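/- Let $M$ be a smooth $n$-dimensional manifold, let $V\to M$ be a smooth real vector bundle of rank $n$, and let $\nabla$ be a flat connection on $V$ (its curvature vanishes). Let $\pi:X=\operatorname{tot}(V)\to M$ be the total space, $j:\pi^*V\to T_X$ the vertical inclusion, $D=(\pi^*\nabla)(S):T_X\to\pi^*V$ where $S$ is the tautological section of $\pi^*V$ (so $D\circ j=1$), and $\alpha:\pi^*T_M\to T_X$ the horizontal lift ($d\pi\circ\alpha=1$, $D\circ\alpha=0$). Put $$F=\begin{pmatrix}D&0\\ d\pi&0\\ 0&j^\vee\\ 0&\alpha^\vee\end{pmatrix}:T_X\oplus T_X^\vee\to\pi^*V\oplus\pi^*T_M\oplus\pi^*V^\vee\oplus\pi^*T_M^\vee,\qquad F^{-1}=\begin{pmatrix}j&\alpha&0&0\\0&0&D^\vee&(d\pi)^\vee\end{pmatrix}.$$ A generalized almost complex structure on a real vector bundle $W$ is a smooth automorphism of $W\oplus W^\vee$ that has square $-1$ and preserves the pairing $\langle v+f,w+g\rangle=-\tfrac12(f(w)+g(v))$. Let $\underline{\mathcal J}$ be a generalized almost complex structure on $V\oplus T_M$ that is adapted: $\underline{\mathcal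 J}(V\oplus V^\vee)=T_M\oplus T_M^\vee$. With respect to $V\oplus T_M\oplus V^\vee\oplus T_M^\vee$ it then has the form $$\underline{\mathcal J}=\begin{pmatrix}0&\mathcal J_{12}&0&\mathcal J_{22}\\ \mathcal J_{13}&0&-\mathcal J_{22}^\vee&0\\ 0&\mathcal J_{31}&0&-\mathcal J_{13}^\vee\\ -\mathcal J_{31}^\vee&0&-\mathcal J_{12}^\vee&0\end{pmatrix}.$$ Let $\mathcal J=F^{-1}(\pi^*\underline{\mathcal J})F$ be the corresponding $\nabla$-semi-flat generalized almost complex structure on $X$ (that is, on the bundle $T_X$). Let $$\mathcal M=\begin{pmatrix}\mathcal J_{13}&\mathcal J_{22}^\vee\\-\mathcal J_{31}^\vee&\mathcal J_{12}^\vee\end{pmatrix}:V\oplus V^\vee\to T_M\oplus T_M^\vee,$$ and let $\mathcal S$ be the sheaf of flat (local, smooth) sections of $V\oplus V^\vee$ for $\nabla$ and its dual connection. The Courant bracket is $$[Y+\xi,Z+\eta]=[Y,Z]+\mathcal L_Y\eta-\mathcal L_Z\xi+\tfrac12\,d(\iota_Z\xi-\iota_Y\eta).$$ Theorem. $\mathcal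 J$ is integrable, i.e. the sheaf of smooth sections of its $+i$ eigenbundle $E\subset(T_X\oplus T_X^\vee)\otimes\mathbb C$ is closed under the (complex bilinear) Courant bracket on $X$, if and only if for every open $U\subseteq M$ and all $\sigma,\tau\in\mathcal S(U)$ one has $[\mathcal M\sigma,\mathcal M\tau]=0$ on $U$. -/

import Mathlib

open Bundle Set VectorField FiberBundle
open scoped Manifold ContDiff Topology

namespace SemiFlat

noncomputable section

/-! ### Generalized geometry on a vector bundle `W` over a manifold `N` -/

section Generalized

variable {E : Type*} [NormedAddCommGroup E] [NormedSpace ℝ E]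
  {H : Type*} [TopologicalSpace H] (I : ModelWithCorners ℝ E H)
  {N : Type*} [TopologicalSpace N] [ChartedSpace H N]
  (G : Type*) [NormedAddCommGroup G] [NormedSpace ℝ G]
  {W : N → Type*} [TopologicalSpace (TotalSpace G W)]
  [∀ x, AddCommGroup (W x)] [∀ x, Module ℝ (W x)] [∀ x, TopologicalSpace (W x)]
  [FiberBundle G W] [VectorBundle ℝ G W]

/-- `s` is a smooth section of `W` over the set `U`
(only the values of `s` on `U` matter when `U` is open). -/
def SmoothSection (s : ∀ x, W x) (U : Set N) : Prop :=
  ContMDiffOn I (I.prod 𝓘(ℝ, G)) ∞ (fun x => TotalSpace.mk' G x (s x)) U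

/-- `η` is a smooth section over `U` of the dual bundle of `W`. -/
def SmoothDualSection (η : ∀ x, W x →L[ℝ] ℝ) (U : Set N) : Prop :=
  ContMDiffOn I (I.prod 𝓘(ℝ, G →L[ℝ] ℝ)) ∞
    (fun x => TotalSpace.mk' (G →L[ℝ] ℝ) (E := fun y => W y →L[ℝ] ℝ) x (η x)) U

/-- The fibre of `W ⊕ W^∨` at `x`. -/
abbrev GenFiber (W : N → Type*) [∀ x, AddCommGroup (W x)] [∀ x, Module ℝ (W x)]
    [∀ x, TopologicalSpace (W x)] (x : N) : Type _ :=
  W x × (W x →L[ℝ] ℝ)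

/-- `a` is a smooth section of `W ⊕ W^∨` over `U`. -/
def SmoothGenSection (a : ∀ x, GenFiber W x) (U : Set N) : Prop :=
  SmoothSection I G (fun x => (a x).1) U ∧ SmoothDualSection I G (fun x => (a x).2) U

/-- The pairing `⟨v + f, w + g⟩ = -(f(w) + g(v)) / 2` on `W_x ⊕ W_x^∨`. -/
def pairing {x : N} (a b : GenFiber W x) : ℝ := -(1 / 2) * (a.2 b.1 + b.2 a.1)

/-- A generalized almost complex structure on the vector bundle `W`: a smooth orthogonal
automorphism of `W ⊕ W^∨` with square `-1`. Smoothness of the bundle map is expressed by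
the fact that it sends smooth local sections to smooth local sections. -/
structure IsGenAlmostComplex (J : ∀ x : N, GenFiber W x →ₗ[ℝ] GenFiber W x) : Prop where
  smooth : ∀ (U : Set N), IsOpen U → ∀ a : ∀ x, GenFiber W x,
    SmoothGenSection I G a U → SmoothGenSection I G (fun x => J x (a x)) U
  sq : ∀ x a, J x (J x a) = -a
  orthogonal : ∀ (x : N) (a b : GenFiber W x), pairing (J x a) (J x b) = pairing a b

end Generalized

/-! ### The Courant bracket and integrability -/

section Courant

variable {E : Type*} [NormedAddCommGroup E] [NormedSpace ℝ E]
  {H : Type*} [TopologicalSpace H] (I : ModelWithCorners ℝ E H)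
  {N : Type*} [TopologicalSpace N] [ChartedSpace H N]

/-- A one-form on `N` (no regularity imposed). -/
abbrev OneForm (N : Type*) [TopologicalSpace N] [ChartedSpace H N] : Type _ :=
  ∀ x : N, TangentSpace I x →L[ℝ] ℝ

/-- A section of `T_N ⊕ T_N^∨` (no regularity imposed). -/
abbrev GenField (N : Type*) [TopologicalSpace N] [ChartedSpace H N] : Type _ :=
  ∀ x : N, GenFiber (TangentSpace I : N → Type _) x

/-- The coordinate expression of the one-form `η` in the preferred chart at `x`,
that is, the pullback of `η` by the inverse of this chart. -/
def coordForm (η : OneForm I N) (x : N) (y : E) : E →L[ℝ] ℝ :=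
  (η ((extChartAt I x).symm y)).comp
    (mfderivWithin 𝓘(ℝ, E) I (extChartAt I x).symm (range I) y)

/-- The exterior derivative of a one-form: at `x` it is the pullback by the preferred chart
at `x` of `(u, v) ↦ D_u η(v) - D_v η(u)`, computed in this chart. -/
def extDerivForm (η : OneForm I N) (x : N) :
    TangentSpace I x →L[ℝ] TangentSpace I x →L[ℝ] ℝ :=
  let A : E →L[ℝ] E →L[ℝ] ℝ := fderivWithin ℝ (coordForm I η x) (range I) (extChartAt I x x)
  let L : TangentSpace I x →L[ℝ] E := mfderiv I 𝓘(ℝ, E) (extChartAt I x) x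
  (ContinuousLinearMap.precomp ℝ L).comp ((A - A.flip).comp L)

/-- The Lie derivative `𝓛_X η = ι_X dη + d(ι_X η)` of a one-form. -/
def lieDerivForm (X : ∀ x : N, TangentSpace I x) (η : OneForm I N) : OneForm I N :=
  fun x => extDerivForm I η x (X x) + mvfderiv I (fun y => η y (X y)) x

/-- The Courant bracket
`[X + ξ, Y + η] = [X, Y] + 𝓛_X η - 𝓛_Y ξ + (1/2) d(ι_Y ξ - ι_X η)`. -/
def courant (a b : GenField I N) : GenField I N := fun x =>
  (mlieBracket I (fun y => (a y).1) (fun y => (b y).1) x,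
    lieDerivForm I (fun y => (a y).1) (fun y => (b y).2) x
      - lieDerivForm I (fun y => (b y).1) (fun y => (a y).2) x
      + (1 / 2 : ℝ) • mvfderiv I (fun y => (a y).2 (b y).1 - (b y).2 (a y).1) x)

/-- A section `re + i im` of `(T_N ⊕ T_N^∨) ⊗ ℂ`. -/
structure ComplexGenField (N : Type*) [TopologicalSpace N] [ChartedSpace H N] where
  re : GenField I N
  im : GenField I N

/-- The complex bilinear extension of the Courant bracket. -/
def complexCourant (a b : ComplexGenField I N) : ComplexGenField I N where
  re := courant I a.re b.re - courant I a.im b.im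
  im := courant I a.re b.im + courant I a.im b.re

variable {I} in
/-- The value of `a = re + i im` at `x` lies in the `+i` eigenspace of `J`:
`J re + i J im = i (re + i im)`. -/
def InEigenbundle (J : ∀ x : N, GenFiber (TangentSpace I) x →ₗ[ℝ] GenFiber (TangentSpace I) x)
    (a : ComplexGenField I N) (x : N) : Prop :=
  J x (a.re x) = -a.im x ∧ J x (a.im x) = a.re x

variable {I} in
/-- `a` is a smooth section over `U` of the `+i` eigenbundle of `J`. -/
def IsEigenSection [IsManifold I 1 N]
    (J : ∀ x : N, GenFiber (TangentSpace I) x →ₗ[ℝ] GenFiber (TangentSpace I) x)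
    (a : ComplexGenField I N) (U : Set N) : Prop :=
  SmoothGenSection I E a.re U ∧ SmoothGenSection I E a.im U ∧ ∀ x ∈ U, InEigenbundle J a x

variable {I} in
/-- Integrability: the sheaf of sections of the `+i` eigenbundle of `J` is closed under the
Courant bracket. (The bracket of two smooth local sections of `(T_N ⊕ T_N^∨) ⊗ ℂ` on a smooth
manifold is always smooth, so the condition is that it has values in the eigenbundle.) -/
def IsIntegrable [IsManifold I ∞ N]
    (J : ∀ x : N, GenFiber (TangentSpace I) x →ₗ[ℝ] GenFiber (TangentSpace I) x) : Prop :=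
  ∀ U : Set N, IsOpen U → ∀ a b : ComplexGenField I N,
    IsEigenSection J a U → IsEigenSection J b U →
    ∀ x ∈ U, InEigenbundle J (complexCourant I a b) x

end Courant

/-! ### Connections, flatness, and the lift to the total space -/

section Connection

variable {E : Type*} [NormedAddCommGroup E] [NormedSpace ℝ E]
  {H : Type*} [TopologicalSpace H] {I : ModelWithCorners ℝ E H}
  {M : Type*} [TopologicalSpace M] [ChartedSpace H M] [IsManifold I ∞ M]
  {F : Type*} [NormedAddCommGroup F] [NormedSpace ℝ F]
  {V : M → Type*} [TopologicalSpace (TotalSpace F V)]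
  [∀ x, AddCommGroup (V x)] [∀ x, Module ℝ (V x)] [∀ x, TopologicalSpace (V x)]
  [∀ x, IsTopologicalAddGroup (V x)] [∀ x, ContinuousSMul ℝ (V x)]
  [FiberBundle F V] [VectorBundle ℝ F V]

/-- The connection sends smooth local sections of `V` to smooth local sections of
`Hom(T_M, V)`. -/
def IsSmoothConnection (D : CovariantDerivative I F V) : Prop :=
  ∀ U : Set M, IsOpen U → ContMDiffCovariantDerivativeOn F ∞ D.toFun U

/-- The connection is flat: its curvature
`R(X, Y) s = ∇_X ∇_Y s - ∇_Y ∇_X s - ∇_[X,Y] s` vanishes.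
Recall that `∇_X s` at `x` is `D s x (X x)`. -/
def IsFlatConnection (D : CovariantDerivative I F V) : Prop :=
  ∀ U : Set M, IsOpen U → ∀ (X Y : ∀ x : M, TangentSpace I x) (s : ∀ x, V x),
    SmoothSection I E X U → SmoothSection I E Y U → SmoothSection I F s U →
    ∀ x ∈ U, D (fun y => D s y (Y y)) x (X x) - D (fun y => D s y (X y)) x (Y x)
      - D s x (mlieBracket I X Y x) = 0

/-- `s` is a flat section of `V` over `U`. -/
def IsFlatSection (D : CovariantDerivative I F V) (s : ∀ x, V x) (U : Set M) : Prop :=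
  SmoothSection I F s U ∧ ∀ x ∈ U, D s x = 0

/-- `f` is a flat section over `U` of `V^∨` for the dual connection, which is given by
`(∇^∨_u f)(s) = d(f(s))(u) - f(∇_u s)`. -/
def IsFlatDualSection (D : CovariantDerivative I F V) (f : ∀ x, V x →L[ℝ] ℝ)
    (U : Set M) : Prop :=
  SmoothDualSection I F f U ∧
    ∀ U' : Set M, IsOpen U' → U' ⊆ U → ∀ s : ∀ x, V x, SmoothSection I F s U' →
      ∀ x ∈ U', ∀ u : TangentSpace I x,
        mvfderiv I (fun y => f y (s y)) x u - f x (D s x u) = 0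

/-- `σ` is a section over `U` of the sheaf `𝓢` of flat sections of `V ⊕ V^∨`. -/
def IsFlatGenSection (D : CovariantDerivative I F V) (σ : ∀ x, GenFiber V x)
    (U : Set M) : Prop :=
  IsFlatSection D (fun x => (σ x).1) U ∧ IsFlatDualSection D (fun x => (σ x).2) U

/-- The vertical inclusion `j : V_{π p} → T_p X`, the derivative of the inclusion of the fibre
through `p` (a fibre is identified with `F` by a linear local trivialization). -/
def vertical (I : ModelWithCorners ℝ E H) (p : TotalSpace F V) :
    V p.proj →L[ℝ] TangentSpace (I.prod 𝓘(ℝ, F)) p :=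
  let e := trivializationAt F V p.proj
  let j₀ : F →L[ℝ] TangentSpace (I.prod 𝓘(ℝ, F)) p :=
    mfderiv 𝓘(ℝ, F) (I.prod 𝓘(ℝ, F)) (fun w : F => TotalSpace.mk' F p.proj (e.symm p.proj w))
      (e p).2
  j₀.comp (e.continuousLinearMapAt ℝ p.proj)

/-- The differential `dπ : T_p X → T_{π p} M` of the projection. -/
def projDeriv (I : ModelWithCorners ℝ E H) (p : TotalSpace F V) :
    TangentSpace (I.prod 𝓘(ℝ, F)) p →L[ℝ] TangentSpace I p.proj :=
  mfderiv (I.prod 𝓘(ℝ, F)) I (fun q : TotalSpace F V => q.proj) p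

/-- The splitting `D = (π^*∇)(S) : T_p X → V_{π p}`, where `S` is the tautological section
of `π^* V`. In the frame `e_i` of `V` given by the local trivialization at `π p`, with fibre
coordinates `ξ_i`, this is `D = e_i ⊗ dξ_i + ξ_i (∇ e_i) ∘ dπ`; here `extend F p.2` is the
local section with constant coefficients `ξ_i(p)` in this frame. -/
def splitting (D : CovariantDerivative I F V) (p : TotalSpace F V) :
    TangentSpace (I.prod 𝓘(ℝ, F)) p →L[ℝ] V p.proj :=
  let e := trivializationAt F V p.proj
  (e.symmL ℝ p.proj).comp (mvfderiv (I.prod 𝓘(ℝ, F)) (fun q : TotalSpace F V => (e q).2) p)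
    + (D (extend F p.2) p.proj).comp (projDeriv I p)

/-- The horizontal lift `α : T_{π p} M → T_p X`, with `dπ ∘ α = 1` and `D ∘ α = 0`:
`α(u) = ds(u) - j(∇_u s)` for a local section `s` of `V` through `p`. -/
def horizontal (D : CovariantDerivative I F V) (p : TotalSpace F V) :
    TangentSpace I p.proj →L[ℝ] TangentSpace (I.prod 𝓘(ℝ, F)) p :=
  let ds : TangentSpace I p.proj →L[ℝ]
      TangentSpace (I.prod 𝓘(ℝ, F)) (TotalSpace.mk' F p.proj (extend F p.2 p.proj)) :=
    mfderiv I (I.prod 𝓘(ℝ, F)) (fun x => TotalSpace.mk' F x (extend F p.2 x)) p.proj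
  (show TangentSpace I p.proj →L[ℝ] TangentSpace (I.prod 𝓘(ℝ, F)) p from ds)
    - (vertical I p).comp (D (extend F p.2) p.proj)

/-- The dual of a linear map. -/
def dualMap {A B : Type*} [AddCommGroup A] [Module ℝ A] [TopologicalSpace A]
    [AddCommGroup B] [Module ℝ B] [TopologicalSpace B] (Q : A →L[ℝ] B) :
    (B →L[ℝ] ℝ) →ₗ[ℝ] (A →L[ℝ] ℝ) where
  toFun φ := φ.comp Q
  map_add' _ _ := rfl
  map_smul' _ _ := rfl

/-- The map `F : T_X ⊕ T_X^∨ → π^*(V ⊕ T_M) ⊕ π^*(V ⊕ T_M)^∨` at `p`, namely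
`(D, dπ)` on `T_X` and the dual `(j^∨, α^∨)` of `(j, α)` on `T_X^∨`. -/
def splitMap (D : CovariantDerivative I F V) (p : TotalSpace F V) :
    GenFiber (TangentSpace (I.prod 𝓘(ℝ, F))) p →ₗ[ℝ]
      GenFiber (V ×ᵇ (TangentSpace I : M → Type _)) p.proj :=
  LinearMap.prodMap ((splitting D p).prod (projDeriv I p)).toLinearMap
    (dualMap ((vertical I p).coprod (horizontal D p)))

/-- The inverse `F⁻¹`, namely `(j, α)` on `π^*(V ⊕ T_M)` and `(D^∨, (dπ)^∨)` on its dual. -/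
def splitMapInv (D : CovariantDerivative I F V) (p : TotalSpace F V) :
    GenFiber (V ×ᵇ (TangentSpace I : M → Type _)) p.proj →ₗ[ℝ]
      GenFiber (TangentSpace (I.prod 𝓘(ℝ, F))) p :=
  LinearMap.prodMap ((vertical I p).coprod (horizontal D p)).toLinearMap
    (dualMap ((splitting D p).prod (projDeriv I p)))

/-- The `∇`-lifted structure `F⁻¹ (π^* J) F` on the total space `X` of `V`. -/
def lift (D : CovariantDerivative I F V)
    (J : ∀ x : M, GenFiber (V ×ᵇ (TangentSpace I : M → Type _)) x →ₗ[ℝ]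
      GenFiber (V ×ᵇ (TangentSpace I : M → Type _)) x) (p : TotalSpace F V) :
    GenFiber (TangentSpace (I.prod 𝓘(ℝ, F))) p →ₗ[ℝ]
      GenFiber (TangentSpace (I.prod 𝓘(ℝ, F))) p :=
  splitMapInv D p ∘ₗ J p.proj ∘ₗ splitMap D p

end Connection

/-! ### Adapted structures and the map `𝓜` -/

section Blocks

variable {E : Type*} [NormedAddCommGroup E] [NormedSpace ℝ E]
  {H : Type*} [TopologicalSpace H] {I : ModelWithCorners ℝ E H}
  {M : Type*} [TopologicalSpace M] [ChartedSpace H M]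
  {V : M → Type*}
  [∀ x, AddCommGroup (V x)] [∀ x, Module ℝ (V x)] [∀ x, TopologicalSpace (V x)]
  {x : M}

/-- The inclusion of `V ⊕ V^∨` in `(V ⊕ T_M) ⊕ (V ⊕ T_M)^∨`. -/
def inclV (I : ModelWithCorners ℝ E H) (V : M → Type*)
    [∀ x, AddCommGroup (V x)] [∀ x, Module ℝ (V x)] [∀ x, TopologicalSpace (V x)] (x : M) :
    GenFiber V x →ₗ[ℝ] GenFiber (V ×ᵇ (TangentSpace I : M → Type _)) x :=
  LinearMap.prodMap (LinearMap.inl ℝ (V x) (TangentSpace I x))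
    (dualMap (ContinuousLinearMap.fst ℝ (V x) (TangentSpace I x)))

/-- The inclusion of `T_M ⊕ T_M^∨` in `(V ⊕ T_M) ⊕ (V ⊕ T_M)^∨`. -/
def inclT (I : ModelWithCorners ℝ E H) (V : M → Type*)
    [∀ x, AddCommGroup (V x)] [∀ x, Module ℝ (V x)] [∀ x, TopologicalSpace (V x)] (x : M) :
    GenFiber (TangentSpace I : M → Type _) x →ₗ[ℝ]
      GenFiber (V ×ᵇ (TangentSpace I : M → Type _)) x :=
  LinearMap.prodMap (LinearMap.inr ℝ (V x) (TangentSpace I x))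
    (dualMap (ContinuousLinearMap.snd ℝ (V x) (TangentSpace I x)))

/-- `J` is adapted: `J(V ⊕ V^∨) = T_M ⊕ T_M^∨`. -/
def IsAdapted (J : ∀ x : M, GenFiber (V ×ᵇ (TangentSpace I : M → Type _)) x →ₗ[ℝ]
    GenFiber (V ×ᵇ (TangentSpace I : M → Type _)) x) : Prop :=
  ∀ x, Submodule.map (J x) (LinearMap.range (inclV I V x)) = LinearMap.range (inclT I V x)

variable (J : GenFiber (V ×ᵇ (TangentSpace I : M → Type _)) x →ₗ[ℝ]
  GenFiber (V ×ᵇ (TangentSpace I : M → Type _)) x)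

/-- The block `J₁₂ : T_M → V`. -/
def block12 : TangentSpace I x →ₗ[ℝ] V x :=
  LinearMap.fst ℝ _ _ ∘ₗ LinearMap.fst ℝ _ _ ∘ₗ J ∘ₗ inclT I V x ∘ₗ LinearMap.inl ℝ _ _

/-- The block `J₁₃ : V → T_M`. -/
def block13 : V x →ₗ[ℝ] TangentSpace I x :=
  LinearMap.snd ℝ _ _ ∘ₗ LinearMap.fst ℝ _ _ ∘ₗ J ∘ₗ inclV I V x ∘ₗ LinearMap.inl ℝ _ _

/-- The block `J₂₂ : T_M^∨ → V`. -/
def block22 : (TangentSpace I x →L[ℝ] ℝ) →ₗ[ℝ] V x :=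
  LinearMap.fst ℝ _ _ ∘ₗ LinearMap.fst ℝ _ _ ∘ₗ J ∘ₗ inclT I V x ∘ₗ LinearMap.inr ℝ _ _

/-- The block `J₃₁ : T_M → V^∨`. -/
def block31 : TangentSpace I x →ₗ[ℝ] (V x →L[ℝ] ℝ) :=
  dualMap (ContinuousLinearMap.inl ℝ (V x) (TangentSpace I x)) ∘ₗ
    LinearMap.snd ℝ _ _ ∘ₗ J ∘ₗ inclT I V x ∘ₗ LinearMap.inl ℝ _ _

variable [FiniteDimensional ℝ E]

/-- A linear form on the (finite-dimensional) tangent space, as a cotangent vector. -/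
def toCotangent (I : ModelWithCorners ℝ E H) (x : M) :
    (TangentSpace I x →ₗ[ℝ] ℝ) →ₗ[ℝ] (TangentSpace I x →L[ℝ] ℝ) :=
  (LinearMap.toContinuousLinearMap (𝕜 := ℝ) (E := E) (F' := ℝ)).toLinearMap

/-- The tangent vector representing an element of the double dual of `T_M`. -/
def ofDoubleDual (I : ModelWithCorners ℝ E H) (x : M) :
    Module.Dual ℝ (Module.Dual ℝ (TangentSpace I x)) →ₗ[ℝ] TangentSpace I x :=
  haveI : FiniteDimensional ℝ (TangentSpace I x) := inferInstanceAs (FiniteDimensional ℝ E)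
  (Module.evalEquiv ℝ (TangentSpace I x)).symm.toLinearMap

/-- The bundle map
`𝓜 = (J₁₃, J₂₂^∨; -J₃₁^∨, J₁₂^∨) : V ⊕ V^∨ → T_M ⊕ T_M^∨`. -/
def mapM (a : GenFiber V x) : GenFiber (TangentSpace I : M → Type _) x :=
  (block13 J a.1 + ofDoubleDual I x (a.2.toLinearMap ∘ₗ block22 J ∘ₗ toCotangent I x),
    -toCotangent I x (LinearMap.applyₗ a.1 ∘ₗ ContinuousLinearMap.coeLM ℝ ∘ₗ block31 J)
      + toCotangent I x (a.2.toLinearMap ∘ₗ block12 J))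

end Blocks

end

end SemiFlat

namespace SemiFlat

noncomputable section

set_option maxSynthPendingDepth 3
set_option linter.unusedSectionVars false

/-! ### The Courant bracket on a normed space -/

section CourantModel

variable {E : Type*} [NormedAddCommGroup E] [NormedSpace ℝ E]

/-- The symmetric pairing `(v + f, w + g) ↦ f(w) + g(v)` on `E ⊕ E^∨`, as a linear form in the
second variable. -/
def pairL (a : E × (E →L[ℝ] ℝ)) : E × (E →L[ℝ] ℝ) →L[ℝ] ℝ :=
  a.2.comp (ContinuousLinearMap.fst ℝ E (E →L[ℝ] ℝ)) +
    (ContinuousLinearMap.apply ℝ ℝ a.1).comp (ContinuousLinearMap.snd ℝ E (E →L[ℝ] ℝ))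

@[simp]
lemma pairL_apply (a b : E × (E →L[ℝ] ℝ)) : pairL a b = a.2 b.1 + b.2 a.1 := rfl

/-- The value of the Courant bracket of two sections of `E ⊕ E^∨` with `1`-jets `(v, P)` and
`(w, Q)`. -/
def courantJet (v : E × (E →L[ℝ] ℝ)) (P : E →L[ℝ] E × (E →L[ℝ] ℝ))
    (w : E × (E →L[ℝ] ℝ)) (Q : E →L[ℝ] E × (E →L[ℝ] ℝ)) : E × (E →L[ℝ] ℝ) :=
  Q v.1 - P w.1 + (0, (1 / 2 : ℝ) • ((pairL w).comp P - (pairL v).comp Q))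

/-- The Courant bracket of two sections of `E ⊕ E^∨` over a normed space. -/
def courantModel (a b : E → E × (E →L[ℝ] ℝ)) (z : E) : E × (E →L[ℝ] ℝ) :=
  courantJet (a z) (fderiv ℝ a z) (b z) (fderiv ℝ b z)

lemma courantModel_eq {a b : E → E × (E →L[ℝ] ℝ)} {z : E} {P Q : E →L[ℝ] E × (E →L[ℝ] ℝ)}
    (ha : HasFDerivAt a P z) (hb : HasFDerivAt b Q z) :
    courantModel a b z = courantJet (a z) P (b z) Q := by
  rw [courantModel, ha.fderiv, hb.fderiv]

lemma courantModel_congr {a a' b b' : E → E × (E →L[ℝ] ℝ)} {z : E}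
    (ha : a =ᶠ[𝓝 z] a') (hb : b =ᶠ[𝓝 z] b') : courantModel a b z = courantModel a' b' z := by
  rw [courantModel, courantModel, ha.fderiv_eq, hb.fderiv_eq, ha.eq_of_nhds, hb.eq_of_nhds]

lemma courantJet_add_left (v v' : E × (E →L[ℝ] ℝ)) (P P' : E →L[ℝ] E × (E →L[ℝ] ℝ))
    (w : E × (E →L[ℝ] ℝ)) (Q : E →L[ℝ] E × (E →L[ℝ] ℝ)) :
    courantJet (v + v') (P + P') w Q = courantJet v P w Q + courantJet v' P' w Q := by
  ext u
  · simp [courantJet]; abel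
  · simp [courantJet]; ring

lemma courantJet_neg_left (v : E × (E →L[ℝ] ℝ)) (P : E →L[ℝ] E × (E →L[ℝ] ℝ))
    (w : E × (E →L[ℝ] ℝ)) (Q : E →L[ℝ] E × (E →L[ℝ] ℝ)) :
    courantJet (-v) (-P) w Q = -courantJet v P w Q := by
  ext u
  · simp [courantJet]; abel
  · simp [courantJet]; ring

lemma courantJet_swap (v : E × (E →L[ℝ] ℝ)) (P : E →L[ℝ] E × (E →L[ℝ] ℝ))
    (w : E × (E →L[ℝ] ℝ)) (Q : E →L[ℝ] E × (E →L[ℝ] ℝ)) :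
    courantJet v P w Q = -courantJet w Q v P := by
  ext u
  · simp [courantJet]
  · simp [courantJet]; ring

lemma courantModel_swap (a b : E → E × (E →L[ℝ] ℝ)) (z : E) :
    courantModel a b z = -courantModel b a z :=
  courantJet_swap _ _ _ _

lemma courantModel_add_left {a a' b : E → E × (E →L[ℝ] ℝ)} {z : E}
    (ha : DifferentiableAt ℝ a z) (ha' : DifferentiableAt ℝ a' z) :
    courantModel (a + a') b z = courantModel a b z + courantModel a' b z := by
  rw [courantModel, fderiv_add ha ha', Pi.add_apply, courantJet_add_left]
  rfl

lemma courantModel_neg_left (a b : E → E × (E →L[ℝ] ℝ)) (z : E) :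
    courantModel (-a) b z = -courantModel a b z := by
  rw [courantModel, fderiv_neg, Pi.neg_apply, courantJet_neg_left]
  rfl

lemma courantModel_neg_right (a b : E → E × (E →L[ℝ] ℝ)) (z : E) :
    courantModel a (-b) z = -courantModel a b z := by
  rw [courantModel_swap, courantModel_neg_left, courantModel_swap b a, neg_neg]

/-- The endomorphism field `J` applied to the section `r`. -/
def endApply (J : E → (E × (E →L[ℝ] ℝ)) →L[ℝ] (E × (E →L[ℝ] ℝ)))
    (r : E → E × (E →L[ℝ] ℝ)) (z : E) : E × (E →L[ℝ] ℝ) := J z (r z)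

/-- The Courant-Nijenhuis torsion of an endomorphism field. -/
def torsionModel (J : E → (E × (E →L[ℝ] ℝ)) →L[ℝ] (E × (E →L[ℝ] ℝ)))
    (r s : E → E × (E →L[ℝ] ℝ)) (z : E) : E × (E →L[ℝ] ℝ) :=
  courantModel (endApply J r) (endApply J s) z
    - J z (courantModel (endApply J r) s z + courantModel r (endApply J s) z)
    - courantModel r s z

variable {J : E → (E × (E →L[ℝ] ℝ)) →L[ℝ] (E × (E →L[ℝ] ℝ))} {z : E}

lemma differentiableAt_endApply (hJ : DifferentiableAt ℝ J z) {r : E → E × (E →L[ℝ] ℝ)}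
    (hr : DifferentiableAt ℝ r z) : DifferentiableAt ℝ (endApply J r) z :=
  hJ.clm_apply hr

lemma endApply_add (r s : E → E × (E →L[ℝ] ℝ)) :
    endApply J (r + s) = endApply J r + endApply J s := by
  ext1 z
  simp [endApply]

lemma torsionModel_swap (r s : E → E × (E →L[ℝ] ℝ)) :
    torsionModel J r s z = -torsionModel J s r z := by
  rw [torsionModel, torsionModel, courantModel_swap (endApply J r) (endApply J s),
    courantModel_swap (endApply J r) s, courantModel_swap r (endApply J s), courantModel_swap r s,
    ← neg_add, map_neg, add_comm (courantModel s _ z)]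
  abel

lemma torsionModel_add_left (hJ : DifferentiableAt ℝ J z) {r r' s : E → E × (E →L[ℝ] ℝ)}
    (hr : DifferentiableAt ℝ r z) (hr' : DifferentiableAt ℝ r' z) :
    torsionModel J (r + r') s z = torsionModel J r s z + torsionModel J r' s z := by
  simp only [torsionModel, endApply_add, courantModel_add_left hr hr',
    courantModel_add_left (differentiableAt_endApply hJ hr) (differentiableAt_endApply hJ hr'),
    map_add]
  abel

lemma torsionModel_endApply_left (hsq : ∀ᶠ y in 𝓝 z, ∀ a, J y (J y a) = -a)
    (r s : E → E × (E →L[ℝ] ℝ)) :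
    torsionModel J (endApply J r) s z = -J z (torsionModel J r s z) := by
  have h : endApply J (endApply J r) =ᶠ[𝓝 z] -r := by
    filter_upwards [hsq] with y hy using hy _
  simp only [torsionModel, courantModel_congr h Filter.EventuallyEq.rfl, courantModel_neg_left,
    map_add, map_sub, map_neg, hsq.self_of_nhds]
  abel

/-- The torsion of an orthogonal almost complex structure depends only on the value of the left
section at the point. -/
lemma torsionModel_eq_zero_of_eq_zero (hJ : DifferentiableAt ℝ J z)
    (hsq : ∀ a, J z (J z a) = -a) (horth : ∀ a b, pairL (J z a) (J z b) = pairL a b)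
    {r s : E → E × (E →L[ℝ] ℝ)} (hr : DifferentiableAt ℝ r z) (hr0 : r z = 0) :
    torsionModel J r s z = 0 := by
  have hskew : ∀ a b, pairL a (J z b) = -pairL (J z a) b := fun a b => by
    rw [← horth a, hsq, map_neg]
  have hJr : HasFDerivAt (endApply J r) ((J z).comp (fderiv ℝ r z)) z := by
    have h := hJ.hasFDerivAt.clm_apply hr.hasFDerivAt
    rwa [hr0, map_zero, add_zero] at h
  have key : ∀ (R : E →L[ℝ] E × (E →L[ℝ] ℝ)) (w : E × (E →L[ℝ] ℝ)) (Q : E →L[ℝ] E × (E →L[ℝ] ℝ)),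
      courantJet 0 R w Q = -R w.1 + (0, (1 / 2 : ℝ) • (pairL w).comp R) := by
    intro R w Q
    ext u <;> simp [courantJet]
  have h0 : endApply J r z = 0 := by simp [endApply, hr0]
  have e1 : (pairL (J z (s z))).comp ((J z).comp (fderiv ℝ r z))
      = (pairL (s z)).comp (fderiv ℝ r z) := by
    ext1 u
    exact horth _ _
  have e2 : (pairL (s z)).comp ((J z).comp (fderiv ℝ r z))
      = -(pairL (J z (s z))).comp (fderiv ℝ r z) := by
    ext1 u
    exact hskew _ _
  rw [torsionModel, courantModel, courantModel, courantModel, courantModel, hJr.fderiv, h0, hr0,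
    key, key, key, key]
  simp only [endApply, ContinuousLinearMap.comp_apply, e1, e2]
  simp only [map_add, map_neg, hsq]
  have e3 : J z (0, (1 / 2 : ℝ) • -(pairL (J z (s z))).comp (fderiv ℝ r z))
      = -J z (0, (1 / 2 : ℝ) • (pairL (J z (s z))).comp (fderiv ℝ r z)) := by
    rw [← map_neg]
    congr 1
    ext <;> simp
  rw [e3]
  abel

/-- If the torsion of `J` vanishes on a family `S` of sections such that `S + J S` spans
`E ⊕ E^∨` at `z`, then it vanishes at `z`. -/
lemma torsionModel_eq_zero_of_span (hJ : DifferentiableAt ℝ J z)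
    (hsq : ∀ᶠ y in 𝓝 z, ∀ a, J y (J y a) = -a) (horth : ∀ a b, pairL (J z a) (J z b) = pairL a b)
    (S : Set (E → E × (E →L[ℝ] ℝ))) (hS : ∀ σ ∈ S, DifferentiableAt ℝ σ z)
    (hspan : ∀ a, ∃ σ ∈ S, ∃ τ ∈ S, a = σ z + J z (τ z))
    (h0 : ∀ σ ∈ S, ∀ τ ∈ S, torsionModel J σ τ z = 0)
    {r s : E → E × (E →L[ℝ] ℝ)} (hr : DifferentiableAt ℝ r z) (hs : DifferentiableAt ℝ s z) :
    torsionModel J r s z = 0 := by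
  have main : ∀ {r : E → E × (E →L[ℝ] ℝ)} (t : E → E × (E →L[ℝ] ℝ)), DifferentiableAt ℝ r z →
      (∀ σ ∈ S, torsionModel J σ t z = 0) → torsionModel J r t z = 0 := by
    intro r t hr ht
    obtain ⟨σ, hσ, τ, hτ, h⟩ := hspan (r z)
    have hd := (hS σ hσ).add (differentiableAt_endApply hJ (hS τ hτ))
    have h1 : torsionModel J (r + -(σ + endApply J τ)) t z = 0 :=
      torsionModel_eq_zero_of_eq_zero hJ hsq.self_of_nhds horth (hr.add hd.neg)
        (by simp [h, endApply])
    have h2 : r = (r + -(σ + endApply J τ)) + (σ + endApply J τ) := by abel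
    rw [h2, torsionModel_add_left hJ (hr.add hd.neg) hd, h1,
      torsionModel_add_left hJ (hS σ hσ) (differentiableAt_endApply hJ (hS τ hτ)), ht σ hσ,
      torsionModel_endApply_left hsq, ht τ hτ]
    simp
  refine main s hr fun σ hσ => ?_
  rw [torsionModel_swap, main σ hs fun τ hτ => h0 τ hτ σ hσ, neg_zero]

end CourantModel

/-! ### Lifts to the total space of a trivial bundle with connection -/

section LiftModel

variable {E : Type*} [NormedAddCommGroup E] [NormedSpace ℝ E]
  {F : Type*} [NormedAddCommGroup F] [NormedSpace ℝ F]

/-- The isomorphism `(vertical, horizontal) : F ⊕ E → E ⊕ F` at the point `z` of the total space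
`E × F` for the connection `d + Γ`. -/
def frameModel (Γ : E → F →L[ℝ] E →L[ℝ] F) (z : E × F) : F × E →L[ℝ] E × F :=
  (ContinuousLinearMap.snd ℝ F E).prod
    (ContinuousLinearMap.fst ℝ F E - (Γ z.1 z.2).comp (ContinuousLinearMap.snd ℝ F E))

/-- The inverse of `frameModel`. -/
def coframeModel (Γ : E → F →L[ℝ] E →L[ℝ] F) (z : E × F) : E × F →L[ℝ] F × E :=
  (ContinuousLinearMap.snd ℝ E F + (Γ z.1 z.2).comp (ContinuousLinearMap.fst ℝ E F)).prod
    (ContinuousLinearMap.fst ℝ E F)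

/-- The lift of a section of `(F ⊕ E) ⊕ (F ⊕ E)^∨` over `E` to the total space `E × F`. -/
def liftModel (Γ : E → F →L[ℝ] E →L[ℝ] F) (c : E → (F × E) × (F × E →L[ℝ] ℝ)) (z : E × F) :
    (E × F) × (E × F →L[ℝ] ℝ) :=
  (frameModel Γ z (c z.1).1, (c z.1).2.comp (coframeModel Γ z))

/-- The inclusion of `F ⊕ F^∨` in `(F ⊕ E) ⊕ (F ⊕ E)^∨`. -/
def inclFst (E : Type*) [NormedAddCommGroup E] [NormedSpace ℝ E]
    {F : Type*} [NormedAddCommGroup F] [NormedSpace ℝ F] (a : F × (F →L[ℝ] ℝ)) :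
    (F × E) × (F × E →L[ℝ] ℝ) :=
  ((a.1, 0), a.2.comp (ContinuousLinearMap.fst ℝ F E))

/-- The inclusion of `E ⊕ E^∨` in `(F ⊕ E) ⊕ (F ⊕ E)^∨`. -/
def inclSnd {E : Type*} [NormedAddCommGroup E] [NormedSpace ℝ E]
    (F : Type*) [NormedAddCommGroup F] [NormedSpace ℝ F] (a : E × (E →L[ℝ] ℝ)) :
    (F × E) × (F × E →L[ℝ] ℝ) :=
  ((0, a.1), a.2.comp (ContinuousLinearMap.snd ℝ F E))

variable {Γ : E → F →L[ℝ] E →L[ℝ] F} {z : E × F}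

lemma contDiffAt_frameModel {n : WithTop ℕ∞} (hΓ : ContDiffAt ℝ n Γ z.1) :
    ContDiffAt ℝ n (frameModel Γ) z := by
  have h : ContDiffAt ℝ n (fun q : E × F => Γ q.1 q.2) z :=
    (hΓ.comp z contDiffAt_fst).clm_apply contDiffAt_snd
  have h2 : ContDiffAt ℝ n (fun q : E × F => ContinuousLinearMap.fst ℝ F E -
      (Γ q.1 q.2).comp (ContinuousLinearMap.snd ℝ F E)) z :=
    contDiffAt_const.sub (h.clm_comp contDiffAt_const)
  exact (ContinuousLinearMap.prodₗᵢ ℝ).toContinuousLinearEquiv.contDiff.contDiffAt.comp z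
    ((contDiffAt_const (c := ContinuousLinearMap.snd ℝ F E)).prodMk h2)

lemma contDiffAt_coframeModel {n : WithTop ℕ∞} (hΓ : ContDiffAt ℝ n Γ z.1) :
    ContDiffAt ℝ n (coframeModel Γ) z := by
  have h : ContDiffAt ℝ n (fun q : E × F => Γ q.1 q.2) z :=
    (hΓ.comp z contDiffAt_fst).clm_apply contDiffAt_snd
  have h2 : ContDiffAt ℝ n (fun q : E × F => ContinuousLinearMap.snd ℝ E F +
      (Γ q.1 q.2).comp (ContinuousLinearMap.fst ℝ E F)) z :=
    contDiffAt_const.add (h.clm_comp contDiffAt_const)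
  exact (ContinuousLinearMap.prodₗᵢ ℝ).toContinuousLinearEquiv.contDiff.contDiffAt.comp z
    (h2.prodMk (contDiffAt_const (c := ContinuousLinearMap.fst ℝ E F)))

lemma contDiffAt_liftModel {n : WithTop ℕ∞} (hΓ : ContDiffAt ℝ n Γ z.1)
    {c : E → (F × E) × (F × E →L[ℝ] ℝ)} (hc : ContDiffAt ℝ n c z.1) :
    ContDiffAt ℝ n (liftModel Γ c) z := by
  have h : ContDiffAt ℝ n (fun q : E × F => c q.1) z := hc.comp z contDiffAt_fst
  exact ((contDiffAt_frameModel hΓ).clm_apply h.fst).prodMk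
    (h.snd.clm_comp (contDiffAt_coframeModel hΓ))

/-- The derivative of the lift of a section `(v, f)` of `F ⊕ F^∨`. -/
lemma hasFDerivAt_liftModel_inclFst {v : E → F} {f : E → F →L[ℝ] ℝ}
    {Γ' : E →L[ℝ] F →L[ℝ] E →L[ℝ] F} {v' : E →L[ℝ] F} {f' : E →L[ℝ] F →L[ℝ] ℝ}
    (hΓ : HasFDerivAt Γ Γ' z.1) (hv : HasFDerivAt v v' z.1) (hf : HasFDerivAt f f' z.1) :
    ∃ P : E × F →L[ℝ] (E × F) × (E × F →L[ℝ] ℝ),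
      HasFDerivAt (liftModel Γ fun y => inclFst E (v y, f y)) P z ∧
      ∀ h k, (P (h, k)).1 = (0, v' h) ∧ ∀ u l, (P (h, k)).2 (u, l) =
        f' h (l + Γ z.1 z.2 u) + f z.1 (Γ' h z.2 u + Γ z.1 k u) := by
  have h1 : HasFDerivAt (fun q : E × F => (v q.1)) (v'.comp (ContinuousLinearMap.fst ℝ E F)) z :=
    hv.comp z hasFDerivAt_fst
  have h2 : HasFDerivAt (fun q : E × F => (f q.1)) (f'.comp (ContinuousLinearMap.fst ℝ E F)) z :=
    hf.comp z hasFDerivAt_fst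
  have h3 : HasFDerivAt (fun q : E × F => (Γ q.1)) (Γ'.comp (ContinuousLinearMap.fst ℝ E F)) z :=
    HasFDerivAt.comp (g := Γ) (f := Prod.fst) z hΓ hasFDerivAt_fst
  have h4 := h3.clm_apply (hasFDerivAt_snd (𝕜 := ℝ) (p := z))
  have h5 := (h4.clm_comp (hasFDerivAt_const (ContinuousLinearMap.fst ℝ E F) z)).const_add
    (ContinuousLinearMap.snd ℝ E F)
  have h6 := ((hasFDerivAt_const (0 : E) z).prodMk h1).prodMk (h2.clm_comp h5)
  have h7 : (liftModel Γ fun y => inclFst E (v y, f y)) = fun q : E × F =>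
      (((0 : E), v q.1), (f q.1).comp (ContinuousLinearMap.snd ℝ E F +
        (Γ q.1 q.2).comp (ContinuousLinearMap.fst ℝ E F))) := by
    funext q
    ext <;> simp [liftModel, inclFst, frameModel, coframeModel]
  rw [h7]
  refine ⟨_, h6, fun h k => ⟨?_, fun u l => ?_⟩⟩
  · simp
  · simp
    ring

/-- The derivative of the lift of a section `(Y, η)` of `E ⊕ E^∨`. -/
lemma hasFDerivAt_liftModel_inclSnd {Y : E → E} {η : E → E →L[ℝ] ℝ}
    {Γ' : E →L[ℝ] F →L[ℝ] E →L[ℝ] F} {Y' : E →L[ℝ] E} {η' : E →L[ℝ] E →L[ℝ] ℝ}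
    (hΓ : HasFDerivAt Γ Γ' z.1) (hY : HasFDerivAt Y Y' z.1) (hη : HasFDerivAt η η' z.1) :
    ∃ P : E × F →L[ℝ] (E × F) × (E × F →L[ℝ] ℝ),
      HasFDerivAt (liftModel Γ fun y => inclSnd F (Y y, η y)) P z ∧
      ∀ h k, (P (h, k)).1 = (Y' h, -(Γ' h z.2 (Y z.1) + Γ z.1 k (Y z.1) + Γ z.1 z.2 (Y' h))) ∧
        ∀ u l, (P (h, k)).2 (u, l) = η' h u := by
  have h1 : HasFDerivAt (fun q : E × F => (Y q.1)) (Y'.comp (ContinuousLinearMap.fst ℝ E F)) z :=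
    hY.comp z hasFDerivAt_fst
  have h2 : HasFDerivAt (fun q : E × F => (η q.1)) (η'.comp (ContinuousLinearMap.fst ℝ E F)) z :=
    hη.comp z hasFDerivAt_fst
  have h3 : HasFDerivAt (fun q : E × F => (Γ q.1)) (Γ'.comp (ContinuousLinearMap.fst ℝ E F)) z :=
    HasFDerivAt.comp (g := Γ) (f := Prod.fst) z hΓ hasFDerivAt_fst
  have h4 := (h3.clm_apply (hasFDerivAt_snd (𝕜 := ℝ) (p := z))).clm_apply h1
  have h5 := h2.clm_comp (hasFDerivAt_const (ContinuousLinearMap.fst ℝ E F) z)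
  have h6 := (h1.prodMk h4.neg).prodMk h5
  have h7 : (liftModel Γ fun y => inclSnd F (Y y, η y)) = fun q : E × F =>
      ((Y q.1, -Γ q.1 q.2 (Y q.1)), (η q.1).comp (ContinuousLinearMap.fst ℝ E F)) := by
    funext q
    ext <;> simp [liftModel, inclSnd, frameModel, coframeModel]
  rw [h7]
  refine ⟨_, h6, fun h k => ⟨?_, fun u l => ?_⟩⟩
  · simp
    abel
  · simp

section Flat

variable {v v₁ : E → F} {f f₁ : E → F →L[ℝ] ℝ} {Γ' : E →L[ℝ] F →L[ℝ] E →L[ℝ] F}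
  {f' f₁' : E →L[ℝ] F →L[ℝ] ℝ} {Y Y₁ : E → E} {η η₁ : E → E →L[ℝ] ℝ}

/-- Lifts of parallel sections of `F ⊕ F^∨` have vanishing Courant bracket. -/
lemma courantModel_lift_parallel (hΓ : HasFDerivAt Γ Γ' z.1)
    (hv : HasFDerivAt v (-Γ z.1 (v z.1)) z.1) (hv₁ : HasFDerivAt v₁ (-Γ z.1 (v₁ z.1)) z.1)
    (hf : HasFDerivAt f f' z.1) (hf' : ∀ h w, f' h w = f z.1 (Γ z.1 w h))
    (hf₁ : HasFDerivAt f₁ f₁' z.1) (hf₁' : ∀ h w, f₁' h w = f₁ z.1 (Γ z.1 w h)) :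
    courantModel (liftModel Γ fun y => inclFst E (v y, f y))
      (liftModel Γ fun y => inclFst E (v₁ y, f₁ y)) z = 0 := by
  obtain ⟨P, hP, hP'⟩ := hasFDerivAt_liftModel_inclFst hΓ hv hf
  obtain ⟨Q, hQ, hQ'⟩ := hasFDerivAt_liftModel_inclFst hΓ hv₁ hf₁
  rw [courantModel_eq hP hQ]
  refine Prod.ext ?_ (ContinuousLinearMap.ext fun ⟨u, l⟩ => ?_)
  · simp [courantJet, liftModel, inclFst, frameModel, hP', hQ']
  · simp [courantJet, liftModel, inclFst, frameModel, coframeModel, hP', hQ', hf', hf₁']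
    ring

/-- Lifts of a parallel section of `F ⊕ F^∨` and of a section of `E ⊕ E^∨` have vanishing
Courant bracket. -/
lemma courantModel_lift_parallel_horizontal (hΓ : HasFDerivAt Γ Γ' z.1)
    (hcurv : ∀ w u u', Γ' u w u' - Γ' u' w u + Γ z.1 (Γ z.1 w u') u
      - Γ z.1 (Γ z.1 w u) u' = 0)
    (hv : HasFDerivAt v (-Γ z.1 (v z.1)) z.1)
    (hf : HasFDerivAt f f' z.1) (hf' : ∀ h w, f' h w = f z.1 (Γ z.1 w h))
    (hY : DifferentiableAt ℝ Y z.1) (hη : DifferentiableAt ℝ η z.1) :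
    courantModel (liftModel Γ fun y => inclFst E (v y, f y))
      (liftModel Γ fun y => inclSnd F (Y y, η y)) z = 0 := by
  obtain ⟨P, hP, hP'⟩ := hasFDerivAt_liftModel_inclFst hΓ hv hf
  obtain ⟨Q, hQ, hQ'⟩ := hasFDerivAt_liftModel_inclSnd hΓ hY.hasFDerivAt hη.hasFDerivAt
  rw [courantModel_eq hP hQ]
  refine Prod.ext ?_ (ContinuousLinearMap.ext fun ⟨u, l⟩ => ?_)
  · simp [courantJet, liftModel, inclFst, inclSnd, frameModel, hP', hQ']
  · have h := congrArg (f z.1) (hcurv z.2 u (Y z.1))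
    simp only [map_add, map_sub, map_zero] at h
    simp [courantJet, liftModel, inclFst, inclSnd, frameModel, coframeModel, hP', hQ', hf']
    linarith

/-- The lift of sections of `E ⊕ E^∨` is compatible with the Courant bracket. -/
lemma courantModel_lift_horizontal (hΓ : HasFDerivAt Γ Γ' z.1)
    (hcurv : ∀ w u u', Γ' u w u' - Γ' u' w u + Γ z.1 (Γ z.1 w u') u
      - Γ z.1 (Γ z.1 w u) u' = 0)
    (hY : DifferentiableAt ℝ Y z.1) (hη : DifferentiableAt ℝ η z.1)
    (hY₁ : DifferentiableAt ℝ Y₁ z.1) (hη₁ : DifferentiableAt ℝ η₁ z.1) :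
    courantModel (liftModel Γ fun y => inclSnd F (Y y, η y))
      (liftModel Γ fun y => inclSnd F (Y₁ y, η₁ y)) z =
    liftModel Γ (fun y => inclSnd F (courantModel (fun y => (Y y, η y))
      (fun y => (Y₁ y, η₁ y)) y)) z := by
  obtain ⟨P, hP, hP'⟩ := hasFDerivAt_liftModel_inclSnd hΓ hY.hasFDerivAt hη.hasFDerivAt
  obtain ⟨Q, hQ, hQ'⟩ := hasFDerivAt_liftModel_inclSnd hΓ hY₁.hasFDerivAt hη₁.hasFDerivAt
  rw [courantModel_eq hP hQ]
  simp only [liftModel]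
  rw [courantModel_eq (hY.hasFDerivAt.prodMk hη.hasFDerivAt)
    (hY₁.hasFDerivAt.prodMk hη₁.hasFDerivAt)]
  refine Prod.ext (Prod.ext ?_ ?_) (ContinuousLinearMap.ext fun ⟨u, l⟩ => ?_)
  · simp [courantJet, inclSnd, frameModel, hP', hQ']
  · have h := hcurv z.2 (Y z.1) (Y₁ z.1)
    simp [courantJet, inclSnd, frameModel, hP', hQ']
    rw [← sub_eq_zero, ← neg_eq_zero, ← h]
    abel
  · simp [courantJet, inclSnd, frameModel, coframeModel, hP', hQ']

end Flat

end LiftModel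

/-! ### Parallel sections of a flat connection on a trivial bundle -/

section Parallel

open Metric NNReal

variable {E : Type*} [NormedAddCommGroup E] [NormedSpace ℝ E]
  {F : Type*} [NormedAddCommGroup F] [NormedSpace ℝ F]
  {Γ : E → F →L[ℝ] E →L[ℝ] F} {y₀ : E} {ρ C : ℝ}

/-- `α` is parallel along the segment `t ↦ y₀ + t x`, `0 ≤ t ≤ 1`, for the connection `d + Γ`. -/
def IsRadialSolution (Γ : E → F →L[ℝ] E →L[ℝ] F) (y₀ x : E) (α : ℝ → F) : Prop :=
  ∀ t ∈ Icc (0 : ℝ) 1, HasDerivWithinAt α (-(Γ (y₀ + t • x) (α t) x)) (Icc 0 1) t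

lemma add_smul_mem_ball {x : E} (hx : ‖x‖ < ρ) {t : ℝ} (ht : t ∈ Icc (0 : ℝ) 1) :
    y₀ + t • x ∈ ball y₀ ρ := by
  rw [mem_ball, dist_eq_norm, add_sub_cancel_left, norm_smul, Real.norm_of_nonneg ht.1]
  exact (mul_le_of_le_one_left (norm_nonneg x) ht.2).trans_lt hx

lemma norm_apply₂_le {T : F →L[ℝ] E →L[ℝ] F} {a b c : ℝ} {w : F} {u : E} (hT : ‖T‖ ≤ a)
    (hw : ‖w‖ ≤ b) (hu : ‖u‖ ≤ c) : ‖T w u‖ ≤ a * b * c := by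
  have ha := (norm_nonneg T).trans hT
  have hb := (norm_nonneg w).trans hw
  refine (T.le_opNorm₂ w u).trans ?_
  gcongr

lemma lipschitzWith_apply (T : F →L[ℝ] E →L[ℝ] F) (x : E) {K : ℝ≥0} (hK : ‖T‖ * ‖x‖ ≤ K) :
    LipschitzWith K fun w => -(T w x) := by
  refine LipschitzWith.of_dist_le_mul fun w w' => ?_
  have h : -(T w x) - -(T w' x) = -(T (w - w') x) := by
    rw [map_sub, _root_.sub_apply]
    abel
  rw [dist_eq_norm, dist_eq_norm, h, norm_neg]
  calc ‖T (w - w') x‖ ≤ ‖T‖ * ‖w - w'‖ * ‖x‖ := T.le_opNorm₂ _ _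
    _ = ‖T‖ * ‖x‖ * ‖w - w'‖ := by ring
    _ ≤ K * ‖w - w'‖ := by gcongr

lemma exists_radialSolution [CompleteSpace F] (hc : ContinuousOn Γ (ball y₀ ρ))
    (hC : ∀ y ∈ ball y₀ ρ, ‖Γ y‖ ≤ C) (s₀ : F) {x : E} (hx : ‖x‖ < ρ)
    (hx' : C * (‖s₀‖ + 1) * ‖x‖ ≤ 1) : ∃ α, α 0 = s₀ ∧ IsRadialSolution Γ y₀ x α := by
  have hρ : 0 < ρ := (norm_nonneg x).trans_lt hx
  have hC0 : 0 ≤ C := (norm_nonneg _).trans (hC y₀ (mem_ball_self hρ))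
  have hpl : IsPicardLindelof (fun t w => -(Γ (y₀ + t • x) w x)) (tmin := 0) (tmax := 1)
      ⟨0, by simp⟩ s₀ 1 0 1 (NNReal.mk (C * ‖x‖) (by positivity)) := by
    refine ⟨fun t ht => ?_, fun w _ => ?_, fun t ht w hw => ?_, by simp⟩
    · refine (lipschitzWith_apply _ x ?_).lipschitzOnWith
      rw [NNReal.coe_mk]
      gcongr
      exact hC _ (add_smul_mem_ball hx ht)
    · have h : ContinuousOn (fun t : ℝ => Γ (y₀ + t • x)) (Icc 0 1) :=
        hc.comp (by fun_prop) fun t ht => add_smul_mem_ball hx ht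
      exact ((h.clm_apply continuousOn_const).clm_apply continuousOn_const).neg
    · rw [norm_neg]
      refine (norm_apply₂_le (hC _ (add_smul_mem_ball hx ht)) (b := ‖s₀‖ + 1) ?_ le_rfl).trans
        (by simpa using hx')
      have h1 : ‖w - s₀‖ ≤ 1 := by simpa [mem_closedBall, dist_eq_norm] using hw
      linarith [norm_le_norm_add_norm_sub' w s₀]
  obtain ⟨α, h0, hα⟩ := hpl.exists_eq_forall_mem_Icc_hasDerivWithinAt₀
  exact ⟨α, h0, hα⟩

/-- The first order behaviour of parallel transport along segments, for a flat connection. -/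
lemma radialSolution_estimate {Γ' : E → E →L[ℝ] F →L[ℝ] E →L[ℝ] F} {C₁ : ℝ} {C₂ : ℝ≥0}
    (hd : ∀ y ∈ ball y₀ ρ, HasFDerivAt Γ (Γ' y) y) (hC : ∀ y ∈ ball y₀ ρ, ‖Γ y‖ ≤ C)
    (hC₁ : ∀ y ∈ ball y₀ ρ, ‖Γ' y‖ ≤ C₁) (hC₂ : LipschitzOnWith C₂ Γ' (ball y₀ ρ))
    (hcurv : ∀ y ∈ ball y₀ ρ, ∀ w u u', Γ' y u w u' - Γ' y u' w u + Γ y (Γ y w u') u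
      - Γ y (Γ y w u) u' = 0) {x : E} (hx : ‖x‖ < ρ) {σ : ℝ → F}
    (hσ : IsRadialSolution Γ y₀ x σ) :
    ∃ K : ℝ, ∀ h, ‖x + h‖ < ρ → ∀ u, IsRadialSolution Γ y₀ (x + h) u → u 0 = σ 0 →
      ‖u 1 - (σ 1 - Γ (y₀ + x) (σ 1) h)‖ ≤ K * ‖h‖ ^ 2 := by
  have hρ : 0 < ρ := (norm_nonneg x).trans_lt hx
  have hC0 : 0 ≤ C := (norm_nonneg _).trans (hC y₀ (mem_ball_self hρ))
  have hC10 : 0 ≤ C₁ := (norm_nonneg _).trans (hC₁ y₀ (mem_ball_self hρ))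
  have hσc : ContinuousOn σ (Icc 0 1) := fun t ht => (hσ t ht).continuousWithinAt
  obtain ⟨S, hS⟩ := isCompact_Icc.exists_bound_of_continuousOn hσc
  have hS0 : 0 ≤ S := (norm_nonneg _).trans (hS 0 (by simp))
  set W : ℝ := S + C * S * (2 * ρ) with hW
  have hW0 : 0 ≤ W := by positivity
  set K₂ : ℝ := C * (C * S) + C₁ * (C * S) * ρ + C₁ * W + C₂ * W * ρ with hK₂
  let K : ℝ≥0 := NNReal.mk (C * ρ) (by positivity)
  refine ⟨K₂ * gronwallBound 0 K 1 1, fun h hxh u hu hu0 => ?_⟩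
  have hh : ‖h‖ ≤ 2 * ρ := by
    have : h = (x + h) - x := by abel
    rw [this]
    linarith [norm_sub_le (x + h) x]
  have huc : ContinuousOn u (Icc 0 1) := fun t ht => (hu t ht).continuousWithinAt
  -- the approximate solution
  let w : ℝ → F := fun t => σ t - t • Γ (y₀ + t • x) (σ t) h
  let w' : ℝ → F := fun t => -(Γ (y₀ + t • x) (σ t) x)
    - (Γ (y₀ + t • x) (σ t) h + t • (Γ' (y₀ + t • x) x (σ t) h
      - Γ (y₀ + t • x) (Γ (y₀ + t • x) (σ t) x) h))
  have hw : ∀ t ∈ Icc (0 : ℝ) 1, HasDerivWithinAt w (w' t) (Icc 0 1) t := by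
    intro t ht
    have h1 : HasDerivWithinAt (fun t : ℝ => y₀ + t • x) x (Icc 0 1) t := by
      simpa using ((hasDerivWithinAt_id t (Icc (0 : ℝ) 1)).smul_const x).const_add y₀
    have h2 := (hd _ (add_smul_mem_ball hx ht)).comp_hasDerivWithinAt t h1
    have h3 := ((h2.clm_apply (hσ t ht)).clm_apply
      (hasDerivWithinAt_const t (Icc (0 : ℝ) 1) h))
    have h4 := (hσ t ht).sub ((hasDerivWithinAt_id t (Icc (0 : ℝ) 1)).smul h3)
    refine h4.congr_deriv ?_
    simp only [w', Function.comp, _root_.add_apply, map_neg, map_zero,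
      _root_.neg_apply, id, one_smul, add_zero]
    module
  have hwc : ContinuousOn w (Icc 0 1) := fun t ht => (hw t ht).continuousWithinAt
  have toIci : ∀ {f : ℝ → F} {f' : F} {t : ℝ}, t ∈ Ico (0 : ℝ) 1 →
      HasDerivWithinAt f f' (Icc 0 1) t → HasDerivWithinAt f f' (Ici t) t :=
    fun ht hf => hf.mono_of_mem_nhdsWithin (Icc_mem_nhdsGE_of_mem ht)
  have herr : ∀ t ∈ Ico (0 : ℝ) 1,
      dist (w' t) (-(Γ (y₀ + t • (x + h)) (w t) (x + h))) ≤ K₂ * ‖h‖ ^ 2 := by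
    intro t ht'
    have ht := Ico_subset_Icc_self ht'
    have hp := add_smul_mem_ball (y₀ := y₀) hx ht
    have hq := add_smul_mem_ball (y₀ := y₀) hxh ht
    set p := y₀ + t • x with hpdef
    set q := y₀ + t • (x + h) with hqdef
    have hqp : q - p = t • h := by rw [hpdef, hqdef]; module
    have hth : ‖t • h‖ ≤ ‖h‖ := by
      rw [norm_smul, Real.norm_of_nonneg ht.1]
      exact mul_le_of_le_one_left (norm_nonneg h) ht.2
    set R := Γ q - Γ p - Γ' p (t • h) with hRdef
    have hR : ‖R‖ ≤ C₂ * ‖h‖ ^ 2 := by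
      have hseg : segment ℝ p q ⊆ ball y₀ ρ := (convex_ball y₀ ρ).segment_subset hp hq
      have h1 : ‖Γ q - Γ p - Γ' p (q - p)‖ ≤ C₂ * ‖h‖ * ‖q - p‖ := by
        refine (convex_segment p q).norm_image_sub_le_of_norm_hasFDerivWithin_le'
          (fun y hy => (hd y (hseg hy)).hasFDerivWithinAt) (fun y hy => ?_)
          (left_mem_segment ℝ p q) (right_mem_segment ℝ p q)
        refine (hC₂.norm_sub_le (hseg hy) hp).trans ?_
        gcongr
        refine le_trans ?_ hth
        rw [← hqp]
        exact norm_sub_le_of_mem_segment hy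
      rw [hqp] at h1
      refine h1.trans ?_
      rw [pow_two, ← mul_assoc]
      gcongr
    have hΓq : Γ q = Γ p + t • Γ' p h + R := by
      rw [hRdef, map_smul]
      abel
    have hσt := hS t ht
    have hGσ : ‖Γ p (σ t) h‖ ≤ C * S * ‖h‖ := norm_apply₂_le (hC p hp) hσt le_rfl
    have hwt : ‖w t‖ ≤ W := by
      refine (norm_sub_le _ _).trans (add_le_add hσt ?_)
      rw [norm_smul, Real.norm_of_nonneg ht.1]
      calc t * ‖Γ p (σ t) h‖ ≤ 1 * (C * S * ‖h‖) := by
            gcongr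
            exact ht.2
        _ ≤ C * S * (2 * ρ) := by
            rw [one_mul]
            gcongr
    have e : w' t - -(Γ q (w t) (x + h)) =
        -(t • Γ p (Γ p (σ t) h) h) - t • t • Γ' p h (Γ p (σ t) h) x
        + t • Γ' p h (w t) h + R (w t) (x + h) := by
      have hc := congrArg (fun v => t • v) (hcurv p hp (σ t) h x)
      simp only [smul_zero] at hc
      rw [hΓq, ← sub_eq_zero, ← hc]
      simp only [w', w, ← hpdef, _root_.add_apply, _root_.smul_apply,
        map_add, map_sub, map_smul, _root_.sub_apply]
      module
    have hΓ'h : ‖Γ' p h‖ ≤ C₁ * ‖h‖ := ((Γ' p).le_opNorm h).trans (by gcongr; exact hC₁ p hp)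
    have smul_le : ∀ v : F, ‖t • v‖ ≤ ‖v‖ := fun v => by
      rw [norm_smul, Real.norm_of_nonneg ht.1]
      exact mul_le_of_le_one_left (norm_nonneg v) ht.2
    rw [dist_eq_norm, e]
    have b1 : ‖-(t • Γ p (Γ p (σ t) h) h)‖ ≤ C * (C * S * ‖h‖) * ‖h‖ := by
      rw [norm_neg]
      exact (smul_le _).trans (norm_apply₂_le (hC p hp) hGσ le_rfl)
    have b2 : ‖t • t • Γ' p h (Γ p (σ t) h) x‖ ≤ C₁ * ‖h‖ * (C * S * ‖h‖) * ρ :=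
      (smul_le _).trans ((smul_le _).trans (norm_apply₂_le hΓ'h hGσ hx.le))
    have b3 : ‖t • Γ' p h (w t) h‖ ≤ C₁ * ‖h‖ * W * ‖h‖ :=
      (smul_le _).trans (norm_apply₂_le hΓ'h hwt le_rfl)
    have b4 : ‖R (w t) (x + h)‖ ≤ C₂ * ‖h‖ ^ 2 * W * ρ := norm_apply₂_le hR hwt hxh.le
    refine (norm_add_le _ _).trans ((add_le_add ((norm_add_le _ _).trans
      (add_le_add ((norm_sub_le _ _).trans (add_le_add b1 b2)) b3)) b4).trans (le_of_eq ?_))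
    rw [hK₂]
    ring
  have hlip : ∀ t ∈ Ico (0 : ℝ) 1,
      LipschitzOnWith K (fun v => -(Γ (y₀ + t • (x + h)) v (x + h))) univ := by
    intro t ht
    refine (lipschitzWith_apply _ _ ?_).lipschitzOnWith
    rw [show (K : ℝ) = C * ρ from rfl]
    gcongr
    exact hC _ (add_smul_mem_ball hxh (Ico_subset_Icc_self ht))
  have main := dist_le_of_approx_trajectories_ODE_of_mem (δ := 0) (εf := 0) hlip huc
    (fun t ht => toIci ht (hu t (Ico_subset_Icc_self ht))) (fun t _ => (dist_self _).le)
    (fun _ _ => mem_univ _) hwc (fun t ht => toIci ht (hw t (Ico_subset_Icc_self ht))) herr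
    (fun _ _ => mem_univ _) (by simp [w, hu0]) 1 (by simp)
  rw [dist_eq_norm] at main
  simp only [w, one_smul, zero_add, sub_zero] at main
  refine main.trans (le_of_eq ?_)
  by_cases hK : (K : ℝ) = 0
  · rw [hK, gronwallBound_K0, gronwallBound_K0]
    ring
  · rw [gronwallBound_of_K_ne_0 hK, gronwallBound_of_K_ne_0 hK]
    ring

/-- A flat connection on a trivial bundle has parallel sections through every vector. -/
theorem exists_parallel [CompleteSpace F] (hΓ : ContDiffAt ℝ ∞ Γ y₀)
    (hcurv : ∀ᶠ y in 𝓝 y₀, ∀ w u u', fderiv ℝ Γ y u w u' - fderiv ℝ Γ y u' w u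
      + Γ y (Γ y w u') u - Γ y (Γ y w u) u' = 0) (s₀ : F) :
    ∃ s : E → F, s y₀ = s₀ ∧ ∀ᶠ y in 𝓝 y₀, HasFDerivAt s (-Γ y (s y)) y := by
  have h2 : ContDiffAt ℝ 2 Γ y₀ := hΓ.of_le (by norm_cast)
  have hd : ∀ᶠ y in 𝓝 y₀, HasFDerivAt Γ (fderiv ℝ Γ y) y := by
    filter_upwards [h2.eventually (by simp)] with y hy
    exact (hy.differentiableAt (by simp)).hasFDerivAt
  have h1 : ContDiffAt ℝ 1 (fderiv ℝ Γ) y₀ := h2.fderiv_right (by norm_num)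
  obtain ⟨C₂, N, hN, hC₂⟩ := h1.exists_lipschitzOnWith
  have hC : ∀ᶠ y in 𝓝 y₀, ‖Γ y‖ ≤ ‖Γ y₀‖ + 1 :=
    (h2.continuousAt.norm.eventually (gt_mem_nhds (lt_add_one _))).mono fun _ h => le_of_lt h
  have hC₁ : ∀ᶠ y in 𝓝 y₀, ‖fderiv ℝ Γ y‖ ≤ ‖fderiv ℝ Γ y₀‖ + 1 :=
    (h1.continuousAt.norm.eventually (gt_mem_nhds (lt_add_one _))).mono fun _ h => le_of_lt h
  obtain ⟨ρ, hρ, hball⟩ := Metric.eventually_nhds_iff_ball.1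
    (hd.and (hC.and (hC₁.and (hcurv.and (Filter.eventually_mem_set.2 hN)))))
  set C := ‖Γ y₀‖ + 1
  have hC0 : 0 < C * (‖s₀‖ + 1) := by positivity
  set r := min ρ (1 / (C * (‖s₀‖ + 1))) with hr
  have hr0 : 0 < r := by positivity
  have hex : ∀ x : E, ‖x‖ < r → ∃ α, α 0 = s₀ ∧ IsRadialSolution Γ y₀ x α := fun x hx =>
    exists_radialSolution (fun y hy => (hball y hy).1.continuousAt.continuousWithinAt)
      (fun y hy => (hball y hy).2.1) s₀ (hx.trans_le (min_le_left _ _)) (by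
        have := (lt_div_iff₀' hC0).1 (hx.trans_le (min_le_right _ _))
        exact this.le)
  choose! α hα0 hα using hex
  have hball' : ∀ y ∈ ball y₀ r, y ∈ ball y₀ ρ := fun y hy =>
    ball_subset_ball (min_le_left _ _) hy
  refine ⟨fun y => α (y - y₀) 1, ?_, ?_⟩
  · have hz : ‖y₀ - y₀‖ < r := by simpa using hr0
    have hc := hα _ hz
    rw [← hα0 _ hz]
    refine constant_of_has_deriv_right_zero (fun t ht => (hc t ht).continuousWithinAt)
      (fun t ht => ?_) 1 (by simp)
    have := (hc t (Ico_subset_Icc_self ht)).mono_of_mem_nhdsWithin (Icc_mem_nhdsGE_of_mem ht)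
    simpa using this
  · filter_upwards [ball_mem_nhds y₀ hr0] with y hy
    have hy' : ‖y - y₀‖ < r := by rwa [← dist_eq_norm]
    obtain ⟨K, hK⟩ := radialSolution_estimate (fun y hy => (hball y (hball' y hy)).1)
      (fun y hy => (hball y (hball' y hy)).2.1) (fun y hy => (hball y (hball' y hy)).2.2.1)
      (hC₂.mono fun y hy => (hball y (hball' y hy)).2.2.2.2)
      (fun y hy => (hball y (hball' y hy)).2.2.2.1) hy' (hα _ hy')
    rw [hasFDerivAt_iff_isLittleO_nhds_zero]
    have hO : (fun h : E => α (y + h - y₀) 1 - α (y - y₀) 1 - (-Γ y (α (y - y₀) 1)) h)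
        =O[𝓝 0] fun h => ‖h‖ ^ 2 := by
      refine Asymptotics.IsBigO.of_bound K ?_
      have hcont : Filter.Tendsto (fun h : E => ‖y - y₀ + h‖) (𝓝 0) (𝓝 ‖y - y₀ + 0‖) :=
        (continuous_const.add continuous_id).norm.tendsto 0
      rw [add_zero] at hcont
      filter_upwards [hcont.eventually (gt_mem_nhds hy')] with h hh
      have hlt : ‖y - y₀ + h‖ < r := hh
      have := hK h hlt _ (hα _ hlt) (by rw [hα0 _ hlt, hα0 _ hy'])
      rw [add_sub_cancel] at this
      rw [add_sub_right_comm, norm_pow, norm_norm]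
      refine le_trans (le_of_eq ?_) this
      congr 1
      simp only [_root_.neg_apply]
      abel
    exact hO.trans_isLittleO (Asymptotics.isLittleO_norm_pow_id one_lt_two)

end Parallel

/-! ### Sections of `W ⊕ W^∨` in coordinates -/

section Coordinates

variable {E : Type*} [NormedAddCommGroup E] [NormedSpace ℝ E]
  {H : Type*} [TopologicalSpace H] (I : ModelWithCorners ℝ E H)
  {N : Type*} [TopologicalSpace N] [ChartedSpace H N]
  (G : Type*) [NormedAddCommGroup G] [NormedSpace ℝ G]
  {W : N → Type*} [TopologicalSpace (TotalSpace G W)]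
  [∀ x, AddCommGroup (W x)] [∀ x, Module ℝ (W x)] [∀ x, TopologicalSpace (W x)]
  [FiberBundle G W] [VectorBundle ℝ G W]

/-- The coordinates of an element of `W_x ⊕ W_x^∨` in the preferred trivialization at `x₀`. -/
def genCoord (x₀ x : N) : GenFiber W x →ₗ[ℝ] G × (G →L[ℝ] ℝ) :=
  LinearMap.prodMap ((trivializationAt G W x₀).continuousLinearMapAt ℝ x).toLinearMap
    (dualMap ((trivializationAt G W x₀).symmL ℝ x))

/-- The element of `W_x ⊕ W_x^∨` with given coordinates. -/
def genCoordSymm (x₀ x : N) : G × (G →L[ℝ] ℝ) →ₗ[ℝ] GenFiber W x :=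
  LinearMap.prodMap ((trivializationAt G W x₀).symmL ℝ x).toLinearMap
    (dualMap ((trivializationAt G W x₀).continuousLinearMapAt ℝ x))

variable {G}

lemma genCoord_apply (x₀ x : N) (a : GenFiber W x) : genCoord G x₀ x a =
    ((trivializationAt G W x₀).continuousLinearMapAt ℝ x a.1,
      a.2.comp ((trivializationAt G W x₀).symmL ℝ x)) := rfl

lemma genCoordSymm_apply (x₀ x : N) (c : G × (G →L[ℝ] ℝ)) :
    (genCoordSymm G x₀ x c : GenFiber W x) = ((trivializationAt G W x₀).symmL ℝ x c.1,
      c.2.comp ((trivializationAt G W x₀).continuousLinearMapAt ℝ x)) := rfl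

lemma genCoordSymm_genCoord {x₀ x : N} (hx : x ∈ (trivializationAt G W x₀).baseSet)
    (a : GenFiber W x) : genCoordSymm G x₀ x (genCoord G x₀ x a) = a := by
  rw [genCoord_apply, genCoordSymm_apply]
  refine Prod.ext ?_ (ContinuousLinearMap.ext fun v => ?_)
  · exact Trivialization.symmL_continuousLinearMapAt _ hx _
  · exact congrArg a.2 (Trivialization.symmL_continuousLinearMapAt _ hx v)

lemma genCoord_genCoordSymm {x₀ x : N} (hx : x ∈ (trivializationAt G W x₀).baseSet)
    (c : G × (G →L[ℝ] ℝ)) : genCoord G x₀ x (genCoordSymm G x₀ x c : GenFiber W x) = c := by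
  rw [genCoord_apply, genCoordSymm_apply]
  refine Prod.ext ?_ (ContinuousLinearMap.ext fun v => ?_)
  · exact Trivialization.continuousLinearMapAt_symmL _ hx _
  · exact congrArg c.2 (Trivialization.continuousLinearMapAt_symmL _ hx v)

lemma pairL_genCoord {x₀ x : N} (hx : x ∈ (trivializationAt G W x₀).baseSet)
    (a b : GenFiber W x) : pairL (genCoord G x₀ x a) (genCoord G x₀ x b) = -2 * pairing a b := by
  have h := fun v : W x =>
    Trivialization.symmL_continuousLinearMapAt (R := ℝ) (trivializationAt G W x₀) hx v
  simp only [pairL_apply, genCoord_apply, pairing, ContinuousLinearMap.comp_apply, h]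
  ring

variable (G) in
/-- The coordinate expression of a section of `W ⊕ W^∨` in the preferred chart and trivialization
at `x₀`. -/
def genRep (a : ∀ x, GenFiber W x) (x₀ : N) (y : E) : G × (G →L[ℝ] ℝ) :=
  genCoord G x₀ ((extChartAt I x₀).symm y) (a ((extChartAt I x₀).symm y))

lemma contMDiffAt_iff_contDiffAt_symm [I.Boundaryless] {F' : Type*} [NormedAddCommGroup F']
    [NormedSpace ℝ F'] {f : N → F'} {x₀ : N} {n : WithTop ℕ∞} :
    ContMDiffAt I 𝓘(ℝ, F') n f x₀ ↔
      ContDiffAt ℝ n (f ∘ (extChartAt I x₀).symm) (extChartAt I x₀ x₀) := by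
  rw [contMDiffAt_iff]
  simp only [extChartAt_model_space_eq_id, PartialEquiv.refl_coe, Function.id_comp,
    I.range_eq_univ, contDiffWithinAt_univ]
  refine ⟨fun h => h.2, fun h => ⟨?_, h⟩⟩
  have h1 : ContinuousAt ((f ∘ (extChartAt I x₀).symm) ∘ extChartAt I x₀) x₀ :=
    h.continuousAt.comp (continuousAt_extChartAt x₀)
  refine h1.congr ?_
  filter_upwards [extChartAt_source_mem_nhds (I := I) x₀] with x hx
  exact congrArg f ((extChartAt I x₀).left_inv hx)

lemma contMDiffAt_section_iff_genRep [I.Boundaryless] {a : ∀ x, GenFiber W x} {x₀ : N}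
    {n : WithTop ℕ∞} :
    (ContMDiffAt I (I.prod 𝓘(ℝ, G)) n (fun x => TotalSpace.mk' G x (a x).1) x₀ ∧
      ContMDiffAt I (I.prod 𝓘(ℝ, G →L[ℝ] ℝ)) n
        (fun x => TotalSpace.mk' (G →L[ℝ] ℝ) (E := fun y => W y →L[ℝ] ℝ) x (a x).2) x₀) ↔
      ContDiffAt ℝ n (genRep I G a x₀) (extChartAt I x₀ x₀) := by
  have hbase : ∀ᶠ x in 𝓝 x₀, x ∈ (trivializationAt G W x₀).baseSet :=
    (trivializationAt G W x₀).open_baseSet.mem_nhds (mem_baseSet_trivializationAt' x₀)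
  have h1 : ContMDiffAt I (I.prod 𝓘(ℝ, G)) n (fun x => TotalSpace.mk' G x (a x).1) x₀ ↔
      ContMDiffAt I 𝓘(ℝ, G) n (fun x => (genCoord G x₀ x (a x)).1) x₀ := by
    rw [contMDiffAt_section]
    refine Filter.EventuallyEq.contMDiffAt_iff ?_
    filter_upwards [hbase] with x hx
    rw [genCoord_apply, Trivialization.continuousLinearMapAt_apply,
      Trivialization.linearMapAt_apply, if_pos hx]
  have h2 : ContMDiffAt I (I.prod 𝓘(ℝ, G →L[ℝ] ℝ)) n
        (fun x => TotalSpace.mk' (G →L[ℝ] ℝ) (E := fun y => W y →L[ℝ] ℝ) x (a x).2) x₀ ↔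
      ContMDiffAt I 𝓘(ℝ, G →L[ℝ] ℝ) n (fun x => (genCoord G x₀ x (a x)).2) x₀ := by
    rw [contMDiffAt_hom_bundle]
    refine (and_iff_right contMDiffAt_id).trans ?_
    refine Filter.EventuallyEq.contMDiffAt_iff (Filter.Eventually.of_forall fun x => ?_)
    ext v
    simp [ContinuousLinearMap.inCoordinates, genCoord_apply]
  rw [h1, h2]
  exact (contMDiffAt_prod_module_iff (fun x => genCoord G x₀ x (a x))).symm.trans
    (contMDiffAt_iff_contDiffAt_symm I)

lemma SmoothGenSection.contDiffAt_genRep [I.Boundaryless] {a : ∀ x, GenFiber W x} {U : Set N}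
    (ha : SmoothGenSection I G a U) (hU : IsOpen U) {x₀ : N} (hx₀ : x₀ ∈ U) :
    ContDiffAt ℝ ∞ (genRep I G a x₀) (extChartAt I x₀ x₀) :=
  (contMDiffAt_section_iff_genRep I).1 ⟨(ha.1 x₀ hx₀).contMDiffAt (hU.mem_nhds hx₀),
    (ha.2 x₀ hx₀).contMDiffAt (hU.mem_nhds hx₀)⟩

lemma smoothGenSection_of_contDiffAt_genRep [I.Boundaryless] {a : ∀ x, GenFiber W x} {U : Set N}
    (h : ∀ x₀ ∈ U, ContDiffAt ℝ ∞ (genRep I G a x₀) (extChartAt I x₀ x₀)) :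
    SmoothGenSection I G a U :=
  ⟨fun x₀ hx₀ => ((contMDiffAt_section_iff_genRep I).2 (h x₀ hx₀)).1.contMDiffWithinAt,
    fun x₀ hx₀ => ((contMDiffAt_section_iff_genRep I).2 (h x₀ hx₀)).2.contMDiffWithinAt⟩

end Coordinates

section CourantCoordinates

variable {E : Type*} [NormedAddCommGroup E] [NormedSpace ℝ E]
  {H : Type*} [TopologicalSpace H] (I : ModelWithCorners ℝ E H)
  {N : Type*} [TopologicalSpace N] [ChartedSpace H N] [IsManifold I 1 N]

/-- The differential of a function at a point of the domain of a chart. -/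
lemma mvfderiv_eq_fderiv_comp [I.Boundaryless] {F' : Type*} [NormedAddCommGroup F']
    [NormedSpace ℝ F'] {f : N → F'} {g : E → F'} {x₀ x : N} (hx : x ∈ (chartAt H x₀).source)
    (hfg : f =ᶠ[𝓝 x] g ∘ extChartAt I x₀) (hg : DifferentiableAt ℝ g (extChartAt I x₀ x)) :
    mvfderiv I f x = (fderiv ℝ g (extChartAt I x₀ x)).comp
      ((trivializationAt E (TangentSpace I) x₀).continuousLinearMapAt ℝ x) := by
  have h1 := mfderiv_comp x hg.mdifferentiableAt (mdifferentiableAt_extChartAt (I := I) hx)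
  rw [mfderiv_eq_fderiv] at h1
  rw [TangentBundle.continuousLinearMapAt_trivializationAt hx, mvfderiv, hfg.mfderiv_eq, h1]
  rfl

lemma eventually_continuousLinearMapAt_eq_inverse [I.Boundaryless] (x₀ : N) :
    ∀ᶠ y in 𝓝 (extChartAt I x₀ x₀), (extChartAt I x₀).symm y ∈ (chartAt H x₀).source ∧
      mfderivWithin 𝓘(ℝ, E) I (extChartAt I x₀).symm (range I) y =
        (trivializationAt E (TangentSpace I) x₀).symmL ℝ ((extChartAt I x₀).symm y) ∧
      (mfderivWithin 𝓘(ℝ, E) I (extChartAt I x₀).symm (range I) y).inverse =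
        (trivializationAt E (TangentSpace I) x₀).continuousLinearMapAt ℝ
          ((extChartAt I x₀).symm y) := by
  filter_upwards [extChartAt_target_mem_nhds (I := I) x₀] with y hy
  have hx : (extChartAt I x₀).symm y ∈ (chartAt H x₀).source := by
    rw [← extChartAt_source I]
    exact (extChartAt I x₀).map_target hy
  have h := TangentBundle.symmL_trivializationAt (I := I) hx
  rw [(extChartAt I x₀).right_inv hy] at h
  refine ⟨hx, h.symm, ?_⟩
  have hb : (extChartAt I x₀).symm y ∈ (trivializationAt E (TangentSpace I) x₀).baseSet := by
    simpa using hx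
  rw [← h]
  refine ContinuousLinearMap.inverse_eq ?_ ?_
  · ext v
    exact Trivialization.symmL_continuousLinearMapAt _ hb v
  · ext v
    exact Trivialization.continuousLinearMapAt_symmL _ hb v

/-- The Courant bracket in coordinates. -/
theorem genCoord_courant [I.Boundaryless] {a b : GenField I N} {x₀ : N}
    (ha : DifferentiableAt ℝ (genRep I E a x₀) (extChartAt I x₀ x₀))
    (hb : DifferentiableAt ℝ (genRep I E b x₀) (extChartAt I x₀ x₀)) :
    genCoord E x₀ x₀ (courant I a b x₀) =
      courantModel (genRep I E a x₀) (genRep I E b x₀) (extChartAt I x₀ x₀) := by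
  have hx₀ : x₀ ∈ (chartAt H x₀).source := mem_chart_source H x₀
  have hbase : x₀ ∈ (trivializationAt E (TangentSpace I) x₀).baseSet := by simp
  have hT := TangentBundle.continuousLinearMapAt_trivializationAt (I := I) hx₀
  set z := extChartAt I x₀ x₀ with hz
  set T := (trivializationAt E (TangentSpace I) x₀).continuousLinearMapAt ℝ x₀ with hTdef
  set T' := (trivializationAt E (TangentSpace I) x₀).symmL ℝ x₀ with hT'def
  have hTT' : ∀ v, T (T' v) = v := Trivialization.continuousLinearMapAt_symmL _ hbase
  have hT'T : ∀ v, T' (T v) = v := Trivialization.symmL_continuousLinearMapAt _ hbase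
  have hinv : T.inverse = T' := by
    refine ContinuousLinearMap.inverse_eq ?_ ?_
    · ext v
      exact hTT' v
    · ext v
      exact hT'T v
  have hsymm : (extChartAt I x₀).symm z = x₀ := extChartAt_to_inv x₀
  have ev := eventually_continuousLinearMapAt_eq_inverse I x₀
  have hvec : ∀ c : GenField I N, mpullbackWithin 𝓘(ℝ, E) I (extChartAt I x₀).symm
      (fun y => (c y).1) (range I) =ᶠ[𝓝 z] fun y => (genRep I E c x₀ y).1 := by
    intro c
    filter_upwards [ev] with y hy
    rw [mpullbackWithin_apply, hy.2.2]
    rfl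
  have hform : ∀ c : GenField I N, coordForm I (fun y => (c y).2) x₀ =ᶠ[𝓝 z]
      fun y => (genRep I E c x₀ y).2 := by
    intro c
    filter_upwards [ev] with y hy
    rw [coordForm, hy.2.1]
    rfl
  have hval : ∀ c : GenField I N, genRep I E c x₀ z = (T (c x₀).1, (c x₀).2.comp T') := by
    intro c
    rw [genRep, hsymm]
    rfl
  have hbr : T (mlieBracket I (fun y => (a y).1) (fun y => (b y).1) x₀) =
      fderiv ℝ (fun y => (genRep I E b x₀ y).1) z (genRep I E a x₀ z).1 -
        fderiv ℝ (fun y => (genRep I E a x₀ y).1) z (genRep I E b x₀ z).1 := by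
    have hinv' : (mfderiv I 𝓘(ℝ, E) (extChartAt I x₀) x₀).inverse = T' := hT ▸ hinv
    obtain ⟨Va, hVa⟩ : ∃ Va : E → E, Va = mpullbackWithin 𝓘(ℝ, E) I (extChartAt I x₀).symm
      (fun y => (a y).1) (range I) := ⟨_, rfl⟩
    obtain ⟨Vb, hVb⟩ : ∃ Vb : E → E, Vb = mpullbackWithin 𝓘(ℝ, E) I (extChartAt I x₀).symm
      (fun y => (b y).1) (range I) := ⟨_, rfl⟩
    have h0 : mlieBracket I (fun y => (a y).1) (fun y => (b y).1) x₀ =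
        T' (lieBracketWithin ℝ Va Vb ((extChartAt I x₀).symm ⁻¹' univ ∩ range I) z) := by
      rw [hVa, hVb]
      exact DFunLike.congr_fun hinv' _
    have ha' : Va =ᶠ[𝓝 z] fun y => (genRep I E a x₀ y).1 := hVa ▸ hvec a
    have hb' : Vb =ᶠ[𝓝 z] fun y => (genRep I E b x₀ y).1 := hVb ▸ hvec b
    rw [h0, hTT', preimage_univ, univ_inter, I.range_eq_univ, lieBracketWithin_univ,
      lieBracket_eq]
    beta_reduce
    rw [ha'.fderiv_eq, hb'.fderiv_eq, ha'.eq_of_nhds, hb'.eq_of_nhds]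
  have hext : ∀ (c : GenField I N) (u v : TangentSpace I x₀),
      extDerivForm I (fun y => (c y).2) x₀ u v =
      fderiv ℝ (fun y => (genRep I E c x₀ y).2) z (T u) (T v) -
        fderiv ℝ (fun y => (genRep I E c x₀ y).2) z (T v) (T u) := by
    intro c u v
    rw [extDerivForm, ← hT, I.range_eq_univ, fderivWithin_univ, (hform c).fderiv_eq]
    rfl
  have hfun : ∀ c d : GenField I N, (fun y => (c y).2 (d y).1) =ᶠ[𝓝 x₀]
      (fun y => (genRep I E c x₀ y).2 (genRep I E d x₀ y).1) ∘ extChartAt I x₀ := by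
    intro c d
    filter_upwards [(chartAt H x₀).open_source.mem_nhds hx₀] with x hx
    have h1 : (extChartAt I x₀).symm (extChartAt I x₀ x) = x :=
      (extChartAt I x₀).left_inv (by rwa [extChartAt_source])
    have h2 : x ∈ (trivializationAt E (TangentSpace I) x₀).baseSet := by simpa using hx
    refine (congrArg (c x).2
      (Trivialization.symmL_continuousLinearMapAt (R := ℝ) _ h2 _).symm).trans ?_
    exact congrArg (fun x' => (genCoord E x₀ x' (c x')).2 (genCoord E x₀ x' (d x')).1) h1.symm
  have hd : ∀ c d : GenField I N, DifferentiableAt ℝ (genRep I E c x₀) z →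
      DifferentiableAt ℝ (genRep I E d x₀) z →
      DifferentiableAt ℝ (fun y => (genRep I E c x₀ y).2 (genRep I E d x₀ y).1) z :=
    fun c d hc hd => hc.snd.clm_apply hd.fst
  have hdfun : ∀ c d : GenField I N, DifferentiableAt ℝ (genRep I E c x₀) z →
      DifferentiableAt ℝ (genRep I E d x₀) z → ∀ u, mvfderiv I (fun y => (c y).2 (d y).1) x₀ (T' u) =
      (fderiv ℝ (genRep I E c x₀) z u).2 (T (d x₀).1) +
        (c x₀).2 (T' (fderiv ℝ (genRep I E d x₀) z u).1) := by
    intro c d hc hd' u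
    rw [mvfderiv_eq_fderiv_comp I hx₀ (hfun c d) (hd c d hc hd'), ContinuousLinearMap.comp_apply,
      hTT', fderiv_clm_apply hc.snd hd'.fst, fderiv.fst hd', fderiv.snd hc]
    simp [hval, add_comm]
  have hmd : ∀ c d : GenField I N, DifferentiableAt ℝ (genRep I E c x₀) z →
      DifferentiableAt ℝ (genRep I E d x₀) z →
      MDifferentiableAt I 𝓘(ℝ, ℝ) (fun y => (c y).2 (d y).1) x₀ := fun c d hc hd' =>
    (((hd c d hc hd').mdifferentiableAt.comp x₀ (mdifferentiableAt_extChartAt hx₀))).congr_of_eventuallyEq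
      (hfun c d)
  rw [courantModel, courantJet, hval, hval]
  refine Prod.ext ?_ (ContinuousLinearMap.ext fun u => ?_)
  · refine hbr.trans ?_
    rw [fderiv.fst ha, fderiv.fst hb, hval, hval]
    simp
  · have h1 := hdfun a b ha hb u
    have h2 := hdfun b a hb ha u
    have h3 : mvfderiv I (fun y => (a y).2 (b y).1 - (b y).2 (a y).1) x₀ (T' u) = _ :=
      DFunLike.congr_fun (mvfderiv_fun_sub (hmd a b ha hb) (hmd b a hb ha)) _
    have h4 : (genCoord E x₀ x₀ (courant I a b x₀)).2 u =
        (extDerivForm I (fun y => (b y).2) x₀ (a x₀).1 (T' u) +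
          mvfderiv I (fun y => (b y).2 (a y).1) x₀ (T' u)) -
        (extDerivForm I (fun y => (a y).2) x₀ (b x₀).1 (T' u) +
          mvfderiv I (fun y => (a y).2 (b y).1) x₀ (T' u)) +
        1 / 2 * mvfderiv I (fun y => (a y).2 (b y).1 - (b y).2 (a y).1) x₀ (T' u) := rfl
    rw [h4, h3, hext, hext, _root_.sub_apply, h1, h2, hTT', fderiv.snd ha,
      fderiv.snd hb]
    simp
    ring

end CourantCoordinates

/-! ### Connections in coordinates -/

section HomSection

variable {E : Type*} [NormedAddCommGroup E] [NormedSpace ℝ E]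
  {H : Type*} [TopologicalSpace H] {I : ModelWithCorners ℝ E H}
  {M : Type*} [TopologicalSpace M] [ChartedSpace H M]
  {F₁ : Type*} [NormedAddCommGroup F₁] [NormedSpace ℝ F₁]
  {W₁ : M → Type*} [TopologicalSpace (TotalSpace F₁ W₁)]
  [∀ x, AddCommGroup (W₁ x)] [∀ x, Module ℝ (W₁ x)] [∀ x, TopologicalSpace (W₁ x)]
  [FiberBundle F₁ W₁] [VectorBundle ℝ F₁ W₁]
  {F₂ : Type*} [NormedAddCommGroup F₂] [NormedSpace ℝ F₂]
  {W₂ : M → Type*} [TopologicalSpace (TotalSpace F₂ W₂)]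
  [∀ x, AddCommGroup (W₂ x)] [∀ x, Module ℝ (W₂ x)] [∀ x, TopologicalSpace (W₂ x)]
  [∀ x, IsTopologicalAddGroup (W₂ x)] [∀ x, ContinuousSMul ℝ (W₂ x)]
  [FiberBundle F₂ W₂] [VectorBundle ℝ F₂ W₂]

/-- Smoothness of a section of a bundle of linear maps, in the coordinates given by the preferred
trivializations at a nearby point. -/
lemma contMDiffAt_hom_section_iff {n : WithTop ℕ∞} [ContMDiffVectorBundle n F₁ W₁ I]
    [ContMDiffVectorBundle n F₂ W₂ I] {η : ∀ x, W₁ x →L[ℝ] W₂ x} {x₀ x : M}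
    (h₁ : x ∈ (trivializationAt F₁ W₁ x₀).baseSet) (h₂ : x ∈ (trivializationAt F₂ W₂ x₀).baseSet) :
    ContMDiffAt I (I.prod 𝓘(ℝ, F₁ →L[ℝ] F₂)) n
      (fun x => TotalSpace.mk' (F₁ →L[ℝ] F₂) (E := fun y => W₁ y →L[ℝ] W₂ y) x (η x)) x ↔
    ContMDiffAt I 𝓘(ℝ, F₁ →L[ℝ] F₂) n (fun x =>
      ((trivializationAt F₂ W₂ x₀).continuousLinearMapAt ℝ x).comp
        ((η x).comp ((trivializationAt F₁ W₁ x₀).symmL ℝ x))) x := by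
  have hx : x ∈ (trivializationAt (F₁ →L[ℝ] F₂) (fun y => W₁ y →L[ℝ] W₂ y) x₀).baseSet := by
    rw [hom_trivializationAt_baseSet]
    exact ⟨h₁, h₂⟩
  refine (Trivialization.contMDiffAt_section_iff
    (trivializationAt (F₁ →L[ℝ] F₂) (fun y => W₁ y →L[ℝ] W₂ y) x₀) hx).trans ?_
  simp only [hom_trivializationAt_apply]
  rfl

end HomSection

section ConnectionCoordinates

variable {E : Type*} [NormedAddCommGroup E] [NormedSpace ℝ E]
  {M : Type*} [TopologicalSpace M] [ChartedSpace E M] [IsManifold 𝓘(ℝ, E) ∞ M]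
  {F : Type*} [NormedAddCommGroup F] [NormedSpace ℝ F]
  {V : M → Type*} [TopologicalSpace (TotalSpace F V)]
  [∀ x, AddCommGroup (V x)] [∀ x, Module ℝ (V x)] [∀ x, TopologicalSpace (V x)]
  [∀ x, IsTopologicalAddGroup (V x)] [∀ x, ContinuousSMul ℝ (V x)]
  [FiberBundle F V] [VectorBundle ℝ F V] [ContMDiffVectorBundle ∞ F V 𝓘(ℝ, E)]

variable (E F V) in
/-- The domain of the preferred chart and trivialization at `x₀`. -/
def coordDomain (x₀ : M) : Set M :=
  (chartAt E x₀).source ∩ (trivializationAt F V x₀).baseSet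

lemma isOpen_coordDomain (x₀ : M) : IsOpen (coordDomain E F V x₀) :=
  (chartAt E x₀).open_source.inter (trivializationAt F V x₀).open_baseSet

lemma mem_coordDomain_self (x₀ : M) : x₀ ∈ coordDomain E F V x₀ :=
  ⟨mem_chart_source E x₀, mem_baseSet_trivializationAt' x₀⟩

variable (E F V) in
/-- The image of `coordDomain` in the chart. -/
def coordTarget (x₀ : M) : Set E :=
  (extChartAt 𝓘(ℝ, E) x₀).target ∩
    (extChartAt 𝓘(ℝ, E) x₀).symm ⁻¹' (trivializationAt F V x₀).baseSet

lemma isOpen_coordTarget (x₀ : M) : IsOpen (coordTarget E F V x₀) :=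
  (continuousOn_extChartAt_symm x₀).isOpen_inter_preimage (isOpen_extChartAt_target x₀)
    (trivializationAt F V x₀).open_baseSet

lemma extChartAt_symm_mem_coordDomain {x₀ : M} {y : E} (hy : y ∈ coordTarget E F V x₀) :
    (extChartAt 𝓘(ℝ, E) x₀).symm y ∈ coordDomain E F V x₀ :=
  ⟨by
    rw [← extChartAt_source 𝓘(ℝ, E)]
    exact (extChartAt 𝓘(ℝ, E) x₀).map_target hy.1, hy.2⟩

lemma extChartAt_left_inv_of_mem {x₀ x : M} (hx : x ∈ coordDomain E F V x₀) :
    (extChartAt 𝓘(ℝ, E) x₀).symm (extChartAt 𝓘(ℝ, E) x₀ x) = x :=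
  (extChartAt 𝓘(ℝ, E) x₀).left_inv (by rw [extChartAt_source]; exact hx.1)

lemma extChartAt_mem_coordTarget {x₀ x : M} (hx : x ∈ coordDomain E F V x₀) :
    extChartAt 𝓘(ℝ, E) x₀ x ∈ coordTarget E F V x₀ := by
  refine ⟨(extChartAt 𝓘(ℝ, E) x₀).map_source (by rw [extChartAt_source]; exact hx.1), ?_⟩
  rw [mem_preimage, extChartAt_left_inv_of_mem hx]
  exact hx.2

/-- A vector field with values in the model space, near `x`, in coordinates. -/
lemma contDiffAt_comp_symm {F' : Type*} [NormedAddCommGroup F'] [NormedSpace ℝ F'] {f : M → F'}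
    {x₀ x : M} (hx : x ∈ (chartAt E x₀).source) {n : ℕ∞} (hf : ContMDiffAt 𝓘(ℝ, E) 𝓘(ℝ, F') n f x) :
    ContDiffAt ℝ n (f ∘ (extChartAt 𝓘(ℝ, E) x₀).symm) (extChartAt 𝓘(ℝ, E) x₀ x) := by
  have hx' : x ∈ (extChartAt 𝓘(ℝ, E) x₀).source := by rwa [extChartAt_source]
  have : IsManifold 𝓘(ℝ, E) n M := IsManifold.of_le (n := ∞) (by exact_mod_cast le_top)
  have h1 : ContMDiffAt 𝓘(ℝ, E) 𝓘(ℝ, E) n (extChartAt 𝓘(ℝ, E) x₀).symm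
      (extChartAt 𝓘(ℝ, E) x₀ x) :=
    (contMDiffOn_extChartAt_symm x₀).contMDiffAt
      ((isOpen_extChartAt_target x₀).mem_nhds ((extChartAt 𝓘(ℝ, E) x₀).map_source hx'))
  rw [← contMDiffAt_iff_contDiffAt]
  refine ContMDiffAt.comp _ ?_ h1
  rwa [(extChartAt 𝓘(ℝ, E) x₀).left_inv hx']

variable (F V) in
/-- The flat connection on the domain of the preferred trivialization at `x₀` for which the frame
given by the trivialization is parallel. -/
def trivialConnection (x₀ : M) (s : ∀ x, V x) (x : M) : TangentSpace 𝓘(ℝ, E) x →L[ℝ] V x :=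
  ((trivializationAt F V x₀).symmL ℝ x).comp
    (mvfderiv 𝓘(ℝ, E) (fun y => (trivializationAt F V x₀).continuousLinearMapAt ℝ y (s y)) x)

lemma eventually_continuousLinearMapAt (x₀ : M) {x : M}
    (hx : x ∈ (trivializationAt F V x₀).baseSet) (s : ∀ x, V x) :
    (fun y => (trivializationAt F V x₀ ⟨y, s y⟩).2) =ᶠ[𝓝 x]
      fun y => (trivializationAt F V x₀).continuousLinearMapAt ℝ y (s y) := by
  filter_upwards [(trivializationAt F V x₀).open_baseSet.mem_nhds hx] with y hy
  rw [Trivialization.continuousLinearMapAt_apply, Trivialization.linearMapAt_apply, if_pos hy]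

lemma mdifferentiableAt_section_iff_continuousLinearMapAt (x₀ : M) {x : M}
    (hx : x ∈ (trivializationAt F V x₀).baseSet) (s : ∀ x, V x) :
    MDifferentiableAt 𝓘(ℝ, E) (𝓘(ℝ, E).prod 𝓘(ℝ, F)) (fun y => TotalSpace.mk' F y (s y)) x ↔
      MDifferentiableAt 𝓘(ℝ, E) 𝓘(ℝ, F)
        (fun y => (trivializationAt F V x₀).continuousLinearMapAt ℝ y (s y)) x := by
  have : ContMDiffVectorBundle 1 F V 𝓘(ℝ, E) := ContMDiffVectorBundle.of_le (n := ∞) (by simp)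
  rw [Trivialization.mdifferentiableAt_section_iff 𝓘(ℝ, E) (trivializationAt F V x₀) s hx]
  exact (eventually_continuousLinearMapAt x₀ hx s).mdifferentiableAt_iff

lemma isCovariantDerivativeOn_trivialConnection (x₀ : M) :
    IsCovariantDerivativeOn (I := 𝓘(ℝ, E)) F (trivialConnection F V x₀)
      (trivializationAt F V x₀).baseSet where
  add {σ σ' x} hσ hσ' hx := by
    rw [mdifferentiableAt_section_iff_continuousLinearMapAt x₀ hx] at hσ hσ'
    have h := mvfderiv_fun_add hσ hσ'
    simp only [trivialConnection, Pi.add_apply, map_add]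
    rw [h, ContinuousLinearMap.comp_add]
  leibniz {σ g x} hσ hg hx := by
    rw [mdifferentiableAt_section_iff_continuousLinearMapAt x₀ hx] at hσ
    have h := mvfderiv_fun_smul hg hσ
    simp only [trivialConnection, Pi.smul_apply', map_smul]
    rw [h, ContinuousLinearMap.comp_add]
    ext u
    simp only [_root_.add_apply, ContinuousLinearMap.comp_apply,
      _root_.smul_apply, ContinuousLinearMap.smulRight_apply, map_smul,
      Trivialization.symmL_continuousLinearMapAt _ hx]

variable [FiniteDimensional ℝ F] (D : CovariantDerivative 𝓘(ℝ, E) F V)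

lemma contMDiffVectorBundle_one : ContMDiffVectorBundle 1 F V 𝓘(ℝ, E) :=
  ContMDiffVectorBundle.of_le (n := ∞) (by simp)

/-- The connection form of `D` in the preferred trivialization at `x₀`. -/
def connectionForm (x₀ x : M) : V x →L[ℝ] TangentSpace 𝓘(ℝ, E) x →L[ℝ] V x :=
  haveI : ContMDiffVectorBundle 1 F V 𝓘(ℝ, E) := contMDiffVectorBundle_one
  IsCovariantDerivativeOn.difference (D.isCovariantDerivativeOn)
    (isCovariantDerivativeOn_trivialConnection (E := E) (F := F) (V := V) x₀) x

lemma covariantDerivative_eq {x₀ x : M} (hx : x ∈ (trivializationAt F V x₀).baseSet)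
    {s : ∀ x, V x} (hs : MDifferentiableAt 𝓘(ℝ, E) (𝓘(ℝ, E).prod 𝓘(ℝ, F))
      (fun y => TotalSpace.mk' F y (s y)) x) :
    D s x = trivialConnection F V x₀ s x + connectionForm D x₀ x (s x) := by
  have : ContMDiffVectorBundle 1 F V 𝓘(ℝ, E) := contMDiffVectorBundle_one
  rw [connectionForm, IsCovariantDerivativeOn.difference_apply _ _ hx hs]
  abel

/-- The Christoffel symbols of `D` in the preferred chart and trivialization at `x₀`. -/
def christoffel (x₀ : M) (y : E) : F →L[ℝ] E →L[ℝ] F :=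
  LinearMap.toContinuousLinearMap
    { toFun := fun w =>
        ((trivializationAt F V x₀).continuousLinearMapAt ℝ ((extChartAt 𝓘(ℝ, E) x₀).symm y)).comp
          ((connectionForm D x₀ ((extChartAt 𝓘(ℝ, E) x₀).symm y)
            ((trivializationAt F V x₀).symmL ℝ ((extChartAt 𝓘(ℝ, E) x₀).symm y) w)).comp
            ((trivializationAt E (TangentSpace 𝓘(ℝ, E)) x₀).symmL ℝ
              ((extChartAt 𝓘(ℝ, E) x₀).symm y)))
      map_add' := fun w w' => by
        ext u
        simp only [map_add, ContinuousLinearMap.comp_apply, _root_.add_apply]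
      map_smul' := fun c w => by
        ext u
        simp only [map_smul, ContinuousLinearMap.comp_apply, _root_.smul_apply,
          RingHom.id_apply] }

lemma christoffel_apply (x₀ : M) (y : E) (w : F) : christoffel D x₀ y w =
    ((trivializationAt F V x₀).continuousLinearMapAt ℝ ((extChartAt 𝓘(ℝ, E) x₀).symm y)).comp
      ((connectionForm D x₀ ((extChartAt 𝓘(ℝ, E) x₀).symm y)
        ((trivializationAt F V x₀).symmL ℝ ((extChartAt 𝓘(ℝ, E) x₀).symm y) w)).comp
        ((trivializationAt E (TangentSpace 𝓘(ℝ, E)) x₀).symmL ℝ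
          ((extChartAt 𝓘(ℝ, E) x₀).symm y))) := rfl

/-- The covariant derivative in coordinates. -/
lemma continuousLinearMapAt_covariantDerivative {x₀ x : M} (hx : x ∈ coordDomain E F V x₀)
    {s : ∀ x, V x} {g : E → F}
    (hsg : (fun y => (trivializationAt F V x₀).continuousLinearMapAt ℝ y (s y)) =ᶠ[𝓝 x]
      g ∘ extChartAt 𝓘(ℝ, E) x₀) (hg : DifferentiableAt ℝ g (extChartAt 𝓘(ℝ, E) x₀ x))
    (u : TangentSpace 𝓘(ℝ, E) x) :
    (trivializationAt F V x₀).continuousLinearMapAt ℝ x (D s x u) =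
      fderiv ℝ g (extChartAt 𝓘(ℝ, E) x₀ x)
        ((trivializationAt E (TangentSpace 𝓘(ℝ, E)) x₀).continuousLinearMapAt ℝ x u) +
      christoffel D x₀ (extChartAt 𝓘(ℝ, E) x₀ x) (g (extChartAt 𝓘(ℝ, E) x₀ x))
        ((trivializationAt E (TangentSpace 𝓘(ℝ, E)) x₀).continuousLinearMapAt ℝ x u) := by
  have hs : MDifferentiableAt 𝓘(ℝ, E) (𝓘(ℝ, E).prod 𝓘(ℝ, F))
      (fun y => TotalSpace.mk' F y (s y)) x := by
    rw [mdifferentiableAt_section_iff_continuousLinearMapAt x₀ hx.2]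
    exact (hg.mdifferentiableAt.comp x
      (mdifferentiableAt_extChartAt hx.1)).congr_of_eventuallyEq hsg
  have hx' : x ∈ (trivializationAt E (TangentSpace 𝓘(ℝ, E)) x₀).baseSet := by simpa using hx.1
  have hgx : g (extChartAt 𝓘(ℝ, E) x₀ x) =
      (trivializationAt F V x₀).continuousLinearMapAt ℝ x (s x) := hsg.eq_of_nhds.symm
  rw [covariantDerivative_eq D hx.2 hs, _root_.add_apply, map_add, hgx,
    christoffel_apply, extChartAt_left_inv_of_mem hx, trivialConnection,
    mvfderiv_eq_fderiv_comp 𝓘(ℝ, E) hx.1 hsg hg]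
  simp only [ContinuousLinearMap.comp_apply, Trivialization.symmL_continuousLinearMapAt _ hx.2,
    Trivialization.symmL_continuousLinearMapAt _ hx',
    Trivialization.continuousLinearMapAt_symmL _ hx.2]

/-- Sections with constant coordinates are smooth. -/
lemma contMDiffOn_symmL_const (x₀ : M) (w : F) :
    ContMDiffOn 𝓘(ℝ, E) (𝓘(ℝ, E).prod 𝓘(ℝ, F)) ∞
      (fun x => TotalSpace.mk' F x ((trivializationAt F V x₀).symmL ℝ x w))
      (trivializationAt F V x₀).baseSet := by
  rw [Trivialization.contMDiffOn_section_iff (trivializationAt F V x₀)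
    (trivializationAt F V x₀).open_baseSet subset_rfl]
  refine (contMDiffOn_const (c := w)).congr fun x hx => ?_
  have h := Trivialization.continuousLinearMapAt_symmL (R := ℝ) (trivializationAt F V x₀) hx w
  rwa [Trivialization.continuousLinearMapAt_apply, Trivialization.linearMapAt_apply,
    if_pos hx] at h

lemma christoffel_apply_of_mem {x₀ x : M} (hx : x ∈ coordDomain E F V x₀) (w : F) :
    christoffel D x₀ (extChartAt 𝓘(ℝ, E) x₀ x) w =
      ((trivializationAt F V x₀).continuousLinearMapAt ℝ x).comp
        ((D (fun x => (trivializationAt F V x₀).symmL ℝ x w) x).comp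
          ((trivializationAt E (TangentSpace 𝓘(ℝ, E)) x₀).symmL ℝ x)) := by
  have hx' : x ∈ (trivializationAt E (TangentSpace 𝓘(ℝ, E)) x₀).baseSet := by simpa using hx.1
  ext u
  have h := continuousLinearMapAt_covariantDerivative D hx
    (s := fun x => (trivializationAt F V x₀).symmL ℝ x w) (g := fun _ => w) (by
      filter_upwards [(trivializationAt F V x₀).open_baseSet.mem_nhds hx.2] with y hy
      exact Trivialization.continuousLinearMapAt_symmL _ hy w) (differentiableAt_const w)
    ((trivializationAt E (TangentSpace 𝓘(ℝ, E)) x₀).symmL ℝ x u)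
  simp only [ContinuousLinearMap.comp_apply]
  rw [h, Trivialization.continuousLinearMapAt_symmL _ hx']
  simp

lemma contDiffOn_christoffel (hD : IsSmoothConnection D) (x₀ : M) :
    ContDiffOn ℝ ∞ (christoffel D x₀) (coordTarget E F V x₀) := by
  rw [contDiffOn_clm_apply]
  intro w y hy
  have hx := extChartAt_symm_mem_coordDomain hy
  set x := (extChartAt 𝓘(ℝ, E) x₀).symm y with hxdef
  have hyx : extChartAt 𝓘(ℝ, E) x₀ x = y := (extChartAt 𝓘(ℝ, E) x₀).right_inv hy.1
  have h1 := ((hD _ (trivializationAt F V x₀).open_baseSet).contMDiff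
    (contMDiffOn_symmL_const (E := E) (V := V) x₀ w) x hx.2).contMDiffAt
    ((trivializationAt F V x₀).open_baseSet.mem_nhds hx.2)
  have h2 := contDiffAt_comp_symm hx.1 (n := ⊤) ((contMDiffAt_hom_section_iff
    (F₁ := E) (W₁ := TangentSpace 𝓘(ℝ, E)) (W₂ := V) (x₀ := x₀) (by simpa using hx.1) hx.2).1 h1)
  rw [hyx] at h2
  refine (h2.congr_of_eventuallyEq ?_).contDiffWithinAt
  filter_upwards [(isOpen_coordTarget x₀).mem_nhds hy] with y' hy'
  have h3 := christoffel_apply_of_mem D (extChartAt_symm_mem_coordDomain hy') w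
  rwa [(extChartAt 𝓘(ℝ, E) x₀).right_inv hy'.1] at h3

end ConnectionCoordinates

/-! ### Flat sections in coordinates -/

section ParallelDual

variable {E : Type*} [NormedAddCommGroup E] [NormedSpace ℝ E]
  {F : Type*} [NormedAddCommGroup F] [NormedSpace ℝ F]

/-- Parallel sections are smooth. -/
lemma contDiffOn_of_parallel {Γ : E → F →L[ℝ] E →L[ℝ] F} {s : E → F} {O : Set E} (hO : IsOpen O)
    (hΓ : ContDiffOn ℝ ∞ Γ O) (hs : ∀ y ∈ O, HasFDerivAt s (-Γ y (s y)) y) :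
    ContDiffOn ℝ ∞ s O := by
  rw [contDiffOn_infty]
  intro n
  induction n with
  | zero => exact contDiffOn_zero.2 fun y hy => (hs y hy).continuousAt.continuousWithinAt
  | succ n ih =>
    rw [Nat.cast_add, Nat.cast_one, contDiffOn_succ_iff_fderiv_of_isOpen hO]
    refine ⟨fun y hy => (hs y hy).differentiableAt.differentiableWithinAt, by simp, ?_⟩
    exact ((contDiffOn_infty.1 hΓ n).clm_apply ih).neg.congr fun y hy => (hs y hy).fderiv

variable (E F) in
/-- The passage from a connection form to the dual connection form. -/
def dualForm [FiniteDimensional ℝ E] [FiniteDimensional ℝ F] :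
    (F →L[ℝ] E →L[ℝ] F) →L[ℝ] (F →L[ℝ] ℝ) →L[ℝ] E →L[ℝ] (F →L[ℝ] ℝ) :=
  LinearMap.toContinuousLinearMap
    { toFun := fun T => -(((ContinuousLinearMap.compL ℝ E (F →L[ℝ] F) (F →L[ℝ] ℝ)).flip T.flip).comp
        (ContinuousLinearMap.compL ℝ F F ℝ))
      map_add' := fun T T' => by
        ext f u w
        change -f (T w u + T' w u) = -f (T w u) + -f (T' w u)
        rw [map_add, neg_add]
      map_smul' := fun c T => by
        ext f u w
        change -f (c • T w u) = c • -f (T w u)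
        rw [map_smul, smul_neg] }

lemma dualForm_apply [FiniteDimensional ℝ E] [FiniteDimensional ℝ F] (T : F →L[ℝ] E →L[ℝ] F)
    (f : F →L[ℝ] ℝ) (u : E) (w : F) : dualForm E F T f u w = -f (T w u) := rfl

end ParallelDual

section FlatCoordinates

variable {E : Type*} [NormedAddCommGroup E] [NormedSpace ℝ E] [FiniteDimensional ℝ E]
  {M : Type*} [TopologicalSpace M] [ChartedSpace E M] [IsManifold 𝓘(ℝ, E) ∞ M]
  {F : Type*} [NormedAddCommGroup F] [NormedSpace ℝ F]
  {V : M → Type*} [TopologicalSpace (TotalSpace F V)]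
  [∀ x, AddCommGroup (V x)] [∀ x, Module ℝ (V x)] [∀ x, TopologicalSpace (V x)]
  [∀ x, IsTopologicalAddGroup (V x)] [∀ x, ContinuousSMul ℝ (V x)]
  [FiberBundle F V] [VectorBundle ℝ F V] [ContMDiffVectorBundle ∞ F V 𝓘(ℝ, E)]

/-- Coordinate vector fields commute. -/
lemma mlieBracket_symmL_const {x₀ x : M} (hx : x ∈ (chartAt E x₀).source) (u u' : E) :
    mlieBracket 𝓘(ℝ, E)
      (fun y => (trivializationAt E (TangentSpace 𝓘(ℝ, E)) x₀).symmL ℝ y u)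
      (fun y => (trivializationAt E (TangentSpace 𝓘(ℝ, E)) x₀).symmL ℝ y u') x = 0 := by
  have : CompleteSpace E := FiniteDimensional.complete ℝ E
  have hmin : minSmoothness ℝ 2 = 2 := minSmoothness_of_isRCLikeNormedField
  have : IsManifold 𝓘(ℝ, E) (minSmoothness ℝ 2) M := by
    rw [hmin]
    exact IsManifold.of_le (n := ∞) (by norm_cast)
  have hfield : ∀ v : E, (fun y => (trivializationAt E (TangentSpace 𝓘(ℝ, E)) x₀).symmL ℝ y v)
      =ᶠ[𝓝 x] mpullback 𝓘(ℝ, E) 𝓘(ℝ, E) (extChartAt 𝓘(ℝ, E) x₀)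
        (fun _ => (v : E)) := by
    intro v
    filter_upwards [(chartAt E x₀).open_source.mem_nhds hx] with y hy
    have hb : y ∈ (trivializationAt E (TangentSpace 𝓘(ℝ, E)) x₀).baseSet := by simpa using hy
    have hinv : (mfderiv 𝓘(ℝ, E) 𝓘(ℝ, E) (extChartAt 𝓘(ℝ, E) x₀) y).inverse =
        (trivializationAt E (TangentSpace 𝓘(ℝ, E)) x₀).symmL ℝ y := by
      rw [← TangentBundle.continuousLinearMapAt_trivializationAt hy]
      refine ContinuousLinearMap.inverse_eq ?_ ?_
      · ext v
        exact Trivialization.continuousLinearMapAt_symmL _ hb v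
      · ext v
        exact Trivialization.symmL_continuousLinearMapAt _ hb v
    exact (DFunLike.congr_fun hinv v).symm
  have hconst : ∀ v : E, MDifferentiableAt 𝓘(ℝ, E) (𝓘(ℝ, E).prod 𝓘(ℝ, E))
      (fun y : E => (⟨y, v⟩ : TangentBundle 𝓘(ℝ, E) E)) (extChartAt 𝓘(ℝ, E) x₀ x) := by
    intro v
    refine (mdifferentiableAt_section 𝓘(ℝ, E) (E := TangentSpace 𝓘(ℝ, E))
      (fun y : E => (v : TangentSpace 𝓘(ℝ, E) y))).2 ?_
    simpa using! mdifferentiableAt_const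
  have hψ : ContMDiffAt 𝓘(ℝ, E) 𝓘(ℝ, E) 2 (extChartAt 𝓘(ℝ, E) x₀) x := by
    have : IsManifold 𝓘(ℝ, E) 2 M := IsManifold.of_le (n := ∞) (by norm_cast)
    exact contMDiffAt_extChartAt' hx
  rw [Filter.EventuallyEq.mlieBracket_vectorField_eq (hfield u) (hfield u'),
    ← mpullback_mlieBracket (hconst u) (hconst u') hψ hmin.le]
  have h0 : mlieBracket 𝓘(ℝ, E) (fun _ : E => (u : E)) (fun _ => (u' : E)) = 0 := by
    funext y
    refine (congrFun (mlieBracketWithin_eq_lieBracketWithin (s := univ)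
      (V := fun _ : E => (u : E)) (W := fun _ => (u' : E))) y).trans ?_
    exact (congrFun (lieBracketWithin_univ (𝕜 := ℝ) (V := fun _ : E => u) (W := fun _ => u')) y).trans
      (by simp [lieBracket]; rfl)
  exact (congrArg (fun Z => mpullback 𝓘(ℝ, E) 𝓘(ℝ, E) (extChartAt 𝓘(ℝ, E) x₀) Z x) h0).trans
    (congrFun mpullback_zero x)

variable [FiniteDimensional ℝ F] (D : CovariantDerivative 𝓘(ℝ, E) F V)

/-- The vanishing of the curvature in coordinates. -/
lemma christoffel_flat (hD : IsSmoothConnection D) (hflat : IsFlatConnection D) {x₀ : M} {y : E}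
    (hy : y ∈ coordTarget E F V x₀) (w : F) (u u' : E) :
    fderiv ℝ (christoffel D x₀) y u w u' - fderiv ℝ (christoffel D x₀) y u' w u
      + christoffel D x₀ y (christoffel D x₀ y w u') u
      - christoffel D x₀ y (christoffel D x₀ y w u) u' = 0 := by
  have hx := extChartAt_symm_mem_coordDomain hy
  set x := (extChartAt 𝓘(ℝ, E) x₀).symm y with hxdef
  have hyx : extChartAt 𝓘(ℝ, E) x₀ x = y := (extChartAt 𝓘(ℝ, E) x₀).right_inv hy.1
  have hx' : x ∈ (trivializationAt E (TangentSpace 𝓘(ℝ, E)) x₀).baseSet := by simpa using hx.1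
  have hΓ : DifferentiableAt ℝ (christoffel D x₀) y :=
    ((contDiffOn_christoffel D hD x₀).contDiffAt
      ((isOpen_coordTarget x₀).mem_nhds hy)).differentiableAt (by simp)
  have hd : ∀ v : E, DifferentiableAt ℝ (fun y => christoffel D x₀ y w v) y := fun v =>
    (hΓ.clm_apply (differentiableAt_const w)).clm_apply (differentiableAt_const v)
  have hfd : ∀ v v' : E, fderiv ℝ (fun y => christoffel D x₀ y w v) y v' =
      fderiv ℝ (christoffel D x₀) y v' w v := by
    intro v v'
    rw [fderiv_clm_apply (hΓ.clm_apply (differentiableAt_const w)) (differentiableAt_const v),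
      fderiv_clm_apply hΓ (differentiableAt_const w)]
    simp
  have hfields : ∀ v : E, SmoothSection 𝓘(ℝ, E) E
      (fun y => (trivializationAt E (TangentSpace 𝓘(ℝ, E)) x₀).symmL ℝ y v)
      (coordDomain E F V x₀) := fun v =>
    (contMDiffOn_symmL_const (E := E) (V := TangentSpace 𝓘(ℝ, E)) x₀ v).mono fun z hz => by
      simpa using hz.1
  have hsec : SmoothSection 𝓘(ℝ, E) F (fun y => (trivializationAt F V x₀).symmL ℝ y w)
      (coordDomain E F V x₀) :=
    (contMDiffOn_symmL_const (E := E) (V := V) x₀ w).mono inter_subset_right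
  have h := hflat (coordDomain E F V x₀) (isOpen_coordDomain x₀) _ _ _ (hfields u) (hfields u')
    hsec x hx
  rw [mlieBracket_symmL_const hx.1, map_zero, sub_zero] at h
  have key : ∀ v v' : E, (trivializationAt F V x₀).continuousLinearMapAt ℝ x
      (D (fun y => D (fun y => (trivializationAt F V x₀).symmL ℝ y w) y
        ((trivializationAt E (TangentSpace 𝓘(ℝ, E)) x₀).symmL ℝ y v)) x
        ((trivializationAt E (TangentSpace 𝓘(ℝ, E)) x₀).symmL ℝ x v')) =
      fderiv ℝ (christoffel D x₀) y v' w v + christoffel D x₀ y (christoffel D x₀ y w v) v' := by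
    intro v v'
    have h1 := continuousLinearMapAt_covariantDerivative D hx
      (s := fun y => D (fun y => (trivializationAt F V x₀).symmL ℝ y w) y
        ((trivializationAt E (TangentSpace 𝓘(ℝ, E)) x₀).symmL ℝ y v))
      (g := fun y => christoffel D x₀ y w v) (by
        filter_upwards [(isOpen_coordDomain x₀).mem_nhds hx] with z hz
        exact (DFunLike.congr_fun (christoffel_apply_of_mem D hz w) v).symm)
      (by rw [hyx]; exact hd v)
      ((trivializationAt E (TangentSpace 𝓘(ℝ, E)) x₀).symmL ℝ x v')
    rw [h1, Trivialization.continuousLinearMapAt_symmL _ hx', hyx, hfd]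
  have h2 := congrArg ((trivializationAt F V x₀).continuousLinearMapAt ℝ x) h
  rw [map_sub, map_zero, key, key] at h2
  rw [← h2]
  abel

lemma IsFlatSection.hasFDerivAt {s : ∀ x, V x} {U : Set M} (hs : IsFlatSection D s U)
    (hU : IsOpen U) {x₀ : M} (hx₀ : x₀ ∈ U) :
    HasFDerivAt (fun y => (trivializationAt F V x₀).continuousLinearMapAt ℝ
        ((extChartAt 𝓘(ℝ, E) x₀).symm y) (s ((extChartAt 𝓘(ℝ, E) x₀).symm y)))
      (-christoffel D x₀ (extChartAt 𝓘(ℝ, E) x₀ x₀)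
        ((trivializationAt F V x₀).continuousLinearMapAt ℝ x₀ (s x₀)))
      (extChartAt 𝓘(ℝ, E) x₀ x₀) := by
  have hx := mem_coordDomain_self (E := E) (F := F) (V := V) x₀
  have hx' : x₀ ∈ (trivializationAt E (TangentSpace 𝓘(ℝ, E)) x₀).baseSet := by simp
  have hsm := (hs.1 x₀ hx₀).contMDiffAt (hU.mem_nhds hx₀)
  rw [Trivialization.contMDiffAt_section_iff (trivializationAt F V x₀) hx.2] at hsm
  have hsm' := contDiffAt_comp_symm (n := ⊤) hx.1
    (hsm.congr_of_eventuallyEq (eventually_continuousLinearMapAt x₀ hx.2 s).symm)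
  have hd := hsm'.differentiableAt (by simp)
  refine hd.hasFDerivAt.congr_fderiv ?_
  ext u
  have h := continuousLinearMapAt_covariantDerivative D hx (s := s) (g := _) (by
      filter_upwards [(isOpen_coordDomain x₀).mem_nhds hx] with z hz
      exact (congrArg (fun z' => (trivializationAt F V x₀).continuousLinearMapAt ℝ z' (s z'))
        (extChartAt_left_inv_of_mem hz)).symm) hd
    ((trivializationAt E (TangentSpace 𝓘(ℝ, E)) x₀).symmL ℝ x₀ u)
  rw [hs.2 x₀ hx₀, Trivialization.continuousLinearMapAt_symmL _ hx'] at h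
  have h0 : ((fun y => (trivializationAt F V x₀).continuousLinearMapAt ℝ y (s y)) ∘
      (extChartAt 𝓘(ℝ, E) x₀).symm) (extChartAt 𝓘(ℝ, E) x₀ x₀) =
      (trivializationAt F V x₀).continuousLinearMapAt ℝ x₀ (s x₀) :=
    congrArg (fun z' => (trivializationAt F V x₀).continuousLinearMapAt ℝ z' (s z'))
      (extChartAt_left_inv_of_mem hx)
  rw [h0, _root_.zero_apply, map_zero] at h
  rw [_root_.neg_apply]
  exact eq_neg_of_add_eq_zero_left h.symm

lemma IsFlatDualSection.hasFDerivAt {f : ∀ x, V x →L[ℝ] ℝ} {U : Set M}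
    (hf : IsFlatDualSection D f U) (hU : IsOpen U) {x₀ : M} (hx₀ : x₀ ∈ U) {g : E → F →L[ℝ] ℝ}
    (hg : g = fun y => (f ((extChartAt 𝓘(ℝ, E) x₀).symm y)).comp
      ((trivializationAt F V x₀).symmL ℝ ((extChartAt 𝓘(ℝ, E) x₀).symm y)))
    (hgd : DifferentiableAt ℝ g (extChartAt 𝓘(ℝ, E) x₀ x₀)) (u : E) (w : F) :
    fderiv ℝ g (extChartAt 𝓘(ℝ, E) x₀ x₀) u w = g (extChartAt 𝓘(ℝ, E) x₀ x₀)
      (christoffel D x₀ (extChartAt 𝓘(ℝ, E) x₀ x₀) w u) := by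
  have hx := mem_coordDomain_self (E := E) (F := F) (V := V) x₀
  have hx' : x₀ ∈ (trivializationAt E (TangentSpace 𝓘(ℝ, E)) x₀).baseSet := by simp
  have hU' := hU.inter (isOpen_coordDomain (E := E) (F := F) (V := V) x₀)
  have hsec : SmoothSection 𝓘(ℝ, E) F (fun y => (trivializationAt F V x₀).symmL ℝ y w)
      (U ∩ coordDomain E F V x₀) :=
    (contMDiffOn_symmL_const (E := E) (V := V) x₀ w).mono
      (inter_subset_right.trans inter_subset_right)
  have h := hf.2 _ hU' inter_subset_left _ hsec x₀ ⟨hx₀, hx⟩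
    ((trivializationAt E (TangentSpace 𝓘(ℝ, E)) x₀).symmL ℝ x₀ u)
  rw [mvfderiv_eq_fderiv_comp 𝓘(ℝ, E) hx.1 (g := fun y => g y w) (by
      filter_upwards [(isOpen_coordDomain x₀).mem_nhds hx] with z hz
      rw [hg]
      exact (congrArg (fun z' => f z' ((trivializationAt F V x₀).symmL ℝ z' w))
        (extChartAt_left_inv_of_mem hz)).symm) (hgd.clm_apply (differentiableAt_const w)),
    ContinuousLinearMap.comp_apply, Trivialization.continuousLinearMapAt_symmL _ hx',
    fderiv_clm_apply hgd (differentiableAt_const w)] at h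
  rw [christoffel_apply_of_mem D hx]
  have hg0 : g (extChartAt 𝓘(ℝ, E) x₀ x₀) = (f x₀).comp ((trivializationAt F V x₀).symmL ℝ x₀) := by
    rw [hg]
    exact congrArg (fun z' => (f z').comp ((trivializationAt F V x₀).symmL ℝ z'))
      (extChartAt_left_inv_of_mem hx)
  rw [hg0]
  simp only [ContinuousLinearMap.comp_apply, Trivialization.symmL_continuousLinearMapAt _ hx.2]
  simpa [sub_eq_zero] using h

/-- The domain of sections that are defined on an open subset of the coordinate space. -/
lemma isOpen_coordDomain_inter_preimage (x₀ : M) {O : Set E} (hO : IsOpen O) :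
    IsOpen (coordDomain E F V x₀ ∩ extChartAt 𝓘(ℝ, E) x₀ ⁻¹' O) :=
  ((continuousOn_extChartAt x₀).mono fun x hx => by
    rw [extChartAt_source]
    exact hx.1).isOpen_inter_preimage (isOpen_coordDomain x₀) hO

lemma contMDiffOn_comp_extChartAt {F' : Type*} [NormedAddCommGroup F'] [NormedSpace ℝ F']
    {g : E → F'} {x₀ : M} {O : Set E} (hg : ContDiffOn ℝ ∞ g O) :
    ContMDiffOn 𝓘(ℝ, E) 𝓘(ℝ, F') ∞ (g ∘ extChartAt 𝓘(ℝ, E) x₀)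
      (coordDomain E F V x₀ ∩ extChartAt 𝓘(ℝ, E) x₀ ⁻¹' O) :=
  hg.contMDiffOn.comp ((contMDiffOn_extChartAt (x := x₀)).mono fun _ hx => hx.1.1) fun _ hx => hx.2

/-- Through every vector there is a local flat section. -/
theorem exists_flatSection (hD : IsSmoothConnection D) (hflat : IsFlatConnection D) (x₀ : M)
    (c : F) : ∃ U : Set M, IsOpen U ∧ x₀ ∈ U ∧ ∃ s : ∀ x, V x, IsFlatSection D s U ∧
      (trivializationAt F V x₀).continuousLinearMapAt ℝ x₀ (s x₀) = c := by
  have : CompleteSpace F := FiniteDimensional.complete ℝ F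
  have hx₀ := mem_coordDomain_self (E := E) (F := F) (V := V) x₀
  have hT := (isOpen_coordTarget (E := E) (F := F) (V := V) x₀).mem_nhds
    (extChartAt_mem_coordTarget hx₀)
  have hΓ := contDiffOn_christoffel D hD x₀
  obtain ⟨g, hg0, hg⟩ := exists_parallel (hΓ.contDiffAt hT) (by
    filter_upwards [hT] with y hy
    exact christoffel_flat D hD hflat hy) c
  obtain ⟨O, hOg, hO, hyO⟩ := eventually_nhds_iff.1 (hg.and hT)
  have hgs : ContDiffOn ℝ ∞ g O :=
    contDiffOn_of_parallel hO (hΓ.mono fun y hy => (hOg y hy).2) fun y hy => (hOg y hy).1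
  refine ⟨_, isOpen_coordDomain_inter_preimage (F := F) (V := V) x₀ hO, ⟨hx₀, hyO⟩,
    fun x => (trivializationAt F V x₀).symmL ℝ x (g (extChartAt 𝓘(ℝ, E) x₀ x)), ⟨?_, ?_⟩, ?_⟩
  · rw [SmoothSection, Trivialization.contMDiffOn_section_iff (trivializationAt F V x₀)
      (isOpen_coordDomain_inter_preimage x₀ hO) fun x hx => hx.1.2]
    refine (contMDiffOn_comp_extChartAt hgs).congr fun x hx => ?_
    have h := Trivialization.continuousLinearMapAt_symmL (R := ℝ) (trivializationAt F V x₀)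
      hx.1.2 (g (extChartAt 𝓘(ℝ, E) x₀ x))
    rwa [Trivialization.continuousLinearMapAt_apply, Trivialization.linearMapAt_apply,
      if_pos hx.1.2] at h
  · intro x hx
    ext u
    have hgx := (hOg _ hx.2).1
    have h := continuousLinearMapAt_covariantDerivative D hx.1
      (s := fun x => (trivializationAt F V x₀).symmL ℝ x (g (extChartAt 𝓘(ℝ, E) x₀ x)))
      (g := g) (by
        filter_upwards [(isOpen_coordDomain x₀).mem_nhds hx.1] with z hz
        exact Trivialization.continuousLinearMapAt_symmL _ hz.2 _) hgx.differentiableAt u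
    rw [hgx.fderiv, _root_.neg_apply, neg_add_cancel] at h
    rw [← Trivialization.symmL_continuousLinearMapAt (R := ℝ) (trivializationAt F V x₀) hx.1.2
      (D _ x u), h, map_zero, _root_.zero_apply]
  · rw [Trivialization.continuousLinearMapAt_symmL _ hx₀.2, hg0]

/-- Through every covector there is a local flat section of the dual bundle. -/
theorem exists_flatDualSection (hD : IsSmoothConnection D) (hflat : IsFlatConnection D) (x₀ : M)
    (c : F →L[ℝ] ℝ) : ∃ U : Set M, IsOpen U ∧ x₀ ∈ U ∧ ∃ f : ∀ x, V x →L[ℝ] ℝ,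
      IsFlatDualSection D f U ∧ (f x₀).comp ((trivializationAt F V x₀).symmL ℝ x₀) = c := by
  have hx₀ := mem_coordDomain_self (E := E) (F := F) (V := V) x₀
  have hT := (isOpen_coordTarget (E := E) (F := F) (V := V) x₀).mem_nhds
    (extChartAt_mem_coordTarget hx₀)
  have hΓ := contDiffOn_christoffel D hD x₀
  have hΓ' : ContDiffOn ℝ ∞ (fun y => dualForm E F (christoffel D x₀ y)) (coordTarget E F V x₀) :=
    (dualForm E F).contDiff.comp_contDiffOn hΓ
  obtain ⟨g, hg0, hg⟩ := exists_parallel (hΓ'.contDiffAt hT) (by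
    filter_upwards [(isOpen_coordTarget (E := E) (F := F) (V := V) x₀).mem_nhds
      (extChartAt_mem_coordTarget hx₀)] with y hy f u u'
    have hd : DifferentiableAt ℝ (christoffel D x₀) y :=
      (hΓ.contDiffAt ((isOpen_coordTarget x₀).mem_nhds hy)).differentiableAt (by simp)
    have hfd : fderiv ℝ (fun y => dualForm E F (christoffel D x₀ y)) y =
        (dualForm E F).comp (fderiv ℝ (christoffel D x₀) y) :=
      ((dualForm E F).hasFDerivAt.comp y hd.hasFDerivAt).fderiv
    ext w
    have h := congrArg f (christoffel_flat D hD hflat hy w u u')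
    rw [hfd]
    simp only [_root_.add_apply, _root_.sub_apply, ContinuousLinearMap.comp_apply,
      dualForm_apply, map_add, map_sub, map_zero, _root_.zero_apply] at h ⊢
    linarith) c
  obtain ⟨O, hOg, hO, hyO⟩ := eventually_nhds_iff.1 (hg.and hT)
  have hgs : ContDiffOn ℝ ∞ g O :=
    contDiffOn_of_parallel hO (hΓ'.mono fun y hy => (hOg y hy).2) fun y hy => (hOg y hy).1
  refine ⟨_, isOpen_coordDomain_inter_preimage (F := F) (V := V) x₀ hO, ⟨hx₀, hyO⟩,
    fun x => (g (extChartAt 𝓘(ℝ, E) x₀ x)).comp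
      ((trivializationAt F V x₀).continuousLinearMapAt ℝ x), ⟨?_, ?_⟩, ?_⟩
  · intro x hx
    have hU := (isOpen_coordDomain_inter_preimage (F := F) (V := V) x₀ hO).mem_nhds hx
    refine ContMDiffAt.contMDiffWithinAt ((contMDiffAt_hom_section_iff (F₁ := F) (W₁ := V)
      (F₂ := ℝ) (W₂ := Bundle.Trivial M ℝ) (x₀ := x₀) hx.1.2 (by simp)).2 ?_)
    refine ((contMDiffOn_comp_extChartAt hgs).contMDiffAt hU).congr_of_eventuallyEq ?_
    filter_upwards [hU] with z hz
    ext w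
    have h := congrArg (g (extChartAt 𝓘(ℝ, E) x₀ z))
      (Trivialization.continuousLinearMapAt_symmL (R := ℝ) (trivializationAt F V x₀) hz.1.2 w)
    simpa using h
  · intro U' hU' hUU' s hs x hx u
    have hxU := hUU' hx
    have hgx := (hOg _ hxU.2).1
    have hsm := (hs x hx).contMDiffAt (hU'.mem_nhds hx)
    rw [Trivialization.contMDiffAt_section_iff (trivializationAt F V x₀) hxU.1.2] at hsm
    have hsm' := contDiffAt_comp_symm (n := ⊤) hxU.1.1
      (hsm.congr_of_eventuallyEq (eventually_continuousLinearMapAt x₀ hxU.1.2 s).symm)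
    obtain ⟨r, hr⟩ : ∃ r : E → F, r = (fun y => (trivializationAt F V x₀).continuousLinearMapAt ℝ
      y (s y)) ∘ (extChartAt 𝓘(ℝ, E) x₀).symm := ⟨_, rfl⟩
    rw [← hr] at hsm'
    have hrd := hsm'.differentiableAt (by simp)
    have hrs : (fun y => (trivializationAt F V x₀).continuousLinearMapAt ℝ y (s y)) =ᶠ[𝓝 x]
        r ∘ extChartAt 𝓘(ℝ, E) x₀ := by
      filter_upwards [(isOpen_coordDomain x₀).mem_nhds hxU.1] with z hz
      rw [hr]
      exact (congrArg (fun z' => (trivializationAt F V x₀).continuousLinearMapAt ℝ z' (s z'))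
        (extChartAt_left_inv_of_mem hz)).symm
    have h1 := mvfderiv_eq_fderiv_comp 𝓘(ℝ, E) hxU.1.1
      (f := fun y => ((g (extChartAt 𝓘(ℝ, E) x₀ y)).comp
        ((trivializationAt F V x₀).continuousLinearMapAt ℝ y)) (s y))
      (g := fun y => g y (r y)) (by
        filter_upwards [hrs] with z hz
        exact congrArg (g (extChartAt 𝓘(ℝ, E) x₀ z)) hz)
      (hgx.differentiableAt.clm_apply hrd)
    have h2 := continuousLinearMapAt_covariantDerivative D hxU.1 hrs hrd u
    rw [h1, ContinuousLinearMap.comp_apply, ContinuousLinearMap.comp_apply, h2,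
      fderiv_clm_apply hgx.differentiableAt hrd, hgx.fderiv]
    simp only [_root_.add_apply, ContinuousLinearMap.comp_apply, ContinuousLinearMap.flip_apply,
      _root_.neg_apply, dualForm_apply, map_add]
    ring
  · ext w
    have h := congrArg (g (extChartAt 𝓘(ℝ, E) x₀ x₀))
      (Trivialization.continuousLinearMapAt_symmL (R := ℝ) (trivializationAt F V x₀) hx₀.2 w)
    exact h.trans (by rw [hg0])

lemma IsFlatGenSection.mono {σ : ∀ x, GenFiber V x} {U U' : Set M} (hσ : IsFlatGenSection D σ U)
    (h : U' ⊆ U) : IsFlatGenSection D σ U' :=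
  ⟨⟨hσ.1.1.mono h, fun x hx => hσ.1.2 x (h hx)⟩,
    ⟨hσ.2.1.mono h, fun U'' hU'' hU' => hσ.2.2 U'' hU'' (hU'.trans h)⟩⟩

/-- Through every vector of `V ⊕ V^∨` there is a local flat section. -/
theorem exists_flatGenSection (hD : IsSmoothConnection D) (hflat : IsFlatConnection D) (x₀ : M)
    (c : GenFiber V x₀) : ∃ U : Set M, IsOpen U ∧ x₀ ∈ U ∧ ∃ σ : ∀ x, GenFiber V x,
      IsFlatGenSection D σ U ∧ σ x₀ = c := by
  have hx₀ : x₀ ∈ (trivializationAt F V x₀).baseSet := mem_baseSet_trivializationAt' x₀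
  obtain ⟨U, hU, hxU, s, hs, hsc⟩ := exists_flatSection D hD hflat x₀ (genCoord F x₀ x₀ c).1
  obtain ⟨U', hU', hxU', f, hf, hfc⟩ := exists_flatDualSection D hD hflat x₀ (genCoord F x₀ x₀ c).2
  refine ⟨U ∩ U', hU.inter hU', ⟨hxU, hxU'⟩, fun x => (s x, f x),
    ⟨⟨hs.1.mono inter_subset_left, fun x hx => hs.2 x hx.1⟩,
    ⟨hf.1.mono inter_subset_right, fun U'' hU'' h => hf.2 U'' hU'' (h.trans inter_subset_right)⟩⟩, ?_⟩
  change (s x₀, f x₀) = c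
  rw [← genCoordSymm_genCoord hx₀ (s x₀, f x₀), ← genCoordSymm_genCoord hx₀ c]
  exact congrArg _ (Prod.ext hsc hfc)

end FlatCoordinates

/-! ### The splitting of the tangent bundle of the total space in coordinates -/

section TotalSpaceCoordinates

variable {E : Type*} [NormedAddCommGroup E] [NormedSpace ℝ E]
  {M : Type*} [TopologicalSpace M] [ChartedSpace E M] [IsManifold 𝓘(ℝ, E) ∞ M]
  {F : Type*} [NormedAddCommGroup F] [NormedSpace ℝ F]
  {V : M → Type*} [TopologicalSpace (TotalSpace F V)]
  [∀ x, AddCommGroup (V x)] [∀ x, Module ℝ (V x)] [∀ x, TopologicalSpace (V x)]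
  [∀ x, IsTopologicalAddGroup (V x)] [∀ x, ContinuousSMul ℝ (V x)]
  [FiberBundle F V] [VectorBundle ℝ F V] [ContMDiffVectorBundle ∞ F V 𝓘(ℝ, E)]

lemma extChartAt_totalSpace_apply {p₀ p : TotalSpace F V}
    (hp : p.proj ∈ coordDomain E F V p₀.proj) :
    extChartAt (𝓘(ℝ, E).prod 𝓘(ℝ, F)) p₀ p = (extChartAt 𝓘(ℝ, E) p₀.proj p.proj,
      (trivializationAt F V p₀.proj).continuousLinearMapAt ℝ p.proj p.2) := by
  have h : extChartAt (𝓘(ℝ, E).prod 𝓘(ℝ, F)) p₀ p =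
      (extChartAt 𝓘(ℝ, E) p₀.proj (trivializationAt F V p₀.proj p).1,
        (trivializationAt F V p₀.proj p).2) := by
    rw [FiberBundle.extChartAt]
    rfl
  rw [h, Trivialization.continuousLinearMapAt_apply, Trivialization.linearMapAt_apply,
    if_pos hp.2, Trivialization.coe_fst' _ hp.2]

lemma mem_chartAt_totalSpace_source {p₀ p : TotalSpace F V} :
    p ∈ (chartAt (ModelProd E F) p₀).source ↔ p.proj ∈ coordDomain E F V p₀.proj := by
  rw [FiberBundle.chartedSpace_chartAt]
  simp only [coordDomain, mfld_simps, mem_inter_iff]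
  constructor
  · rintro ⟨h1, h2⟩
    rw [Trivialization.coe_fst _ h1] at h2
    exact ⟨h2, (Trivialization.mem_source _).1 h1⟩
  · rintro ⟨h1, h2⟩
    refine ⟨(Trivialization.mem_source _).2 h2, ?_⟩
    rwa [Trivialization.coe_fst' _ h2]

lemma extend_eq_symmL (p : TotalSpace F V) {x : M}
    (hx : x ∈ (trivializationAt F V p.proj).baseSet) : extend F p.2 x =
      (trivializationAt F V p.proj).symmL ℝ x (trivializationAt F V p.proj p).2 :=
  (Trivialization.symmL_apply _ hx _).symm

/-- The coordinates of a tangent vector of the total space in the preferred chart at `p₀`. -/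
def tangentCoord (p₀ p : TotalSpace F V) :
    TangentSpace (𝓘(ℝ, E).prod 𝓘(ℝ, F)) p →L[ℝ] E × F :=
  (trivializationAt (E × F) (TangentSpace (𝓘(ℝ, E).prod 𝓘(ℝ, F)) : TotalSpace F V → Type _)
    p₀).continuousLinearMapAt ℝ p

lemma tangentCoord_mfderiv {E' : Type*} [NormedAddCommGroup E'] [NormedSpace ℝ E'] {H' : Type*}
    [TopologicalSpace H'] {I' : ModelWithCorners ℝ E' H'} {N : Type*} [TopologicalSpace N]
    [ChartedSpace H' N] {f : N → TotalSpace F V} {y : N} {p₀ p : TotalSpace F V}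
    (hf : MDifferentiableAt I' (𝓘(ℝ, E).prod 𝓘(ℝ, F)) f y) (hfy : f y = p)
    (hp : p.proj ∈ coordDomain E F V p₀.proj) (v : TangentSpace I' y) :
    tangentCoord p₀ p (mfderiv I' (𝓘(ℝ, E).prod 𝓘(ℝ, F)) f y v) =
      mvfderiv I' (fun y => extChartAt (𝓘(ℝ, E).prod 𝓘(ℝ, F)) p₀ (f y)) y v := by
  have hp' := mem_chartAt_totalSpace_source.2 hp
  rw [tangentCoord, TangentBundle.continuousLinearMapAt_trivializationAt hp']
  exact (mfderiv_comp_apply_of_eq y (mdifferentiableAt_extChartAt hp') hf hfy v).symm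

lemma tangentCoord_injective {p₀ p : TotalSpace F V} (hp : p.proj ∈ coordDomain E F V p₀.proj) :
    Function.Injective (tangentCoord (E := E) p₀ p) := by
  intro ξ ξ' h
  have hb : p ∈ (trivializationAt (E × F)
      (TangentSpace (𝓘(ℝ, E).prod 𝓘(ℝ, F)) : TotalSpace F V → Type _) p₀).baseSet := by
    simpa using mem_chartAt_totalSpace_source.2 hp
  have h' := fun ξ => Trivialization.symmL_continuousLinearMapAt (R := ℝ) (trivializationAt (E × F)
      (TangentSpace (𝓘(ℝ, E).prod 𝓘(ℝ, F)) : TotalSpace F V → Type _) p₀) hb ξ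
  rw [← h' ξ, ← h' ξ']
  exact congrArg _ h

lemma tangentCoord_vertical {p₀ p : TotalSpace F V} (hp : p.proj ∈ coordDomain E F V p₀.proj)
    (v : V p.proj) : tangentCoord p₀ p (vertical 𝓘(ℝ, E) p v) =
      (0, (trivializationAt F V p₀.proj).continuousLinearMapAt ℝ p.proj v) := by
  have hb : p.proj ∈ (trivializationAt F V p.proj).baseSet := mem_baseSet_trivializationAt' _
  obtain ⟨f, hf⟩ : ∃ f : F → TotalSpace F V, f = fun w : F =>
    TotalSpace.mk' F p.proj ((trivializationAt F V p.proj).symm p.proj w) := ⟨_, rfl⟩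
  have hfp : f (trivializationAt F V p.proj p).2 = p := by
    rw [hf]
    exact Bundle.TotalSpace.ext rfl (heq_of_eq ((trivializationAt F V p.proj).symm_apply_apply_mk hb p.2))
  have hΨ : (fun w => extChartAt (𝓘(ℝ, E).prod 𝓘(ℝ, F)) p₀ (f w)) = fun w =>
      (extChartAt 𝓘(ℝ, E) p₀.proj p.proj,
        (((trivializationAt F V p₀.proj).continuousLinearMapAt ℝ p.proj).comp
          ((trivializationAt F V p.proj).symmL ℝ p.proj)) w) := by
    funext w
    rw [hf]
    refine (extChartAt_totalSpace_apply (p := TotalSpace.mk' F p.proj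
      ((trivializationAt F V p.proj).symm p.proj w)) hp).trans ?_
    rw [ContinuousLinearMap.comp_apply, Trivialization.symmL_apply _ hb]
  have hfd : MDifferentiableAt 𝓘(ℝ, F) (𝓘(ℝ, E).prod 𝓘(ℝ, F)) f
      (trivializationAt F V p.proj p).2 := by
    have h : ContMDiffAt 𝓘(ℝ, F) (𝓘(ℝ, E).prod 𝓘(ℝ, F)) ∞ f (trivializationAt F V p.proj p).2 := by
      have := Trivialization.contMDiffAt_iff (IB := 𝓘(ℝ, E)) (IM := 𝓘(ℝ, F)) (n := ∞)
        (e := trivializationAt F V p.proj) (f := f) (x₀ := (trivializationAt F V p.proj p).2)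
        (by rw [hfp]; exact (trivializationAt F V p.proj).mem_source.2 hb)
      refine this.2 ⟨?_, ?_⟩
      · rw [hf]; exact contMDiffAt_const
      · refine contMDiffAt_id.congr_of_eventuallyEq (Filter.Eventually.of_forall fun w => ?_)
        rw [hf]
        exact congrArg Prod.snd ((trivializationAt F V p.proj).apply_mk_symm hb w)
    exact h.mdifferentiableAt (by simp)
  refine (congrArg (tangentCoord p₀ p) (?_ : _ = mfderiv 𝓘(ℝ, F) (𝓘(ℝ, E).prod 𝓘(ℝ, F)) f
      (trivializationAt F V p.proj p).2
      ((trivializationAt F V p.proj).continuousLinearMapAt ℝ p.proj v))).trans ?_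
  · rw [hf]
    rfl
  refine (tangentCoord_mfderiv hfd hfp hp _).trans ?_
  rw [hΨ, mvfderiv, mfderiv_eq_fderiv]
  have h := ((hasFDerivAt_const (extChartAt 𝓘(ℝ, E) p₀.proj p.proj)
    (trivializationAt F V p.proj p).2).prodMk
      (((trivializationAt F V p₀.proj).continuousLinearMapAt ℝ p.proj).comp
          ((trivializationAt F V p.proj).symmL ℝ p.proj)).hasFDerivAt).fderiv
  refine (DFunLike.congr_fun h _).trans (Prod.ext rfl ?_)
  exact congrArg ((trivializationAt F V p₀.proj).continuousLinearMapAt ℝ p.proj)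
    (Trivialization.symmL_continuousLinearMapAt _ hb v)

lemma continuousLinearMapAt_projDeriv {p₀ p : TotalSpace F V}
    (hp : p.proj ∈ coordDomain E F V p₀.proj) (ξ : TangentSpace (𝓘(ℝ, E).prod 𝓘(ℝ, F)) p) :
    (trivializationAt E (TangentSpace 𝓘(ℝ, E)) p₀.proj).continuousLinearMapAt ℝ p.proj
      (projDeriv 𝓘(ℝ, E) p ξ) = (tangentCoord p₀ p ξ).1 := by
  have hp' := mem_chartAt_totalSpace_source.2 hp
  have h1 := mvfderiv_eq_fderiv_comp (𝓘(ℝ, E).prod 𝓘(ℝ, F)) hp'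
    (f := fun q : TotalSpace F V => extChartAt 𝓘(ℝ, E) p₀.proj q.proj) (g := Prod.fst) (by
      filter_upwards [(chartAt (ModelProd E F) p₀).open_source.mem_nhds hp'] with q hq
      exact (congrArg Prod.fst
        (extChartAt_totalSpace_apply (mem_chartAt_totalSpace_source.1 hq))).symm)
    differentiableAt_fst
  have h2 := mfderiv_comp_apply (I'' := 𝓘(ℝ, E)) p (g := extChartAt 𝓘(ℝ, E) p₀.proj)
    (f := fun q : TotalSpace F V => q.proj) (mdifferentiableAt_extChartAt hp.1)
    (((contMDiffAt_proj V (n := 1)).mdifferentiableAt (by simp)) :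
      MDifferentiableAt (𝓘(ℝ, E).prod 𝓘(ℝ, F)) 𝓘(ℝ, E) (fun q : TotalSpace F V => q.proj) p) ξ
  rw [TangentBundle.continuousLinearMapAt_trivializationAt hp.1]
  refine h2.symm.trans ((DFunLike.congr_fun h1 ξ).trans ?_)
  rw [fderiv_fst]
  rfl

variable [FiniteDimensional ℝ F] (D : CovariantDerivative 𝓘(ℝ, E) F V)

lemma tangentCoord_horizontal {p₀ p : TotalSpace F V} (hp : p.proj ∈ coordDomain E F V p₀.proj)
    (u : TangentSpace 𝓘(ℝ, E) p.proj) : tangentCoord p₀ p (horizontal D p u) =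
      ((trivializationAt E (TangentSpace 𝓘(ℝ, E)) p₀.proj).continuousLinearMapAt ℝ p.proj u,
        -christoffel D p₀.proj (extChartAt 𝓘(ℝ, E) p₀.proj p.proj)
          ((trivializationAt F V p₀.proj).continuousLinearMapAt ℝ p.proj p.2)
          ((trivializationAt E (TangentSpace 𝓘(ℝ, E)) p₀.proj).continuousLinearMapAt ℝ
            p.proj u)) := by
  have hb : p.proj ∈ (trivializationAt F V p.proj).baseSet := mem_baseSet_trivializationAt' _
  obtain ⟨s, hs⟩ : ∃ s : ∀ x, V x, s = extend F p.2 := ⟨_, rfl⟩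
  have hsp : s p.proj = p.2 := by rw [hs, extend_apply_self]
  have hsmooth : ContMDiffAt 𝓘(ℝ, E) (𝓘(ℝ, E).prod 𝓘(ℝ, F)) ∞
      (fun x => TotalSpace.mk' F x (s x)) p.proj := by
    rw [hs]
    exact ((contMDiffOn_symmL_const (E := E) (V := V) p.proj (trivializationAt F V p.proj p).2).congr
      (fun x hx => congrArg (TotalSpace.mk' F x) (extend_eq_symmL p hx)) p.proj hb).contMDiffAt ((trivializationAt F V p.proj).open_baseSet.mem_nhds hb)
  have hsm := hsmooth
  rw [Trivialization.contMDiffAt_section_iff (trivializationAt F V p₀.proj) hp.2] at hsm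
  have hsm' := contDiffAt_comp_symm (n := ⊤) hp.1
    (hsm.congr_of_eventuallyEq (eventually_continuousLinearMapAt p₀.proj hp.2 s).symm)
  obtain ⟨g, hg⟩ : ∃ g : E → F, g = (fun y => (trivializationAt F V p₀.proj).continuousLinearMapAt ℝ
      y (s y)) ∘ (extChartAt 𝓘(ℝ, E) p₀.proj).symm := ⟨_, rfl⟩
  rw [← hg] at hsm'
  have hgd := hsm'.differentiableAt (by simp)
  have hsg : (fun y => (trivializationAt F V p₀.proj).continuousLinearMapAt ℝ y (s y)) =ᶠ[𝓝 p.proj]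
      g ∘ extChartAt 𝓘(ℝ, E) p₀.proj := by
    filter_upwards [(isOpen_coordDomain p₀.proj).mem_nhds hp] with z hz
    rw [hg]
    exact (congrArg (fun z' => (trivializationAt F V p₀.proj).continuousLinearMapAt ℝ z' (s z'))
      (extChartAt_left_inv_of_mem hz)).symm
  have hgp : g (extChartAt 𝓘(ℝ, E) p₀.proj p.proj) =
      (trivializationAt F V p₀.proj).continuousLinearMapAt ℝ p.proj p.2 := by
    rw [← hsp]
    exact hsg.eq_of_nhds.symm
  have h1 := mvfderiv_eq_fderiv_comp 𝓘(ℝ, E) hp.1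
    (f := fun x => extChartAt (𝓘(ℝ, E).prod 𝓘(ℝ, F)) p₀ (TotalSpace.mk' F x (s x)))
    (g := fun y => (y, g y)) (by
      filter_upwards [hsg, (isOpen_coordDomain p₀.proj).mem_nhds hp] with z hz hz'
      refine (extChartAt_totalSpace_apply (p := TotalSpace.mk' F z (s z)) hz').trans ?_
      exact Prod.ext rfl hz) (differentiableAt_id.prodMk hgd)
  have h2 := tangentCoord_mfderiv (p₀ := p₀) (p := p) (hsmooth.mdifferentiableAt (by simp))
    (Bundle.TotalSpace.ext rfl (heq_of_eq hsp)) hp u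
  have hG : fderiv ℝ (fun y => (y, g y)) (extChartAt 𝓘(ℝ, E) p₀.proj p.proj) =
      (ContinuousLinearMap.id ℝ E).prod (fderiv ℝ g (extChartAt 𝓘(ℝ, E) p₀.proj p.proj)) :=
    ((hasFDerivAt_id _).prodMk hgd.hasFDerivAt).fderiv
  rw [h1, hG] at h2
  have h3 := tangentCoord_vertical hp (D s p.proj u)
  rw [continuousLinearMapAt_covariantDerivative D hp hsg hgd u, hgp] at h3
  have h4 : horizontal D p u = (show TangentSpace (𝓘(ℝ, E).prod 𝓘(ℝ, F)) p from
      mfderiv 𝓘(ℝ, E) (𝓘(ℝ, E).prod 𝓘(ℝ, F)) (fun x => TotalSpace.mk' F x (s x)) p.proj u) -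
      vertical 𝓘(ℝ, E) p (D s p.proj u) := by
    rw [hs]
    rfl
  rw [h4, map_sub]
  refine (congrArg₂ (fun a b => a - b) h2 h3).trans ?_
  refine Prod.ext ?_ ?_
  · exact sub_zero _
  · exact sub_add_cancel_left _ _

/-- The splitting in coordinates centered at the base point. -/
lemma continuousLinearMapAt_splitting_self (p : TotalSpace F V)
    (ξ : TangentSpace (𝓘(ℝ, E).prod 𝓘(ℝ, F)) p) :
    (trivializationAt F V p.proj).continuousLinearMapAt ℝ p.proj (splitting D p ξ) =
      (tangentCoord p p ξ).2 + christoffel D p.proj (extChartAt 𝓘(ℝ, E) p.proj p.proj)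
        ((trivializationAt F V p.proj).continuousLinearMapAt ℝ p.proj p.2)
        (tangentCoord p p ξ).1 := by
  have hp := mem_coordDomain_self (E := E) (F := F) (V := V) p.proj
  have hp' := mem_chartAt_totalSpace_source.2 hp
  have h1 := mvfderiv_eq_fderiv_comp (𝓘(ℝ, E).prod 𝓘(ℝ, F)) hp'
    (f := fun q : TotalSpace F V => (trivializationAt F V p.proj q).2) (g := Prod.snd) (by
      filter_upwards with q
      rw [Function.comp_apply, FiberBundle.extChartAt]
      rfl) differentiableAt_snd
  have hw : (trivializationAt F V p.proj p).2 =
      (trivializationAt F V p.proj).continuousLinearMapAt ℝ p.proj p.2 := by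
    rw [Trivialization.continuousLinearMapAt_apply, Trivialization.linearMapAt_apply, if_pos hp.2]
  have h2 := continuousLinearMapAt_covariantDerivative D hp (s := extend F p.2)
    (g := fun _ => (trivializationAt F V p.proj p).2) (by
      filter_upwards [(trivializationAt F V p.proj).open_baseSet.mem_nhds hp.2] with y hy
      rw [extend_eq_symmL p hy]
      exact Trivialization.continuousLinearMapAt_symmL _ hy _) (differentiableAt_const _)
    (projDeriv 𝓘(ℝ, E) p ξ)
  have h3 := continuousLinearMapAt_projDeriv hp ξ
  have h4 : splitting D p ξ = (trivializationAt F V p.proj).symmL ℝ p.proj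
      (mvfderiv (𝓘(ℝ, E).prod 𝓘(ℝ, F))
        (fun q : TotalSpace F V => (trivializationAt F V p.proj q).2) p ξ) +
      D (extend F p.2) p.proj (projDeriv 𝓘(ℝ, E) p ξ) := rfl
  rw [h4, map_add, h2, h3, h1, Trivialization.continuousLinearMapAt_symmL _ hp.2, hw, fderiv_snd]
  simp
  rfl

lemma vertical_splitting_add_horizontal_projDeriv (p : TotalSpace F V)
    (ξ : TangentSpace (𝓘(ℝ, E).prod 𝓘(ℝ, F)) p) :
    vertical 𝓘(ℝ, E) p (splitting D p ξ) + horizontal D p (projDeriv 𝓘(ℝ, E) p ξ) = ξ := by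
  have hp := mem_coordDomain_self (E := E) (F := F) (V := V) p.proj
  refine tangentCoord_injective hp ?_
  rw [map_add, tangentCoord_vertical hp, tangentCoord_horizontal D hp,
    continuousLinearMapAt_projDeriv hp, continuousLinearMapAt_splitting_self]
  refine Prod.ext ?_ ?_
  · exact zero_add _
  · exact add_neg_cancel_right _ _

/-- The splitting in coordinates. -/
lemma continuousLinearMapAt_splitting {p₀ p : TotalSpace F V}
    (hp : p.proj ∈ coordDomain E F V p₀.proj) (ξ : TangentSpace (𝓘(ℝ, E).prod 𝓘(ℝ, F)) p) :
    (trivializationAt F V p₀.proj).continuousLinearMapAt ℝ p.proj (splitting D p ξ) =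
      (tangentCoord p₀ p ξ).2 + christoffel D p₀.proj (extChartAt 𝓘(ℝ, E) p₀.proj p.proj)
        ((trivializationAt F V p₀.proj).continuousLinearMapAt ℝ p.proj p.2)
        (tangentCoord p₀ p ξ).1 := by
  have h := congrArg (tangentCoord p₀ p) (vertical_splitting_add_horizontal_projDeriv D p ξ)
  rw [map_add, tangentCoord_vertical hp, tangentCoord_horizontal D hp,
    continuousLinearMapAt_projDeriv hp] at h
  rw [← congrArg Prod.snd h]
  exact (neg_add_cancel_right _ _).symm

lemma splitting_vertical_add_horizontal (p : TotalSpace F V) (v : V p.proj)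
    (u : TangentSpace 𝓘(ℝ, E) p.proj) :
    splitting D p (vertical 𝓘(ℝ, E) p v + horizontal D p u) = v ∧
      projDeriv 𝓘(ℝ, E) p (vertical 𝓘(ℝ, E) p v + horizontal D p u) = u := by
  have hp := mem_coordDomain_self (E := E) (F := F) (V := V) p.proj
  have hp' : p.proj ∈ (trivializationAt E (TangentSpace 𝓘(ℝ, E)) p.proj).baseSet := by simp
  have hT := map_add (tangentCoord p p) (vertical 𝓘(ℝ, E) p v) (horizontal D p u)
  rw [tangentCoord_vertical hp, tangentCoord_horizontal D hp] at hT
  have h1 := continuousLinearMapAt_splitting D hp (vertical 𝓘(ℝ, E) p v + horizontal D p u)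
  have h2 := continuousLinearMapAt_projDeriv hp (vertical 𝓘(ℝ, E) p v + horizontal D p u)
  rw [hT] at h1 h2
  constructor
  · rw [← Trivialization.symmL_continuousLinearMapAt (R := ℝ) _ hp.2 (splitting D p _), h1]
    refine (congrArg _ ?_).trans (Trivialization.symmL_continuousLinearMapAt (R := ℝ) _ hp.2 v)
    simp
  · rw [← Trivialization.symmL_continuousLinearMapAt (R := ℝ) _ hp' (projDeriv 𝓘(ℝ, E) p _), h2]
    refine (congrArg _ ?_).trans (Trivialization.symmL_continuousLinearMapAt (R := ℝ) _ hp' u)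
    simp

end TotalSpaceCoordinates

/-! ### Adapted structures -/

section Adapted

variable {E : Type*} [NormedAddCommGroup E] [NormedSpace ℝ E]
  {M : Type*} [TopologicalSpace M] [ChartedSpace E M]
  {F : Type*} [NormedAddCommGroup F] [NormedSpace ℝ F]
  {V : M → Type*} [TopologicalSpace (TotalSpace F V)]
  [∀ x, AddCommGroup (V x)] [∀ x, Module ℝ (V x)] [∀ x, TopologicalSpace (V x)]
  [∀ x, IsTopologicalAddGroup (V x)] [∀ x, ContinuousSMul ℝ (V x)]
  [FiberBundle F V] [VectorBundle ℝ F V]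
  {J : ∀ x : M, GenFiber (V ×ᵇ (TangentSpace 𝓘(ℝ, E) : M → Type _)) x →ₗ[ℝ]
      GenFiber (V ×ᵇ (TangentSpace 𝓘(ℝ, E) : M → Type _)) x} {x : M}

/-- The embedding `v + f ↦ v - f` of `V ⊕ V^∨` in `(V ⊕ T_M) ⊕ (V ⊕ T_M)^∨`. -/
def inclFlip (E : Type*) [NormedAddCommGroup E] [NormedSpace ℝ E] [ChartedSpace E M] (x : M)
    (a : GenFiber V x) : GenFiber (V ×ᵇ (TangentSpace 𝓘(ℝ, E) : M → Type _)) x :=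
  inclV 𝓘(ℝ, E) V x (a.1, -a.2)

lemma inclT_injective : Function.Injective (inclT 𝓘(ℝ, E) V x) := by
  intro a b h
  refine Prod.ext (congrArg (fun c => c.1.2) h) (ContinuousLinearMap.ext fun u => ?_)
  exact congrArg (fun c => c.2 (0, u)) h

lemma inclV_add_inclT (a : GenFiber (V ×ᵇ (TangentSpace 𝓘(ℝ, E) : M → Type _)) x) :
    inclV 𝓘(ℝ, E) V x (a.1.1, a.2.comp (ContinuousLinearMap.inl ℝ (V x) (TangentSpace 𝓘(ℝ, E) x))) +
      inclT 𝓘(ℝ, E) V x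
        (a.1.2, a.2.comp (ContinuousLinearMap.inr ℝ (V x) (TangentSpace 𝓘(ℝ, E) x))) = a := by
  refine Prod.ext (Prod.ext (add_zero _) (zero_add _)) (ContinuousLinearMap.ext fun w => ?_)
  refine (map_add a.2 (w.1, 0) (0, w.2)).symm.trans (congrArg a.2 ?_)
  exact Prod.ext (add_zero _) (zero_add _)

lemma exists_eq_inclFlip_add (hadapted : IsAdapted J)
    (w : GenFiber (V ×ᵇ (TangentSpace 𝓘(ℝ, E) : M → Type _)) x) :
    ∃ a b, w = inclFlip E x a + J x (inclFlip E x b) := by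
  have hflip : ∀ a : GenFiber V x, inclFlip E x (a.1, -a.2) = inclV 𝓘(ℝ, E) V x a := fun a => by
    rw [inclFlip, neg_neg]
  have h : inclT 𝓘(ℝ, E) V x
      (w.1.2, w.2.comp (ContinuousLinearMap.inr ℝ (V x) (TangentSpace 𝓘(ℝ, E) x))) ∈
      Submodule.map (J x) (LinearMap.range (inclV 𝓘(ℝ, E) V x)) := by
    rw [hadapted x]
    exact ⟨_, rfl⟩
  obtain ⟨_, ⟨b, rfl⟩, hb⟩ := h
  refine ⟨(w.1.1, -w.2.comp (ContinuousLinearMap.inl ℝ (V x) (TangentSpace 𝓘(ℝ, E) x))),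
    (b.1, -b.2), ?_⟩
  rw [hflip, hb, inclFlip, neg_neg]
  exact (inclV_add_inclT w).symm

lemma pairing_apply_left (hsq : ∀ x a, J x (J x a) = -a)
    (horth : ∀ x a b, pairing (J x a) (J x b) = pairing a b)
    (a b : GenFiber (V ×ᵇ (TangentSpace 𝓘(ℝ, E) : M → Type _)) x) :
    pairing (J x a) b = -pairing a (J x b) := by
  rw [← horth x a, hsq]
  have h : (J x a).2 (-b).1 = -(J x a).2 b.1 := map_neg _ _
  have h' : (-b).2 (J x a).1 = -b.2 (J x a).1 := rfl
  rw [pairing, pairing, h, h']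
  ring

variable [FiniteDimensional ℝ E]

lemma apply_ofDoubleDual (Φ : Module.Dual ℝ (Module.Dual ℝ (TangentSpace 𝓘(ℝ, E) x)))
    (η : TangentSpace 𝓘(ℝ, E) x →L[ℝ] ℝ) : η (ofDoubleDual 𝓘(ℝ, E) x Φ) = Φ η.toLinearMap := by
  have : FiniteDimensional ℝ (TangentSpace 𝓘(ℝ, E) x) := inferInstanceAs (FiniteDimensional ℝ E)
  exact Module.apply_evalEquiv_symm_apply (R := ℝ) (M := TangentSpace 𝓘(ℝ, E) x) η.toLinearMap Φ

lemma inclT_mapM (hsq : ∀ x a, J x (J x a) = -a)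
    (horth : ∀ x a b, pairing (J x a) (J x b) = pairing a b) (hadapted : IsAdapted J)
    (a : GenFiber V x) : inclT 𝓘(ℝ, E) V x (mapM (J x) a) = J x (inclFlip E x a) := by
  have h : J x (inclFlip E x a) ∈ LinearMap.range (inclT 𝓘(ℝ, E) V x) := by
    rw [← hadapted x]
    exact ⟨_, ⟨_, rfl⟩, rfl⟩
  obtain ⟨b, hb⟩ := h
  have hpair : ∀ c : GenFiber (TangentSpace 𝓘(ℝ, E) : M → Type _) x,
      b.2 c.1 + c.2 b.1 = a.2 (J x (inclT 𝓘(ℝ, E) V x c)).1.1 -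
        (J x (inclT 𝓘(ℝ, E) V x c)).2 (a.1, 0) := by
    intro c
    have h1 := pairing_apply_left hsq horth (inclFlip E x a) (inclT 𝓘(ℝ, E) V x c)
    rw [← hb] at h1
    have h2 : pairing (inclT 𝓘(ℝ, E) V x b) (inclT 𝓘(ℝ, E) V x c) =
      -(1 / 2) * (b.2 c.1 + c.2 b.1) := rfl
    have h3 : pairing (inclFlip E x a) (J x (inclT 𝓘(ℝ, E) V x c)) =
      -(1 / 2) * (-(a.2 (J x (inclT 𝓘(ℝ, E) V x c)).1.1) +
        (J x (inclT 𝓘(ℝ, E) V x c)).2 (a.1, 0)) := rfl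
    rw [h2, h3] at h1
    linarith
  rw [← hb]
  refine congrArg _ (Prod.ext ?_ (ContinuousLinearMap.ext fun u => ?_))
  · obtain ⟨η₀, hη₀⟩ : ∃ w : TangentSpace 𝓘(ℝ, E) x, w = (mapM (J x) a).1 := ⟨_, rfl⟩
    have key : ∀ η : TangentSpace 𝓘(ℝ, E) x →L[ℝ] ℝ, η (mapM (J x) a).1 = η b.1 := by
      intro η
      have h1 := hpair (0, η)
      have h2 : η (mapM (J x) a).1 = η (block13 (J x) a.1) +
          η (ofDoubleDual 𝓘(ℝ, E) x (a.2.toLinearMap ∘ₗ block22 (J x) ∘ₗ toCotangent 𝓘(ℝ, E) x)) :=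
        map_add η _ _
      rw [apply_ofDoubleDual] at h2
      have h3 := pairing_apply_left hsq horth (inclV 𝓘(ℝ, E) V x (a.1, 0))
        (inclT 𝓘(ℝ, E) V x (0, η))
      have h4 : pairing (J x (inclV 𝓘(ℝ, E) V x (a.1, 0))) (inclT 𝓘(ℝ, E) V x (0, η)) =
        -(1 / 2) * ((J x (inclV 𝓘(ℝ, E) V x (a.1, 0))).2 0 + η (block13 (J x) a.1)) := rfl
      have h5 : pairing (inclV 𝓘(ℝ, E) V x (a.1, 0)) (J x (inclT 𝓘(ℝ, E) V x (0, η))) =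
        -(1 / 2) * (0 + (J x (inclT 𝓘(ℝ, E) V x (0, η))).2 (a.1, 0)) := rfl
      have h6 : (a.2.toLinearMap ∘ₗ block22 (J x) ∘ₗ toCotangent 𝓘(ℝ, E) x) η.toLinearMap =
        a.2 (J x (inclT 𝓘(ℝ, E) V x (0, η))).1.1 := rfl
      have h7 : b.2 (0 : TangentSpace 𝓘(ℝ, E) x) = 0 := map_zero _
      rw [h4, h5, map_zero] at h3
      rw [h2, h6]
      simp only [h7, zero_add] at h1
      linarith
    exact (SeparatingDual.eq_iff_forall_dual_eq (R := ℝ) (V := E)).2 key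
  · have h1 := hpair (u, 0)
    have h2 : (mapM (J x) a).2 u = -(J x (inclT 𝓘(ℝ, E) V x (u, 0))).2 (a.1, 0) +
      a.2 (J x (inclT 𝓘(ℝ, E) V x (u, 0))).1.1 := rfl
    have h3 : (0 : TangentSpace 𝓘(ℝ, E) x →L[ℝ] ℝ) b.1 = 0 := rfl
    rw [h2]
    simp only [h3, add_zero] at h1
    linarith

end Adapted

section InclCoordinates

variable {E : Type*} [NormedAddCommGroup E] [NormedSpace ℝ E]
  {M : Type*} [TopologicalSpace M] [ChartedSpace E M] [IsManifold 𝓘(ℝ, E) ∞ M]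
  {F : Type*} [NormedAddCommGroup F] [NormedSpace ℝ F]
  {V : M → Type*} [TopologicalSpace (TotalSpace F V)]
  [∀ x, AddCommGroup (V x)] [∀ x, Module ℝ (V x)] [∀ x, TopologicalSpace (V x)]
  [∀ x, IsTopologicalAddGroup (V x)] [∀ x, ContinuousSMul ℝ (V x)]
  [FiberBundle F V] [VectorBundle ℝ F V] {x₀ x : M}

lemma mem_baseSet_prod (hx : x ∈ coordDomain E F V x₀) : x ∈ (trivializationAt (F × E)
    (V ×ᵇ (TangentSpace 𝓘(ℝ, E) : M → Type _)) x₀).baseSet :=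
  ⟨hx.2, by simpa using hx.1⟩

lemma continuousLinearMapAt_prod (hx : x ∈ coordDomain E F V x₀) (v : V x)
    (u : TangentSpace 𝓘(ℝ, E) x) :
    (trivializationAt (F × E) (V ×ᵇ (TangentSpace 𝓘(ℝ, E) : M → Type _)) x₀).continuousLinearMapAt
      ℝ x (v, u) = ((trivializationAt F V x₀).continuousLinearMapAt ℝ x v,
        (trivializationAt E (TangentSpace 𝓘(ℝ, E)) x₀).continuousLinearMapAt ℝ x u) := by
  have hx' : x ∈ (trivializationAt E (TangentSpace 𝓘(ℝ, E)) x₀).baseSet := by simpa using hx.1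
  rw [Trivialization.continuousLinearMapAt_apply, Trivialization.linearMapAt_apply,
    if_pos (mem_baseSet_prod hx), Trivialization.continuousLinearMapAt_apply,
    Trivialization.linearMapAt_apply, if_pos hx.2, Trivialization.continuousLinearMapAt_apply,
    Trivialization.linearMapAt_apply, if_pos hx']
  rfl

lemma symmL_prod (hx : x ∈ coordDomain E F V x₀) (w : F) (u : E) :
    (trivializationAt (F × E) (V ×ᵇ (TangentSpace 𝓘(ℝ, E) : M → Type _)) x₀).symmL ℝ x (w, u) =
      ((trivializationAt F V x₀).symmL ℝ x w,
        (trivializationAt E (TangentSpace 𝓘(ℝ, E)) x₀).symmL ℝ x u) := by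
  have hx' : x ∈ (trivializationAt E (TangentSpace 𝓘(ℝ, E)) x₀).baseSet := by simpa using hx.1
  have h := continuousLinearMapAt_prod hx ((trivializationAt F V x₀).symmL ℝ x w)
    ((trivializationAt E (TangentSpace 𝓘(ℝ, E)) x₀).symmL ℝ x u)
  rw [Trivialization.continuousLinearMapAt_symmL _ hx.2,
    Trivialization.continuousLinearMapAt_symmL _ hx'] at h
  rw [← h]
  exact Trivialization.symmL_continuousLinearMapAt _ (mem_baseSet_prod hx) _

lemma genCoord_inclV (hx : x ∈ coordDomain E F V x₀) (a : GenFiber V x) :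
    genCoord (F × E) x₀ x (inclV 𝓘(ℝ, E) V x a) = inclFst E (genCoord F x₀ x a) := by
  rw [genCoord_apply]
  refine Prod.ext ?_ (ContinuousLinearMap.ext fun w => ?_)
  · refine (continuousLinearMapAt_prod hx a.1 0).trans (Prod.ext rfl ?_)
    exact map_zero _
  · exact congrArg (fun q => a.2 q.1) (symmL_prod hx w.1 w.2)

lemma genCoord_inclFlip (hx : x ∈ coordDomain E F V x₀) (a : GenFiber V x) :
    genCoord (F × E) x₀ x (inclFlip E x a) =
      inclFst E ((genCoord F x₀ x a).1, -(genCoord F x₀ x a).2) :=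
  genCoord_inclV hx _

lemma genCoord_inclT (hx : x ∈ coordDomain E F V x₀)
    (a : GenFiber (TangentSpace 𝓘(ℝ, E) : M → Type _) x) :
    genCoord (F × E) x₀ x (inclT 𝓘(ℝ, E) V x a) = inclSnd F (genCoord E x₀ x a) := by
  rw [genCoord_apply]
  refine Prod.ext ?_ (ContinuousLinearMap.ext fun w => ?_)
  · refine (continuousLinearMapAt_prod hx 0 a.1).trans (Prod.ext ?_ rfl)
    exact map_zero _
  · exact congrArg (fun q => a.2 q.2) (symmL_prod hx w.1 w.2)

end InclCoordinates

section LiftCoordinates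

variable {E : Type*} [NormedAddCommGroup E] [NormedSpace ℝ E]
  {M : Type*} [TopologicalSpace M] [ChartedSpace E M] [IsManifold 𝓘(ℝ, E) ∞ M]
  {F : Type*} [NormedAddCommGroup F] [NormedSpace ℝ F] [FiniteDimensional ℝ F]
  {V : M → Type*} [TopologicalSpace (TotalSpace F V)]
  [∀ x, AddCommGroup (V x)] [∀ x, Module ℝ (V x)] [∀ x, TopologicalSpace (V x)]
  [∀ x, IsTopologicalAddGroup (V x)] [∀ x, ContinuousSMul ℝ (V x)]
  [FiberBundle F V] [VectorBundle ℝ F V] [ContMDiffVectorBundle ∞ F V 𝓘(ℝ, E)]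
  (D : CovariantDerivative 𝓘(ℝ, E) F V)

lemma splitMap_splitMapInv (p : TotalSpace F V)
    (a : GenFiber (V ×ᵇ (TangentSpace 𝓘(ℝ, E) : M → Type _)) p.proj) :
    splitMap D p (splitMapInv D p a) = a := by
  refine Prod.ext ?_ (ContinuousLinearMap.ext fun w => congrArg a.2 ?_)
  · exact Prod.ext (splitting_vertical_add_horizontal D p a.1.1 a.1.2).1
      (splitting_vertical_add_horizontal D p a.1.1 a.1.2).2
  · exact Prod.ext (splitting_vertical_add_horizontal D p w.1 w.2).1
      (splitting_vertical_add_horizontal D p w.1 w.2).2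

lemma splitMapInv_splitMap (p : TotalSpace F V)
    (a : GenFiber (TangentSpace (𝓘(ℝ, E).prod 𝓘(ℝ, F))) p) :
    splitMapInv D p (splitMap D p a) = a := by
  refine Prod.ext ?_ (ContinuousLinearMap.ext fun ξ => congrArg a.2 ?_)
  · exact vertical_splitting_add_horizontal_projDeriv D p a.1
  · exact vertical_splitting_add_horizontal_projDeriv D p ξ

lemma lift_splitMapInv (J : ∀ x : M, GenFiber (V ×ᵇ (TangentSpace 𝓘(ℝ, E) : M → Type _)) x →ₗ[ℝ]
    GenFiber (V ×ᵇ (TangentSpace 𝓘(ℝ, E) : M → Type _)) x) (p : TotalSpace F V)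
    (a : GenFiber (V ×ᵇ (TangentSpace 𝓘(ℝ, E) : M → Type _)) p.proj) :
    lift D J p (splitMapInv D p a) = splitMapInv D p (J p.proj a) := by
  change splitMapInv D p (J p.proj (splitMap D p (splitMapInv D p a))) = _
  rw [splitMap_splitMapInv]

/-- The section of `T_X ⊕ T_X^∨` corresponding to a section of `(V ⊕ T_M) ⊕ (V ⊕ T_M)^∨`. -/
def liftSection (c : ∀ x, GenFiber (V ×ᵇ (TangentSpace 𝓘(ℝ, E) : M → Type _)) x) :
    GenField (𝓘(ℝ, E).prod 𝓘(ℝ, F)) (TotalSpace F V) :=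
  fun p => splitMapInv D p (c p.proj)

/-- The isomorphism `splitMapInv` in coordinates. -/
lemma genCoord_splitMapInv {p₀ p : TotalSpace F V} (hp : p.proj ∈ coordDomain E F V p₀.proj)
    (a : GenFiber (V ×ᵇ (TangentSpace 𝓘(ℝ, E) : M → Type _)) p.proj) :
    genCoord (E × F) p₀ p (splitMapInv D p a) =
      (frameModel (christoffel D p₀.proj) (extChartAt (𝓘(ℝ, E).prod 𝓘(ℝ, F)) p₀ p)
        (genCoord (F × E) p₀.proj p.proj a).1,
      (genCoord (F × E) p₀.proj p.proj a).2.comp (coframeModel (christoffel D p₀.proj)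
        (extChartAt (𝓘(ℝ, E).prod 𝓘(ℝ, F)) p₀ p))) := by
  have hb : p ∈ (trivializationAt (E × F)
      (TangentSpace (𝓘(ℝ, E).prod 𝓘(ℝ, F)) : TotalSpace F V → Type _) p₀).baseSet := by
    simpa using mem_chartAt_totalSpace_source.2 hp
  have hp' : p.proj ∈ (trivializationAt E (TangentSpace 𝓘(ℝ, E)) p₀.proj).baseSet := by
    simpa using hp.1
  rw [extChartAt_totalSpace_apply hp]
  refine Prod.ext ?_ (ContinuousLinearMap.ext fun w => ?_)
  · have h1 : (genCoord (F × E) p₀.proj p.proj a).1 = _ := continuousLinearMapAt_prod hp a.1.1 a.1.2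
    have h2 : (genCoord (E × F) p₀ p (splitMapInv D p a)).1 =
      tangentCoord p₀ p (vertical 𝓘(ℝ, E) p a.1.1 + horizontal D p a.1.2) := rfl
    rw [h1, h2, map_add, tangentCoord_vertical hp, tangentCoord_horizontal D hp]
    refine Prod.ext (zero_add _) ?_
    exact (sub_eq_add_neg _ _).symm
  · obtain ⟨ξ, hξ⟩ : ∃ ξ : TangentSpace (𝓘(ℝ, E).prod 𝓘(ℝ, F)) p, ξ = (trivializationAt (E × F)
      (TangentSpace (𝓘(ℝ, E).prod 𝓘(ℝ, F)) : TotalSpace F V → Type _) p₀).symmL ℝ p w := ⟨_, rfl⟩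
    have hw : tangentCoord p₀ p ξ = w := by
      rw [hξ]
      exact Trivialization.continuousLinearMapAt_symmL _ hb w
    have h1 : (genCoord (E × F) p₀ p (splitMapInv D p a)).2 w =
        a.2 (splitting D p ξ, projDeriv 𝓘(ℝ, E) p ξ) := by
      rw [hξ]
      rfl
    have h2 := continuousLinearMapAt_splitting D hp ξ
    have h3 := continuousLinearMapAt_projDeriv hp ξ
    rw [hw] at h2 h3
    rw [h1, ContinuousLinearMap.comp_apply]
    refine congrArg a.2 ((symmL_prod hp _ _).trans ?_).symm
    refine Prod.ext ?_ ?_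
    · refine (congrArg ((trivializationAt F V p₀.proj).symmL ℝ p.proj) h2.symm).trans ?_
      exact Trivialization.symmL_continuousLinearMapAt _ hp.2 _
    · refine (congrArg ((trivializationAt E (TangentSpace 𝓘(ℝ, E)) p₀.proj).symmL ℝ p.proj)
        h3.symm).trans ?_
      exact Trivialization.symmL_continuousLinearMapAt _ hp' _

lemma eventually_extChartAt_totalSpace (p₀ : TotalSpace F V) :
    ∀ᶠ z in 𝓝 (extChartAt (𝓘(ℝ, E).prod 𝓘(ℝ, F)) p₀ p₀),
      extChartAt (𝓘(ℝ, E).prod 𝓘(ℝ, F)) p₀ ((extChartAt (𝓘(ℝ, E).prod 𝓘(ℝ, F)) p₀).symm z) = z ∧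
      ((extChartAt (𝓘(ℝ, E).prod 𝓘(ℝ, F)) p₀).symm z).proj ∈ coordDomain E F V p₀.proj ∧
      ((extChartAt (𝓘(ℝ, E).prod 𝓘(ℝ, F)) p₀).symm z).proj =
        (extChartAt 𝓘(ℝ, E) p₀.proj).symm z.1 := by
  filter_upwards [extChartAt_target_mem_nhds (I := 𝓘(ℝ, E).prod 𝓘(ℝ, F)) p₀] with z hz
  have hp : ((extChartAt (𝓘(ℝ, E).prod 𝓘(ℝ, F)) p₀).symm z).proj ∈
      coordDomain E F V p₀.proj := by
    rw [← mem_chartAt_totalSpace_source, ← extChartAt_source (𝓘(ℝ, E).prod 𝓘(ℝ, F))]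
    exact (extChartAt (𝓘(ℝ, E).prod 𝓘(ℝ, F)) p₀).map_target hz
  have hz' := (extChartAt (𝓘(ℝ, E).prod 𝓘(ℝ, F)) p₀).right_inv hz
  refine ⟨hz', hp, ?_⟩
  rw [extChartAt_totalSpace_apply hp] at hz'
  rw [← congrArg Prod.fst hz']
  exact (extChartAt_left_inv_of_mem hp).symm

/-- Lifted sections in coordinates. -/
lemma genRep_liftSection (c : ∀ x, GenFiber (V ×ᵇ (TangentSpace 𝓘(ℝ, E) : M → Type _)) x)
    (p₀ : TotalSpace F V) :
    genRep (𝓘(ℝ, E).prod 𝓘(ℝ, F)) (E × F) (liftSection D c) p₀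
      =ᶠ[𝓝 (extChartAt (𝓘(ℝ, E).prod 𝓘(ℝ, F)) p₀ p₀)]
      liftModel (christoffel D p₀.proj) (genRep 𝓘(ℝ, E) (F × E) c p₀.proj) := by
  filter_upwards [eventually_extChartAt_totalSpace p₀] with z hz
  rw [genRep, liftSection, genCoord_splitMapInv D hz.2.1, hz.1, liftModel, genRep, hz.2.2]

lemma extChartAt_totalSpace_self_fst (p₀ : TotalSpace F V) :
    (extChartAt (𝓘(ℝ, E).prod 𝓘(ℝ, F)) p₀ p₀).1 = extChartAt 𝓘(ℝ, E) p₀.proj p₀.proj := by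
  rw [extChartAt_totalSpace_apply (mem_coordDomain_self _)]

variable [FiniteDimensional ℝ E]

lemma contDiffAt_genRep_liftSection (hD : IsSmoothConnection D)
    {c : ∀ x, GenFiber (V ×ᵇ (TangentSpace 𝓘(ℝ, E) : M → Type _)) x} {p₀ : TotalSpace F V}
    (hc : ContDiffAt ℝ ∞ (genRep 𝓘(ℝ, E) (F × E) c p₀.proj)
      (extChartAt 𝓘(ℝ, E) p₀.proj p₀.proj)) :
    ContDiffAt ℝ ∞ (genRep (𝓘(ℝ, E).prod 𝓘(ℝ, F)) (E × F) (liftSection D c) p₀)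
      (extChartAt (𝓘(ℝ, E).prod 𝓘(ℝ, F)) p₀ p₀) := by
  refine ContDiffAt.congr_of_eventuallyEq ?_ (genRep_liftSection D c p₀)
  rw [← extChartAt_totalSpace_self_fst] at hc
  refine contDiffAt_liftModel ?_ hc
  rw [extChartAt_totalSpace_self_fst]
  exact (contDiffOn_christoffel D hD p₀.proj).contDiffAt ((isOpen_coordTarget p₀.proj).mem_nhds
    (extChartAt_mem_coordTarget (mem_coordDomain_self _)))

end LiftCoordinates

/-! ### Integrability in coordinates -/

/-- Pointwise differentiability of a family of linear maps on a finite-dimensional space. -/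
lemma differentiableAt_clm_of_apply {E₁ E₂ E₃ : Type*} [NormedAddCommGroup E₁] [NormedSpace ℝ E₁]
    [NormedAddCommGroup E₂] [NormedSpace ℝ E₂] [FiniteDimensional ℝ E₂]
    [NormedAddCommGroup E₃] [NormedSpace ℝ E₃] {f : E₁ → E₂ →L[ℝ] E₃} {z : E₁}
    (h : ∀ v, DifferentiableAt ℝ (fun y => f y v) z) : DifferentiableAt ℝ f z := by
  have hd : Module.finrank ℝ E₂ = Module.finrank ℝ (Fin (Module.finrank ℝ E₂) → ℝ) :=
    (Module.finrank_fin_fun ℝ).symm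
  let e₁ := ContinuousLinearEquiv.ofFinrankEq hd
  let e₂ := (e₁.arrowCongr (1 : E₃ ≃L[ℝ] E₃)).trans
    (ContinuousLinearEquiv.piRing (Fin (Module.finrank ℝ E₂)))
  rw [← Function.id_comp f, ← e₂.symm_comp_self]
  exact e₂.symm.differentiable.differentiableAt.comp z (differentiableAt_pi.2 fun i => h _)

section EndCoordinates

variable {E : Type*} [NormedAddCommGroup E] [NormedSpace ℝ E]
  {H : Type*} [TopologicalSpace H] (I : ModelWithCorners ℝ E H) [I.Boundaryless]
  {N : Type*} [TopologicalSpace N] [ChartedSpace H N]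
  (G : Type*) [NormedAddCommGroup G] [NormedSpace ℝ G] [FiniteDimensional ℝ G]
  {W : N → Type*} [TopologicalSpace (TotalSpace G W)]
  [∀ x, AddCommGroup (W x)] [∀ x, Module ℝ (W x)] [∀ x, TopologicalSpace (W x)]
  [FiberBundle G W] [VectorBundle ℝ G W]

/-- An endomorphism of `W ⊕ W^∨` in the preferred chart and trivialization at `x₀`. -/
def endCoord (J : ∀ x : N, GenFiber W x →ₗ[ℝ] GenFiber W x) (x₀ : N) (y : E) :
    (G × (G →L[ℝ] ℝ)) →L[ℝ] (G × (G →L[ℝ] ℝ)) :=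
  LinearMap.toContinuousLinearMap (genCoord G x₀ ((extChartAt I x₀).symm y) ∘ₗ
    J ((extChartAt I x₀).symm y) ∘ₗ genCoordSymm G x₀ ((extChartAt I x₀).symm y))

variable {G} (J : ∀ x : N, GenFiber W x →ₗ[ℝ] GenFiber W x)

lemma endCoord_apply (x₀ : N) (y : E) (c : G × (G →L[ℝ] ℝ)) : endCoord I G J x₀ y c =
    genCoord G x₀ ((extChartAt I x₀).symm y) (J ((extChartAt I x₀).symm y)
      (genCoordSymm G x₀ ((extChartAt I x₀).symm y) c)) := rfl

lemma eventually_extChartAt_symm {x₀ : N} {P : N → Prop} (h : ∀ᶠ x in 𝓝 x₀, P x) :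
    ∀ᶠ y in 𝓝 (extChartAt I x₀ x₀), P ((extChartAt I x₀).symm y) := by
  have hc := continuousAt_extChartAt_symm (I := I) x₀
  rw [ContinuousAt, extChartAt_to_inv] at hc
  exact hc.eventually h

lemma eventually_symm_mem_baseSet (x₀ : N) : ∀ᶠ y in 𝓝 (extChartAt I x₀ x₀),
    (extChartAt I x₀).symm y ∈ (trivializationAt G W x₀).baseSet :=
  eventually_extChartAt_symm I
    ((trivializationAt G W x₀).open_baseSet.mem_nhds (mem_baseSet_trivializationAt' x₀))

lemma endCoord_genRep (a : ∀ x, GenFiber W x) {x₀ : N} {y : E}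
    (hy : (extChartAt I x₀).symm y ∈ (trivializationAt G W x₀).baseSet) :
    endCoord I G J x₀ y (genRep I G a x₀ y) = genRep I G (fun x => J x (a x)) x₀ y := by
  rw [endCoord_apply, genRep, genCoordSymm_genCoord hy]
  rfl

variable {J}

lemma endCoord_sq (hJ : ∀ x a, J x (J x a) = -a) {x₀ : N} {y : E}
    (hy : (extChartAt I x₀).symm y ∈ (trivializationAt G W x₀).baseSet) (c : G × (G →L[ℝ] ℝ)) :
    endCoord I G J x₀ y (endCoord I G J x₀ y c) = -c := by
  rw [endCoord_apply, endCoord_apply, genCoordSymm_genCoord hy, hJ, map_neg,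
    genCoord_genCoordSymm hy]

lemma pairL_endCoord (hJ : ∀ x a b, pairing (J x a) (J x b) = pairing a b) {x₀ : N} {y : E}
    (hy : (extChartAt I x₀).symm y ∈ (trivializationAt G W x₀).baseSet) (c c' : G × (G →L[ℝ] ℝ)) :
    pairL (endCoord I G J x₀ y c) (endCoord I G J x₀ y c') = pairL c c' := by
  rw [endCoord_apply, endCoord_apply, pairL_genCoord hy, hJ, ← pairL_genCoord hy,
    genCoord_genCoordSymm hy, genCoord_genCoordSymm hy]

end EndCoordinates

section EigenbundleCoordinates

variable {E : Type*} [NormedAddCommGroup E] [NormedSpace ℝ E] [FiniteDimensional ℝ E]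
  {H : Type*} [TopologicalSpace H] (I : ModelWithCorners ℝ E H) [I.Boundaryless]
  {N : Type*} [TopologicalSpace N] [ChartedSpace H N] [IsManifold I 1 N]
  {J : ∀ x : N, GenFiber (TangentSpace I) x →ₗ[ℝ] GenFiber (TangentSpace I) x}

/-- The condition for the Courant bracket of two sections of the eigenbundle to be a section of
the eigenbundle, in coordinates. -/
lemma inEigenbundle_complexCourant_iff (hJsq : ∀ x a, J x (J x a) = -a) {a b : ComplexGenField I N}
    {x₀ : N} (hJd : DifferentiableAt ℝ (endCoord I E J x₀) (extChartAt I x₀ x₀))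
    (ha : DifferentiableAt ℝ (genRep I E a.re x₀) (extChartAt I x₀ x₀))
    (hb : DifferentiableAt ℝ (genRep I E b.re x₀) (extChartAt I x₀ x₀))
    (hae : ∀ᶠ x in 𝓝 x₀, InEigenbundle J a x) (hbe : ∀ᶠ x in 𝓝 x₀, InEigenbundle J b x) :
    InEigenbundle J (complexCourant I a b) x₀ ↔
      torsionModel (endCoord I E J x₀) (genRep I E a.re x₀) (genRep I E b.re x₀)
        (extChartAt I x₀ x₀) = 0 := by
  have hbase : x₀ ∈ (trivializationAt E (TangentSpace I) x₀).baseSet := by simp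
  have him : ∀ c : ComplexGenField I N, (∀ᶠ x in 𝓝 x₀, InEigenbundle J c x) →
      genRep I E c.im x₀ =ᶠ[𝓝 (extChartAt I x₀ x₀)]
        -endApply (endCoord I E J x₀) (genRep I E c.re x₀) := by
    intro c hc
    filter_upwards [eventually_extChartAt_symm I hc,
      eventually_symm_mem_baseSet (G := E) (W := TangentSpace I) I x₀] with y hy hy'
    rw [Pi.neg_apply, endApply, endCoord_genRep I J c.re hy', genRep, genRep, hy.1, map_neg, neg_neg]
  have hd : ∀ c : ComplexGenField I N, (∀ᶠ x in 𝓝 x₀, InEigenbundle J c x) →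
      DifferentiableAt ℝ (genRep I E c.re x₀) (extChartAt I x₀ x₀) →
      DifferentiableAt ℝ (genRep I E c.im x₀) (extChartAt I x₀ x₀) := fun c hc h =>
    (differentiableAt_endApply hJd h).neg.congr_of_eventuallyEq (him c hc)
  have hre : genCoord E x₀ x₀ ((complexCourant I a b).re x₀) =
      courantModel (genRep I E a.re x₀) (genRep I E b.re x₀) (extChartAt I x₀ x₀) -
      courantModel (endApply (endCoord I E J x₀) (genRep I E a.re x₀))
        (endApply (endCoord I E J x₀) (genRep I E b.re x₀)) (extChartAt I x₀ x₀) := by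
    refine (map_sub (genCoord E x₀ x₀) (courant I a.re b.re x₀) (courant I a.im b.im x₀)).trans ?_
    rw [genCoord_courant I ha hb, genCoord_courant I (hd a hae ha) (hd b hbe hb),
      courantModel_congr (him a hae) (him b hbe), courantModel_neg_left, courantModel_neg_right,
      neg_neg]
  have him' : genCoord E x₀ x₀ ((complexCourant I a b).im x₀) =
      -courantModel (genRep I E a.re x₀)
        (endApply (endCoord I E J x₀) (genRep I E b.re x₀)) (extChartAt I x₀ x₀) -
      courantModel (endApply (endCoord I E J x₀) (genRep I E a.re x₀))
        (genRep I E b.re x₀) (extChartAt I x₀ x₀) := by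
    refine (map_add (genCoord E x₀ x₀) (courant I a.re b.im x₀) (courant I a.im b.re x₀)).trans ?_
    rw [genCoord_courant I ha (hd b hbe hb), genCoord_courant I (hd a hae ha) hb,
      courantModel_congr Filter.EventuallyEq.rfl (him b hbe),
      courantModel_congr (him a hae) Filter.EventuallyEq.rfl, courantModel_neg_left,
      courantModel_neg_right, sub_eq_add_neg]
  have hcoord : ∀ c : GenFiber (TangentSpace I : N → Type _) x₀, genCoord E x₀ x₀ (J x₀ c) =
      endCoord I E J x₀ (extChartAt I x₀ x₀) (genCoord E x₀ x₀ c) := by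
    intro c
    rw [endCoord_apply, extChartAt_to_inv, genCoordSymm_genCoord hbase]
  have hinj : Function.Injective (genCoord E x₀ x₀ : GenFiber (TangentSpace I : N → Type _) x₀ → _) :=
    Function.LeftInverse.injective (genCoordSymm_genCoord hbase)
  have h1 : InEigenbundle J (complexCourant I a b) x₀ ↔
      J x₀ ((complexCourant I a b).im x₀) = (complexCourant I a b).re x₀ :=
    ⟨fun h => h.2, fun h => ⟨by rw [← h, hJsq], h⟩⟩
  rw [h1, ← hinj.eq_iff, hcoord, hre, him', torsionModel, ← sub_eq_zero]
  simp only [map_sub, map_neg, map_add]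
  refine Eq.congr ?_ rfl
  abel

end EigenbundleCoordinates

/-! ### The lifted structure in coordinates -/

section LiftedStructure

variable {E : Type*} [NormedAddCommGroup E] [NormedSpace ℝ E] [FiniteDimensional ℝ E]
  {M : Type*} [TopologicalSpace M] [ChartedSpace E M] [IsManifold 𝓘(ℝ, E) ∞ M]
  {F : Type*} [NormedAddCommGroup F] [NormedSpace ℝ F] [FiniteDimensional ℝ F]
  {V : M → Type*} [TopologicalSpace (TotalSpace F V)]
  [∀ x, AddCommGroup (V x)] [∀ x, Module ℝ (V x)] [∀ x, TopologicalSpace (V x)]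
  [∀ x, IsTopologicalAddGroup (V x)] [∀ x, ContinuousSMul ℝ (V x)]
  [FiberBundle F V] [VectorBundle ℝ F V]

/-- Sections of `W ⊕ W^∨` with constant coordinates are smooth. -/
lemma smoothGenSection_genCoordSymm_const [ContMDiffVectorBundle ∞ F V 𝓘(ℝ, E)] (x₀ : M)
    (c : F × (F →L[ℝ] ℝ)) : SmoothGenSection 𝓘(ℝ, E) F
      (fun x => (genCoordSymm F x₀ x c : GenFiber V x)) (trivializationAt F V x₀).baseSet := by
  refine ⟨contMDiffOn_symmL_const x₀ c.1, fun x hx => ContMDiffAt.contMDiffWithinAt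
    ((contMDiffAt_hom_section_iff (F₁ := F) (W₁ := V) (F₂ := ℝ) (W₂ := Bundle.Trivial M ℝ)
      (x₀ := x₀) hx (by simp)).2 ?_)⟩
  refine (contMDiffAt_const (c := c.2)).congr_of_eventuallyEq ?_
  filter_upwards [(trivializationAt F V x₀).open_baseSet.mem_nhds hx] with z hz
  ext w
  have h := congrArg c.2
    (Trivialization.continuousLinearMapAt_symmL (R := ℝ) (trivializationAt F V x₀) hz w)
  simpa [genCoordSymm_apply] using h

lemma differentiableAt_endCoord [ContMDiffVectorBundle ∞ F V 𝓘(ℝ, E)]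
    {J : ∀ x : M, GenFiber V x →ₗ[ℝ] GenFiber V x}
    (hJ : IsGenAlmostComplex 𝓘(ℝ, E) F J) (x₀ : M) :
    DifferentiableAt ℝ (endCoord 𝓘(ℝ, E) F J x₀) (extChartAt 𝓘(ℝ, E) x₀ x₀) := by
  refine differentiableAt_clm_of_apply fun c => ?_
  exact ((hJ.smooth _ (trivializationAt F V x₀).open_baseSet _
    (smoothGenSection_genCoordSymm_const x₀ c)).contDiffAt_genRep 𝓘(ℝ, E)
      (trivializationAt F V x₀).open_baseSet (mem_baseSet_trivializationAt' x₀)).differentiableAt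
    (by simp)

variable [ContMDiffVectorBundle ∞ F V 𝓘(ℝ, E)] (D : CovariantDerivative 𝓘(ℝ, E) F V)
  {J : ∀ x : M, GenFiber (V ×ᵇ (TangentSpace 𝓘(ℝ, E) : M → Type _)) x →ₗ[ℝ]
    GenFiber (V ×ᵇ (TangentSpace 𝓘(ℝ, E) : M → Type _)) x}

lemma lift_sq (hJ : ∀ x a, J x (J x a) = -a) (p : TotalSpace F V)
    (a : GenFiber (TangentSpace (𝓘(ℝ, E).prod 𝓘(ℝ, F))) p) :
    lift D J p (lift D J p a) = -a := by
  rw [← splitMapInv_splitMap D p a, lift_splitMapInv, lift_splitMapInv, hJ, map_neg]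

lemma pairing_splitMapInv (p : TotalSpace F V)
    (a b : GenFiber (V ×ᵇ (TangentSpace 𝓘(ℝ, E) : M → Type _)) p.proj) :
    pairing (splitMapInv D p a) (splitMapInv D p b) = pairing a b := by
  have h : ∀ a b : GenFiber (V ×ᵇ (TangentSpace 𝓘(ℝ, E) : M → Type _)) p.proj,
      (splitMapInv D p a).2 (splitMapInv D p b).1 = a.2 b.1 := fun a b =>
    congrArg a.2 (congrArg Prod.fst (splitMap_splitMapInv D p b))
  rw [pairing, pairing, h, h]

lemma pairing_lift (hJ : ∀ x a b, pairing (J x a) (J x b) = pairing a b) (p : TotalSpace F V)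
    (a b : GenFiber (TangentSpace (𝓘(ℝ, E).prod 𝓘(ℝ, F))) p) :
    pairing (lift D J p a) (lift D J p b) = pairing a b := by
  rw [← splitMapInv_splitMap D p a, ← splitMapInv_splitMap D p b, lift_splitMapInv,
    lift_splitMapInv, pairing_splitMapInv, pairing_splitMapInv, hJ]

lemma coframeModel_frameModel (Γ : E → F →L[ℝ] E →L[ℝ] F) (z : E × F) (w : F × E) :
    coframeModel Γ z (frameModel Γ z w) = w :=
  Prod.ext (sub_add_cancel _ _) rfl

/-- The lifted structure in coordinates. -/
lemma endCoord_lift (p₀ : TotalSpace F V) (w : (E × F) × (E × F →L[ℝ] ℝ)) :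
    (fun z => endCoord (𝓘(ℝ, E).prod 𝓘(ℝ, F)) (E × F) (lift D J) p₀ z w)
      =ᶠ[𝓝 (extChartAt (𝓘(ℝ, E).prod 𝓘(ℝ, F)) p₀ p₀)] fun z =>
        (frameModel (christoffel D p₀.proj) z (endCoord 𝓘(ℝ, E) (F × E) J p₀.proj z.1
          (coframeModel (christoffel D p₀.proj) z w.1,
            w.2.comp (frameModel (christoffel D p₀.proj) z))).1,
        (endCoord 𝓘(ℝ, E) (F × E) J p₀.proj z.1 (coframeModel (christoffel D p₀.proj) z w.1,
            w.2.comp (frameModel (christoffel D p₀.proj) z))).2.comp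
          (coframeModel (christoffel D p₀.proj) z)) := by
  filter_upwards [eventually_extChartAt_totalSpace p₀,
    eventually_symm_mem_baseSet (G := E × F) (W := TangentSpace (𝓘(ℝ, E).prod 𝓘(ℝ, F)))
      (𝓘(ℝ, E).prod 𝓘(ℝ, F)) p₀] with z hz hz'
  obtain ⟨p, hp⟩ : ∃ p, p = (extChartAt (𝓘(ℝ, E).prod 𝓘(ℝ, F)) p₀).symm z := ⟨_, rfl⟩
  rw [← hp] at hz hz'
  obtain ⟨a, ha⟩ : ∃ a : GenFiber (V ×ᵇ (TangentSpace 𝓘(ℝ, E) : M → Type _)) p.proj,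
      splitMapInv D p a = genCoordSymm (E × F) p₀ p w := ⟨_, splitMapInv_splitMap D p _⟩
  have h1 := genCoord_splitMapInv D hz.2.1 a
  rw [ha, genCoord_genCoordSymm hz', hz.1] at h1
  have h2 : (coframeModel (christoffel D p₀.proj) z w.1,
      w.2.comp (frameModel (christoffel D p₀.proj) z)) = genCoord (F × E) p₀.proj p.proj a := by
    rw [h1]
    refine Prod.ext (coframeModel_frameModel _ _ _) (ContinuousLinearMap.ext fun q => ?_)
    exact congrArg (genCoord (F × E) p₀.proj p.proj a).2
      (coframeModel_frameModel (christoffel D p₀.proj) z q)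
  rw [h2, endCoord_apply, endCoord_apply, ← hp, ← hz.2.2, ← ha, lift_splitMapInv,
    genCoord_splitMapInv D hz.2.1, hz.1, genCoordSymm_genCoord (mem_baseSet_prod hz.2.1)]

lemma differentiableAt_endCoord_lift (hD : IsSmoothConnection D)
    (hJ : IsGenAlmostComplex 𝓘(ℝ, E) (F × E) J) (p₀ : TotalSpace F V) :
    DifferentiableAt ℝ (endCoord (𝓘(ℝ, E).prod 𝓘(ℝ, F)) (E × F) (lift D J) p₀)
      (extChartAt (𝓘(ℝ, E).prod 𝓘(ℝ, F)) p₀ p₀) := by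
  refine differentiableAt_clm_of_apply fun w => ?_
  refine DifferentiableAt.congr_of_eventuallyEq ?_ (endCoord_lift D p₀ w)
  have hfst := extChartAt_totalSpace_self_fst (E := E) p₀
  have hΓ : ContDiffAt ℝ ∞ (christoffel D p₀.proj)
      (extChartAt (𝓘(ℝ, E).prod 𝓘(ℝ, F)) p₀ p₀).1 := by
    rw [hfst]
    exact (contDiffOn_christoffel D hD p₀.proj).contDiffAt ((isOpen_coordTarget p₀.proj).mem_nhds
      (extChartAt_mem_coordTarget (mem_coordDomain_self _)))
  have h1 := (contDiffAt_frameModel hΓ).differentiableAt (by simp)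
  have h2 := (contDiffAt_coframeModel hΓ).differentiableAt (by simp)
  have h3 : DifferentiableAt ℝ (endCoord 𝓘(ℝ, E) (F × E) J p₀.proj)
      (extChartAt (𝓘(ℝ, E).prod 𝓘(ℝ, F)) p₀ p₀).1 := by
    rw [hfst]
    exact differentiableAt_endCoord hJ p₀.proj
  have h4 := (h3.comp _ differentiableAt_fst).clm_apply
    ((h2.clm_apply (differentiableAt_const w.1)).prodMk ((differentiableAt_const w.2).clm_comp h1))
  exact (h1.clm_apply h4.fst).prodMk (h4.snd.clm_comp h2)

end LiftedStructure

/-! ### Lifts of flat sections -/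

section FlatLifts

variable {E : Type*} [NormedAddCommGroup E] [NormedSpace ℝ E] [FiniteDimensional ℝ E]
  {M : Type*} [TopologicalSpace M] [ChartedSpace E M] [IsManifold 𝓘(ℝ, E) ∞ M]
  {F : Type*} [NormedAddCommGroup F] [NormedSpace ℝ F] [FiniteDimensional ℝ F]
  {V : M → Type*} [TopologicalSpace (TotalSpace F V)]
  [∀ x, AddCommGroup (V x)] [∀ x, Module ℝ (V x)] [∀ x, TopologicalSpace (V x)]
  [∀ x, IsTopologicalAddGroup (V x)] [∀ x, ContinuousSMul ℝ (V x)]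
  [FiberBundle F V] [VectorBundle ℝ F V] [ContMDiffVectorBundle ∞ F V 𝓘(ℝ, E)]
  {D : CovariantDerivative 𝓘(ℝ, E) F V} {U : Set M}

lemma IsFlatGenSection.smooth {σ : ∀ x, GenFiber V x} (hσ : IsFlatGenSection D σ U) :
    SmoothGenSection 𝓘(ℝ, E) F σ U :=
  ⟨hσ.1.1, hσ.2.1⟩

/-- Flat sections in coordinates. -/
lemma IsFlatGenSection.hasFDerivAt {σ : ∀ x, GenFiber V x} (hσ : IsFlatGenSection D σ U)
    (hU : IsOpen U) {x₀ : M} (hx₀ : x₀ ∈ U) :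
    HasFDerivAt (fun y => (genRep 𝓘(ℝ, E) F σ x₀ y).1)
      (-christoffel D x₀ (extChartAt 𝓘(ℝ, E) x₀ x₀)
        (genRep 𝓘(ℝ, E) F σ x₀ (extChartAt 𝓘(ℝ, E) x₀ x₀)).1) (extChartAt 𝓘(ℝ, E) x₀ x₀) ∧
    ∃ f' : E →L[ℝ] F →L[ℝ] ℝ, HasFDerivAt (fun y => -(genRep 𝓘(ℝ, E) F σ x₀ y).2) f' (extChartAt 𝓘(ℝ, E) x₀ x₀) ∧
      ∀ h w, f' h w = (-(genRep 𝓘(ℝ, E) F σ x₀ (extChartAt 𝓘(ℝ, E) x₀ x₀)).2)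
        (christoffel D x₀ (extChartAt 𝓘(ℝ, E) x₀ x₀) w h) := by
  have hd := (hσ.smooth.contDiffAt_genRep 𝓘(ℝ, E) hU hx₀).differentiableAt (by simp)
  constructor
  · have h := hσ.1.hasFDerivAt D hU hx₀
    have h0 : (genRep 𝓘(ℝ, E) F σ x₀ (extChartAt 𝓘(ℝ, E) x₀ x₀)).1 =
        (trivializationAt F V x₀).continuousLinearMapAt ℝ x₀ (σ x₀).1 :=
      congrArg (fun z' => (trivializationAt F V x₀).continuousLinearMapAt ℝ z' (σ z').1)
        (extChartAt_to_inv x₀)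
    rw [h0]
    exact h
  · have h2 : DifferentiableAt ℝ (fun y => (genRep 𝓘(ℝ, E) F σ x₀ y).2)
        (extChartAt 𝓘(ℝ, E) x₀ x₀) := hd.snd
    refine ⟨_, h2.hasFDerivAt.fun_neg, fun u w => ?_⟩
    exact congrArg (fun t : ℝ => -t) (hσ.2.hasFDerivAt D hU hx₀ (g := fun y => (genRep 𝓘(ℝ, E) F σ x₀ y).2)
      rfl h2 u w)

lemma genRep_inclFlip (σ : ∀ x, GenFiber V x) (x₀ : M) :
    genRep 𝓘(ℝ, E) (F × E) (fun x => inclFlip E x (σ x)) x₀ =ᶠ[𝓝 (extChartAt 𝓘(ℝ, E) x₀ x₀)]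
      fun y => inclFst E ((genRep 𝓘(ℝ, E) F σ x₀ y).1, -(genRep 𝓘(ℝ, E) F σ x₀ y).2) := by
  filter_upwards [eventually_extChartAt_symm 𝓘(ℝ, E)
    ((isOpen_coordDomain (E := E) (F := F) (V := V) x₀).mem_nhds (mem_coordDomain_self x₀))]
    with y hy
  exact genCoord_inclFlip hy _

lemma genRep_inclT (b : GenField 𝓘(ℝ, E) M) (x₀ : M) :
    genRep 𝓘(ℝ, E) (F × E) (fun x => inclT 𝓘(ℝ, E) V x (b x)) x₀
      =ᶠ[𝓝 (extChartAt 𝓘(ℝ, E) x₀ x₀)]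
      fun y => inclSnd F ((genRep 𝓘(ℝ, E) E b x₀ y).1, (genRep 𝓘(ℝ, E) E b x₀ y).2) := by
  filter_upwards [eventually_extChartAt_symm 𝓘(ℝ, E)
    ((isOpen_coordDomain (E := E) (F := F) (V := V) x₀).mem_nhds (mem_coordDomain_self x₀))]
    with y hy
  exact genCoord_inclT hy _

lemma contDiffAt_inclFst {E₁ : Type*} [NormedAddCommGroup E₁] [NormedSpace ℝ E₁]
    {a : E₁ → F × (F →L[ℝ] ℝ)} {z : E₁} {n : WithTop ℕ∞} (ha : ContDiffAt ℝ n a z) :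
    ContDiffAt ℝ n (fun y => inclFst E ((a y).1, -(a y).2)) z :=
  (ha.fst.prodMk contDiffAt_const).prodMk (ha.snd.neg.clm_comp contDiffAt_const)

lemma smoothGenSection_inclFlip {σ : ∀ x, GenFiber V x} (hσ : SmoothGenSection 𝓘(ℝ, E) F σ U)
    (hU : IsOpen U) : SmoothGenSection 𝓘(ℝ, E) (F × E) (fun x => inclFlip E x (σ x)) U :=
  smoothGenSection_of_contDiffAt_genRep 𝓘(ℝ, E) fun x₀ hx₀ =>
    (contDiffAt_inclFst (hσ.contDiffAt_genRep 𝓘(ℝ, E) hU hx₀)).congr_of_eventuallyEq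
      (genRep_inclFlip σ x₀)

/-- A section of `T_M ⊕ T_M^∨` is as smooth as its image in `(V ⊕ T_M) ⊕ (V ⊕ T_M)^∨`. -/
lemma contDiffAt_genRep_of_inclT {b : GenField 𝓘(ℝ, E) M} {x₀ : M} {n : WithTop ℕ∞}
    (hb : ContDiffAt ℝ n (genRep 𝓘(ℝ, E) (F × E) (fun x => inclT 𝓘(ℝ, E) V x (b x)) x₀)
      (extChartAt 𝓘(ℝ, E) x₀ x₀)) :
    ContDiffAt ℝ n (genRep 𝓘(ℝ, E) E b x₀) (extChartAt 𝓘(ℝ, E) x₀ x₀) := by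
  have h := (hb.congr_of_eventuallyEq (genRep_inclT b x₀).symm)
  refine (h.fst.snd.prodMk (h.snd.clm_comp
    (contDiffAt_const (c := ContinuousLinearMap.inr ℝ F E)))).congr_of_eventuallyEq
    (Filter.Eventually.of_forall fun y => ?_)
  exact Prod.ext rfl (ContinuousLinearMap.ext fun u => rfl)

end FlatLifts

/-! ### The torsion of the lifted structure on lifts of flat sections -/

section FlatTorsion

variable {E : Type*} [NormedAddCommGroup E] [NormedSpace ℝ E] [FiniteDimensional ℝ E]
  {M : Type*} [TopologicalSpace M] [ChartedSpace E M] [IsManifold 𝓘(ℝ, E) ∞ M]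
  {F : Type*} [NormedAddCommGroup F] [NormedSpace ℝ F] [FiniteDimensional ℝ F]
  {V : M → Type*} [TopologicalSpace (TotalSpace F V)]
  [∀ x, AddCommGroup (V x)] [∀ x, Module ℝ (V x)] [∀ x, TopologicalSpace (V x)]
  [∀ x, IsTopologicalAddGroup (V x)] [∀ x, ContinuousSMul ℝ (V x)]
  [FiberBundle F V] [VectorBundle ℝ F V] [ContMDiffVectorBundle ∞ F V 𝓘(ℝ, E)]
  {D : CovariantDerivative 𝓘(ℝ, E) F V}
  {J : ∀ x : M, GenFiber (V ×ᵇ (TangentSpace 𝓘(ℝ, E) : M → Type _)) x →ₗ[ℝ]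
    GenFiber (V ×ᵇ (TangentSpace 𝓘(ℝ, E) : M → Type _)) x}

lemma liftModel_congr {Γ : E → F →L[ℝ] E →L[ℝ] F} {c c' : E → (F × E) × (F × E →L[ℝ] ℝ)}
    {p₀ : TotalSpace F V} (h : c =ᶠ[𝓝 (extChartAt 𝓘(ℝ, E) p₀.proj p₀.proj)] c') :
    liftModel Γ c =ᶠ[𝓝 (extChartAt (𝓘(ℝ, E).prod 𝓘(ℝ, F)) p₀ p₀)] liftModel Γ c' := by
  rw [← extChartAt_totalSpace_self_fst] at h
  filter_upwards [continuousAt_fst.eventually h] with z hz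
  rw [liftModel, liftModel, hz]

/-- For lifts of flat sections, the torsion of the lifted structure is the lift of the Courant
bracket of their images under `𝓜`. -/
theorem torsionModel_lift_flat (hD : IsSmoothConnection D) (hflat : IsFlatConnection D)
    (hJ : IsGenAlmostComplex 𝓘(ℝ, E) (F × E) J) (hadapted : IsAdapted J) {U : Set M}
    (hU : IsOpen U) {σ τ : ∀ x, GenFiber V x} (hσ : IsFlatGenSection D σ U)
    (hτ : IsFlatGenSection D τ U) {p₀ : TotalSpace F V} (hp₀ : p₀.proj ∈ U) :
    torsionModel (endCoord (𝓘(ℝ, E).prod 𝓘(ℝ, F)) (E × F) (lift D J) p₀)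
      (genRep (𝓘(ℝ, E).prod 𝓘(ℝ, F)) (E × F)
        (liftSection D fun x => inclFlip E x (σ x)) p₀)
      (genRep (𝓘(ℝ, E).prod 𝓘(ℝ, F)) (E × F)
        (liftSection D fun x => inclFlip E x (τ x)) p₀)
      (extChartAt (𝓘(ℝ, E).prod 𝓘(ℝ, F)) p₀ p₀) =
    genCoord (E × F) p₀ p₀ (splitMapInv D p₀ (inclT 𝓘(ℝ, E) V p₀.proj
      (courant 𝓘(ℝ, E) (fun y => mapM (J y) (σ y)) (fun y => mapM (J y) (τ y)) p₀.proj))) := by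
  have hx := mem_coordDomain_self (E := E) (F := F) (V := V) p₀.proj
  obtain ⟨z, hz⟩ : ∃ z, z = extChartAt (𝓘(ℝ, E).prod 𝓘(ℝ, F)) p₀ p₀ := ⟨_, rfl⟩
  have hfst : z.1 = extChartAt 𝓘(ℝ, E) p₀.proj p₀.proj := by
    rw [hz, extChartAt_totalSpace_self_fst]
  have hzT : z.1 ∈ coordTarget E F V p₀.proj := hfst ▸ extChartAt_mem_coordTarget hx
  have hΓ : HasFDerivAt (christoffel D p₀.proj) (fderiv ℝ (christoffel D p₀.proj) z.1) z.1 :=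
    (((contDiffOn_christoffel D hD p₀.proj).contDiffAt
      ((isOpen_coordTarget p₀.proj).mem_nhds hzT)).differentiableAt (by simp)).hasFDerivAt
  have hcurv := christoffel_flat D hD hflat hzT
  have hMapM : ∀ σ : ∀ x, GenFiber V x, IsFlatGenSection D σ U → DifferentiableAt ℝ
      (genRep 𝓘(ℝ, E) E (fun y => mapM (J y) (σ y)) p₀.proj) z.1 := by
    intro σ hσ
    have h := (hJ.smooth U hU _ (smoothGenSection_inclFlip hσ.smooth hU)).contDiffAt_genRep
      𝓘(ℝ, E) hU hp₀
    simp only [← inclT_mapM hJ.sq hJ.orthogonal hadapted] at h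
    rw [hfst]
    exact (contDiffAt_genRep_of_inclT h).differentiableAt (by simp)
  have hrep : ∀ σ : ∀ x, GenFiber V x, genRep (𝓘(ℝ, E).prod 𝓘(ℝ, F)) (E × F)
      (liftSection D fun x => inclFlip E x (σ x)) p₀ =ᶠ[𝓝 z]
      liftModel (christoffel D p₀.proj) fun y => inclFst E
        ((genRep 𝓘(ℝ, E) F σ p₀.proj y).1, -(genRep 𝓘(ℝ, E) F σ p₀.proj y).2) := by
    intro σ
    rw [hz]
    exact (genRep_liftSection D _ p₀).trans (liftModel_congr (genRep_inclFlip σ p₀.proj))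
  have hrepT : ∀ σ : ∀ x, GenFiber V x,
      endApply (endCoord (𝓘(ℝ, E).prod 𝓘(ℝ, F)) (E × F) (lift D J) p₀)
        (genRep (𝓘(ℝ, E).prod 𝓘(ℝ, F)) (E × F)
          (liftSection D fun x => inclFlip E x (σ x)) p₀) =ᶠ[𝓝 z]
      liftModel (christoffel D p₀.proj) fun y => inclSnd F
        ((genRep 𝓘(ℝ, E) E (fun y => mapM (J y) (σ y)) p₀.proj y).1,
          (genRep 𝓘(ℝ, E) E (fun y => mapM (J y) (σ y)) p₀.proj y).2) := by
    intro σ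
    rw [hz]
    have h1 : (fun p => lift D J p (liftSection D (fun x => inclFlip E x (σ x)) p)) =
        liftSection D fun x => inclT 𝓘(ℝ, E) V x (mapM (J x) (σ x)) := by
      funext p
      rw [liftSection, lift_splitMapInv, liftSection, inclT_mapM hJ.sq hJ.orthogonal hadapted]
    refine Filter.EventuallyEq.trans ?_ ((genRep_liftSection D _ p₀).trans
      (liftModel_congr (genRep_inclT _ p₀.proj)))
    rw [← h1]
    filter_upwards [eventually_symm_mem_baseSet (G := E × F)
      (W := TangentSpace (𝓘(ℝ, E).prod 𝓘(ℝ, F))) (𝓘(ℝ, E).prod 𝓘(ℝ, F)) p₀] with y hy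
    exact endCoord_genRep _ _ _ hy
  have hσd := hσ.hasFDerivAt hU hp₀
  have hτd := hτ.hasFDerivAt hU hp₀
  rw [← hfst] at hσd hτd
  obtain ⟨hv, f', hf, hf'⟩ := hσd
  obtain ⟨hv₁, f₁', hf₁, hf₁'⟩ := hτd
  have hmixed := courantModel_lift_parallel_horizontal hΓ hcurv hv₁ hf₁ hf₁'
    (hMapM σ hσ).fst (hMapM σ hσ).snd
  rw [courantModel_swap, neg_eq_zero] at hmixed
  rw [← hz, torsionModel, courantModel_congr (hrepT σ) (hrepT τ),
    courantModel_congr (hrepT σ) (hrep τ), courantModel_congr (hrep σ) (hrepT τ),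
    courantModel_congr (hrep σ) (hrep τ), courantModel_lift_parallel hΓ hv hv₁ hf hf' hf₁ hf₁',
    courantModel_lift_parallel_horizontal hΓ hcurv hv hf hf' (hMapM τ hτ).fst (hMapM τ hτ).snd,
    hmixed, courantModel_lift_horizontal hΓ hcurv (hMapM σ hσ).fst (hMapM σ hσ).snd
      (hMapM τ hτ).fst (hMapM τ hτ).snd]
  have hcour := genCoord_courant 𝓘(ℝ, E) (x₀ := p₀.proj) (hfst ▸ hMapM σ hσ) (hfst ▸ hMapM τ hτ)
  rw [genCoord_splitMapInv D hx, genCoord_inclT hx, hcour, ← hz, liftModel, hfst]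
  simp

/-- Lifts of smooth sections are smooth. -/
lemma smoothGenSection_liftSection (hD : IsSmoothConnection D)
    {c : ∀ x, GenFiber (V ×ᵇ (TangentSpace 𝓘(ℝ, E) : M → Type _)) x} {U : Set M} (hU : IsOpen U)
    (hc : SmoothGenSection 𝓘(ℝ, E) (F × E) c U) :
    SmoothGenSection (𝓘(ℝ, E).prod 𝓘(ℝ, F)) (E × F) (liftSection D c)
      (TotalSpace.proj ⁻¹' U : Set (TotalSpace F V)) :=
  smoothGenSection_of_contDiffAt_genRep _ fun _ hp =>
    contDiffAt_genRep_liftSection D hD (hc.contDiffAt_genRep 𝓘(ℝ, E) hU hp)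

/-- The section of the eigenbundle with given real part. -/
def eigenSection {E' : Type*} [NormedAddCommGroup E'] [NormedSpace ℝ E'] {H : Type*}
    [TopologicalSpace H] {I : ModelWithCorners ℝ E' H} {N : Type*} [TopologicalSpace N]
    [ChartedSpace H N]
    (K : ∀ x : N, GenFiber (TangentSpace I) x →ₗ[ℝ] GenFiber (TangentSpace I) x)
    (r : GenField I N) : ComplexGenField I N where
  re := r
  im := fun x => -K x (r x)

lemma inEigenbundle_eigenSection {E' : Type*} [NormedAddCommGroup E'] [NormedSpace ℝ E']
    {H : Type*} [TopologicalSpace H] {I : ModelWithCorners ℝ E' H} {N : Type*} [TopologicalSpace N]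
    [ChartedSpace H N]
    {K : ∀ x : N, GenFiber (TangentSpace I) x →ₗ[ℝ] GenFiber (TangentSpace I) x}
    (hK : ∀ x a, K x (K x a) = -a) (r : GenField I N) (x : N) :
    InEigenbundle K (eigenSection K r) x :=
  ⟨(neg_neg _).symm, by simp only [eigenSection, map_neg, hK, neg_neg]⟩

lemma isEigenSection_lift (hD : IsSmoothConnection D)
    (hJ : IsGenAlmostComplex 𝓘(ℝ, E) (F × E) J) {U : Set M} (hU : IsOpen U)
    {σ : ∀ x, GenFiber V x} (hσ : SmoothGenSection 𝓘(ℝ, E) F σ U) :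
    IsEigenSection (lift D J)
      (eigenSection (lift D J) (liftSection D fun x => inclFlip E x (σ x)))
      (TotalSpace.proj ⁻¹' U : Set (TotalSpace F V)) := by
  have hneg : (fun p => -lift D J p (liftSection D (fun x => inclFlip E x (σ x)) p)) =
      liftSection D fun x => J x (inclFlip E x (-σ x)) := by
    funext p
    have h : inclFlip E p.proj (-σ p.proj) = -inclFlip E p.proj (σ p.proj) :=
      map_neg (inclV 𝓘(ℝ, E) V p.proj) ((σ p.proj).1, -(σ p.proj).2)
    rw [liftSection, lift_splitMapInv, liftSection, h, map_neg, map_neg]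
  have hσ' : SmoothGenSection 𝓘(ℝ, E) F (fun x => -σ x) U :=
    smoothGenSection_of_contDiffAt_genRep 𝓘(ℝ, E) fun x₀ hx₀ =>
      (hσ.contDiffAt_genRep 𝓘(ℝ, E) hU hx₀).neg.congr_of_eventuallyEq
        (Filter.Eventually.of_forall fun y => map_neg (genCoord F x₀ _) _)
  refine ⟨smoothGenSection_liftSection hD hU (smoothGenSection_inclFlip hσ hU), ?_,
    fun p _ => inEigenbundle_eigenSection (lift_sq D hJ.sq) _ p⟩
  change SmoothGenSection (𝓘(ℝ, E).prod 𝓘(ℝ, F)) (E × F)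
    (fun p => -lift D J p (liftSection D (fun x => inclFlip E x (σ x)) p)) _
  rw [hneg]
  exact smoothGenSection_liftSection hD hU (hJ.smooth U hU _ (smoothGenSection_inclFlip hσ' hU))

lemma splitMapInv_injective (p : TotalSpace F V) : Function.Injective (splitMapInv D p) :=
  Function.LeftInverse.injective (splitMap_splitMapInv D p)

/-- The lifted structure is integrable if and only if its torsion vanishes on lifts of flat
sections. -/
theorem isIntegrable_lift_iff (hD : IsSmoothConnection D) (hflat : IsFlatConnection D)
    (hJ : IsGenAlmostComplex 𝓘(ℝ, E) (F × E) J) (hadapted : IsAdapted J) :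
    IsIntegrable (lift D J) ↔ ∀ U : Set M, IsOpen U → ∀ σ τ : ∀ x, GenFiber V x,
      IsFlatGenSection D σ U → IsFlatGenSection D τ U → ∀ x ∈ U, courant 𝓘(ℝ, E)
        (fun y => mapM (J y) (σ y)) (fun y => mapM (J y) (τ y)) x = 0 := by
  have hsq := lift_sq D hJ.sq
  constructor
  · intro h U hU σ τ hσ hτ x hx
    obtain ⟨p₀, rfl⟩ : ∃ p₀ : TotalSpace F V, p₀.proj = x := ⟨⟨x, 0⟩, rfl⟩
    have hUX : IsOpen (TotalSpace.proj ⁻¹' U : Set (TotalSpace F V)) :=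
      hU.preimage (FiberBundle.continuous_proj F V)
    have hd : ∀ σ : ∀ x, GenFiber V x, IsFlatGenSection D σ U → DifferentiableAt ℝ
        (genRep (𝓘(ℝ, E).prod 𝓘(ℝ, F)) (E × F)
          (eigenSection (lift D J) (liftSection D fun x => inclFlip E x (σ x))).re p₀)
        (extChartAt (𝓘(ℝ, E).prod 𝓘(ℝ, F)) p₀ p₀) := fun σ hσ =>
      ((isEigenSection_lift hD hJ hU hσ.smooth).1.contDiffAt_genRep _ hUX hx).differentiableAt
        (by simp)
    have h1 := (inEigenbundle_complexCourant_iff _ hsq (differentiableAt_endCoord_lift D hD hJ p₀)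
      (hd σ hσ) (hd τ hτ) (Filter.Eventually.of_forall (inEigenbundle_eigenSection hsq _))
      (Filter.Eventually.of_forall (inEigenbundle_eigenSection hsq _))).1
      (h _ hUX _ _ (isEigenSection_lift hD hJ hU hσ.smooth)
        (isEigenSection_lift hD hJ hU hτ.smooth) p₀ hx)
    have h2 := (torsionModel_lift_flat hD hflat hJ hadapted hU hσ hτ hx).symm.trans h1
    have hbase : p₀ ∈ (trivializationAt (E × F) (TangentSpace (𝓘(ℝ, E).prod 𝓘(ℝ, F)) :
      TotalSpace F V → Type _) p₀).baseSet := by simp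
    have h3 := congrArg (genCoordSymm (E × F)
      (W := (TangentSpace (𝓘(ℝ, E).prod 𝓘(ℝ, F)) : TotalSpace F V → Type _)) p₀ p₀) h2
    rw [genCoordSymm_genCoord hbase, map_zero] at h3
    refine inclT_injective (V := V) (splitMapInv_injective (D := D) p₀ ?_)
    rw [h3, map_zero, map_zero]
  · intro h U hU a b ha hb p₀ hp₀
    have hd : ∀ a : ComplexGenField (𝓘(ℝ, E).prod 𝓘(ℝ, F)) (TotalSpace F V),
        IsEigenSection (lift D J) a U → DifferentiableAt ℝ
        (genRep (𝓘(ℝ, E).prod 𝓘(ℝ, F)) (E × F) a.re p₀)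
        (extChartAt (𝓘(ℝ, E).prod 𝓘(ℝ, F)) p₀ p₀) := fun a ha =>
      (ha.1.contDiffAt_genRep _ hU hp₀).differentiableAt (by simp)
    have hJd := differentiableAt_endCoord_lift D hD hJ p₀
    have hself : (extChartAt (𝓘(ℝ, E).prod 𝓘(ℝ, F)) p₀).symm
        (extChartAt (𝓘(ℝ, E).prod 𝓘(ℝ, F)) p₀ p₀) = p₀ := extChartAt_to_inv p₀
    have hbase := (eventually_symm_mem_baseSet (G := E × F)
      (W := TangentSpace (𝓘(ℝ, E).prod 𝓘(ℝ, F))) (𝓘(ℝ, E).prod 𝓘(ℝ, F)) p₀)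
    rw [inEigenbundle_complexCourant_iff _ hsq hJd (hd a ha) (hd b hb)
      (Filter.eventually_of_mem (hU.mem_nhds hp₀) ha.2.2)
      (Filter.eventually_of_mem (hU.mem_nhds hp₀) hb.2.2)]
    refine torsionModel_eq_zero_of_span hJd
      (hbase.mono fun y hy => endCoord_sq _ hsq hy)
      (pairL_endCoord _ (pairing_lift D hJ.orthogonal) hbase.self_of_nhds)
      {r | ∃ U : Set M, IsOpen U ∧ p₀.proj ∈ U ∧ ∃ σ, IsFlatGenSection D σ U ∧
        r = genRep (𝓘(ℝ, E).prod 𝓘(ℝ, F)) (E × F)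
          (liftSection D fun x => inclFlip E x (σ x)) p₀} ?_ ?_ ?_ (hd a ha) (hd b hb)
    · rintro _ ⟨U', hU', hx, σ, hσ, rfl⟩
      exact (contDiffAt_genRep_liftSection D hD ((smoothGenSection_inclFlip hσ.smooth
        hU').contDiffAt_genRep 𝓘(ℝ, E) hU' hx)).differentiableAt (by simp)
    · intro w
      obtain ⟨c, hc⟩ : ∃ c : GenFiber (V ×ᵇ (TangentSpace 𝓘(ℝ, E) : M → Type _)) p₀.proj,
        splitMapInv D p₀ c = genCoordSymm (E × F) p₀ p₀ w := ⟨_, splitMapInv_splitMap D p₀ _⟩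
      obtain ⟨a₁, b₁, hab⟩ := exists_eq_inclFlip_add hadapted c
      obtain ⟨U₁, hU₁, hx₁, σ, hσ, hσ₀⟩ := exists_flatGenSection D hD hflat p₀.proj a₁
      obtain ⟨U₂, hU₂, hx₂, τ, hτ, hτ₀⟩ := exists_flatGenSection D hD hflat p₀.proj b₁
      refine ⟨_, ⟨U₁, hU₁, hx₁, σ, hσ, rfl⟩, _, ⟨U₂, hU₂, hx₂, τ, hτ, rfl⟩, ?_⟩
      have hb0 := hbase.self_of_nhds
      rw [endCoord_genRep _ _ _ hb0, genRep, genRep, hself, ← map_add, liftSection, liftSection,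
        lift_splitMapInv, ← map_add, hσ₀, hτ₀, ← hab, hc]
      rw [hself] at hb0
      exact (genCoord_genCoordSymm hb0 w).symm
    · rintro _ ⟨U₁, hU₁, hx₁, σ, hσ, rfl⟩ _ ⟨U₂, hU₂, hx₂, τ, hτ, rfl⟩
      rw [torsionModel_lift_flat hD hflat hJ hadapted (hU₁.inter hU₂) (hσ.mono D inter_subset_left)
        (hτ.mono D inter_subset_right) ⟨hx₁, hx₂⟩, h _ (hU₁.inter hU₂) σ τ
        (hσ.mono D inter_subset_left) (hτ.mono D inter_subset_right) _ ⟨hx₁, hx₂⟩, map_zero, map_zero,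
        map_zero]

end FlatTorsion

end

end SemiFlat

theorem mainTheorem1
    (n : ℕ)
    {E : Type*} [NormedAddCommGroup E] [NormedSpace ℝ E] [FiniteDimensional ℝ E]
    {M : Type*} [TopologicalSpace M] [T2Space M] [SecondCountableTopology M]
    [ChartedSpace E M] [IsManifold 𝓘(ℝ, E) ∞ M]
    {F : Type*} [NormedAddCommGroup F] [NormedSpace ℝ F] [FiniteDimensional ℝ F]
    {V : M → Type*} [TopologicalSpace (TotalSpace F V)]
    [∀ x, AddCommGroup (V x)] [∀ x, Module ℝ (V x)] [∀ x, TopologicalSpace (V x)]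
    [∀ x, IsTopologicalAddGroup (V x)] [∀ x, ContinuousSMul ℝ (V x)]
    [FiberBundle F V] [VectorBundle ℝ F V] [ContMDiffVectorBundle ∞ F V 𝓘(ℝ, E)]
    (hdim : Module.finrank ℝ E = n) (hrank : Module.finrank ℝ F = n)
    (D : CovariantDerivative 𝓘(ℝ, E) F V)
    (hsmooth : SemiFlat.IsSmoothConnection D) (hflat : SemiFlat.IsFlatConnection D)
    (J : ∀ x : M, SemiFlat.GenFiber (V ×ᵇ (TangentSpace 𝓘(ℝ, E) : M → Type _)) x →ₗ[ℝ]
      SemiFlat.GenFiber (V ×ᵇ (TangentSpace 𝓘(ℝ, E) : M → Type _)) x)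
    (hJ : SemiFlat.IsGenAlmostComplex 𝓘(ℝ, E) (F × E) J)
    (hadapted : SemiFlat.IsAdapted J) :
    SemiFlat.IsIntegrable (SemiFlat.lift D J) ↔
      ∀ U : Set M, IsOpen U → ∀ σ τ : ∀ x, SemiFlat.GenFiber V x,
        SemiFlat.IsFlatGenSection D σ U → SemiFlat.IsFlatGenSection D τ U →
        ∀ x ∈ U, SemiFlat.courant 𝓘(ℝ, E)
          (fun y => SemiFlat.mapM (J y) (σ y)) (fun y => SemiFlat.mapM (J y) (τ y)) x = 0 :=
  SemiFlat.isIntegrable_lift_iff hsmooth hflat hJ hadapted
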